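/- For each $n\ge 1$ let $X_1,\dots,X_n$ be i.i.d. $N(\mu,\Sigma)$ random vectors in $\mathbb R^p$, where $p=p_n\ge1$, the mean $\mu=\mu_n$, the covariance matrix $\Sigma=\Sigma_n=(\sigma_{ij})_{1\le i,j\le p}$ and the integer $0\le\tau=\tau_n<p$ may all depend on $n$. Put $N=\lfloor n/2\rfloor$, $\bar X^1=\frac1N\sum_{i=1}^N X_i$, $\bar X^2=\frac1N\sum_{i=N+1}^{2N}X_i$ and, for $1\le i\le N$, $$Y_i^*=(X_i-\bar X^1)(X_i-\bar X^1)^T,\qquad Y_{N+i}^*=(X_{N+i}-\bar X^2)(X_{N+i}-\bar X^2)^T .$$ For a $p\times p$ matrix $M$ let $M^{(\tau)}$ have the entries $M_{ij}\,I(|i-j|\ge\tau)$ and let $M^{[\tau]}$ have the entries $$M_{ij}\bigl\{I\bigl(i\le\tfrac{p-\tau}2,\ j>\tfrac{p+\tau}2\bigr)+I\bigl(j\le\tfrac{p-\tau}2,\ i>\tfrac{p+\tau}2\bigr)\bigr\}.$$ With $\mathbf 1_p=(1,\dots,1)^T\in\mathbb R^p$ and a $p\times p$ matrix $S$ put $$e_i^{*\prime}(S)=\operatorname{tr}\Bigl(\bigl(Y_i^{*(\tau)}-\tfrac{N-1}NS^{(\tau)}\bigr)\bigl(Y_{N+i}^{*(\tau)}-\tfrac{N-1}NS^{(\tau)}\bigr)\Bigr),\qquad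 \tilde v_i^{*\prime}(S)=\mathbf 1_p^T\Bigl(Y_i^{*[\tau]}+Y_{N+i}^{*[\tau]}-\tfrac{2(N-1)}NS^{[\tau]}\Bigr)\mathbf 1_p ,$$ $$L_5(S)=\sup\Bigl\{\prod_{i=1}^N(Np_i):\ p_i\ge0,\ \sum_{i=1}^Np_i=1,\ \sum_{i=1}^Np_i\bigl(e_i^{*\prime}(S),\tilde v_i^{*\prime}(S)\bigr)=(0,0)\Bigr\},$$ where $\sup\emptyset=0$ and $-2\log0=+\infty$. Put also $\tilde v_i'(\Sigma)=\mathbf 1_p^T\bigl(Y_i^{[\tau]}+Y_{N+i}^{[\tau]}-2\Sigma^{[\tau]}\bigr)\mathbf 1_p$ with $Y_i=(X_i-\mu)(X_i-\mu)^T$. **Theorem.** Suppose that there are constants $0<C_1\le C_2<\infty$ with $$C_1\le\liminf_{n\to\infty}\min_{1\le i\le p}\sigma_{ii}\le\limsup_{n\to\infty}\max_{1\le i\le p}\sigma_{ii}\le C_2,$$ that $\tau=o\bigl((\sum_{1\le i,j\le p}\sigma_{ij}^2)^{1/2}\bigr)$ as $n\to\infty$, and that $\mathrm E[\tilde v_1'(\Sigma)^2]>0$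 for all sufficiently large $n$. If the null hypothesis $H_0:\ \sigma_{ij}=0$ for all $|i-j|\ge\tau$ holds for every $n$, then for any $p\times p$ matrices $\Sigma_0=\Sigma_{0,n}$ with $\Sigma_0^{(\tau)}=0$, $-2\log L_5(\Sigma_0)$ converges in distribution, as $n\to\infty$, to a chi-square distribution with two degrees of freedom. -/

import Mathlib

open MeasureTheory ProbabilityTheory Filter Topology Asymptotics

noncomputable section

namespace BandTest

/-- The chi-square distribution with `k` degrees of freedom: the law of `z₁² + ⋯ + z_k²` for
independent standard normal `z₁, …, z_k`. -/
def chiSquared (k : ℕ) : Measure ℝ :=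
  (Measure.pi fun _ : Fin k => gaussianReal 0 1).map fun z => ∑ i, z i ^ 2

instance isProbabilityMeasure_chiSquared (k : ℕ) : IsProbabilityMeasure (chiSquared k) :=
  Measure.isProbabilityMeasure_map
    (Finset.measurable_sum _ fun i _ => (measurable_pi_apply i).pow_const 2).aemeasurable

/-- `M^{(τ)}`: the entries of `M` with `|i - j| ≥ τ`, the other entries being replaced by `0`. -/
def offBand {p : ℕ} (τ : ℕ) (M : Matrix (Fin p) (Fin p) ℝ) : Matrix (Fin p) (Fin p) ℝ :=
  Matrix.of fun i j => if (τ : ℤ) ≤ |(i : ℤ) - (j : ℤ)| then M i j else 0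

/-- `M^{[τ]}`: the entries of `M` with `i ≤ (p - τ)/2, j > (p + τ)/2` or
`j ≤ (p - τ)/2, i > (p + τ)/2`, the other entries being replaced by `0`. The indices of the
mathematical text run from `1` to `p`, those of `Fin p` from `0` to `p - 1`. -/
def corner {p : ℕ} (τ : ℕ) (M : Matrix (Fin p) (Fin p) ℝ) : Matrix (Fin p) (Fin p) ℝ :=
  Matrix.of fun i j =>
    if ((((i : ℕ) : ℝ) + 1 ≤ ((p : ℝ) - τ) / 2 ∧ ((p : ℝ) + τ) / 2 < ((j : ℕ) : ℝ) + 1) ∨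
        (((j : ℕ) : ℝ) + 1 ≤ ((p : ℝ) - τ) / 2 ∧ ((p : ℝ) + τ) / 2 < ((i : ℕ) : ℝ) + 1))
    then M i j else 0

/-- `(x - m)(x - m)ᵀ`. -/
def outer {p : ℕ} (m x : EuclideanSpace ℝ (Fin p)) : Matrix (Fin p) (Fin p) ℝ :=
  Matrix.of fun i j => (x i - m i) * (x j - m j)

/-- `𝟏ᵀ M 𝟏`. -/
def oneFormOne {p : ℕ} (M : Matrix (Fin p) (Fin p) ℝ) : ℝ :=
  ∑ i, ∑ j, M i j

/-- The first subsample `x₁, …, x_N`, where `N = ⌊n/2⌋`. -/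
def firstHalf {n p : ℕ} (x : Fin n → EuclideanSpace ℝ (Fin p)) :
    Fin (n / 2) → EuclideanSpace ℝ (Fin p) :=
  fun i => x ⟨i, by omega⟩

/-- The second subsample `x_{N+1}, …, x_{2N}`, where `N = ⌊n/2⌋`. -/
def secondHalf {n p : ℕ} (x : Fin n → EuclideanSpace ℝ (Fin p)) :
    Fin (n / 2) → EuclideanSpace ℝ (Fin p) :=
  fun i => x ⟨n / 2 + i, by omega⟩

/-- The mean of a sample. -/
def sampleMean {N p : ℕ} (x : Fin N → EuclideanSpace ℝ (Fin p)) : EuclideanSpace ℝ (Fin p) :=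
  (N : ℝ)⁻¹ • ∑ i, x i

/-- `Y*_i` for a sample of size `N`: the outer product of the observation centred at the
sample mean. -/
def centeredOuter {N p : ℕ} (x : Fin N → EuclideanSpace ℝ (Fin p)) (i : Fin N) :
    Matrix (Fin p) (Fin p) ℝ :=
  outer (sampleMean x) (x i)

/-- `e*'_i(S) = tr((Y*_i^{(τ)} - ((N-1)/N) S^{(τ)}) (Y*_{N+i}^{(τ)} - ((N-1)/N) S^{(τ)}))`, where
`N = ⌊n/2⌋`. -/
def eStar {n p : ℕ} (τ : ℕ) (S : Matrix (Fin p) (Fin p) ℝ)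
    (x : Fin n → EuclideanSpace ℝ (Fin p)) (i : Fin (n / 2)) : ℝ :=
  let N : ℝ := ((n / 2 : ℕ) : ℝ)
  Matrix.trace
    ((offBand τ (centeredOuter (firstHalf x) i) - ((N - 1) / N) • offBand τ S) *
      (offBand τ (centeredOuter (secondHalf x) i) - ((N - 1) / N) • offBand τ S))

/-- `ṽ*'_i(S) = 𝟏ᵀ (Y*_i^{[τ]} + Y*_{N+i}^{[τ]} - (2(N-1)/N) S^{[τ]}) 𝟏`, where `N = ⌊n/2⌋`. -/
def vStar {n p : ℕ} (τ : ℕ) (S : Matrix (Fin p) (Fin p) ℝ)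
    (x : Fin n → EuclideanSpace ℝ (Fin p)) (i : Fin (n / 2)) : ℝ :=
  let N : ℝ := ((n / 2 : ℕ) : ℝ)
  oneFormOne
    (corner τ (centeredOuter (firstHalf x) i) + corner τ (centeredOuter (secondHalf x) i) -
      (2 * (N - 1) / N) • corner τ S)

/-- `ṽ'_i(S) = 𝟏ᵀ (Y_i^{[τ]} + Y_{N+i}^{[τ]} - 2 S^{[τ]}) 𝟏`, where `N = ⌊n/2⌋` and
`Y_i = (x_i - m)(x_i - m)ᵀ` is centred at the true mean `m`. -/
def vKnown {n p : ℕ} (τ : ℕ) (m : EuclideanSpace ℝ (Fin p)) (S : Matrix (Fin p) (Fin p) ℝ)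
    (x : Fin n → EuclideanSpace ℝ (Fin p)) (i : Fin (n / 2)) : ℝ :=
  oneFormOne
    (corner τ (outer m (firstHalf x i)) + corner τ (outer m (secondHalf x i)) -
      (2 : ℝ) • corner τ S)

/-- The empirical likelihood ratio of `R₁, …, R_N ∈ ℝ²`: the supremum of `∏ (N w_i)` over all
weights `w_i ≥ 0` with `∑ w_i = 1` and `∑ w_i R_i = 0`. It is `0` if there are no such weights. -/
def elRatio {N : ℕ} (R : Fin N → ℝ × ℝ) : ENNReal :=
  ⨆ w ∈ {w : Fin N → ℝ | (∀ i, 0 ≤ w i) ∧ ∑ i, w i = 1 ∧ ∑ i, w i • R i = 0},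
    ENNReal.ofReal (∏ i, (N : ℝ) * w i)

/-- The statistic `L₅(S)` of the sample `x₁, …, x_n`. -/
def L5 {n p : ℕ} (τ : ℕ) (S : Matrix (Fin p) (Fin p) ℝ)
    (x : Fin n → EuclideanSpace ℝ (Fin p)) : ENNReal :=
  elRatio fun i => (eStar τ S x i, vStar τ S x i)

end BandTest

end

/-! ### Deterministic second-order expansion of the empirical likelihood ratio. -/

namespace BandTest

/-! Let A be the indicator matrix of |j - k| ≥ τ and B that of the two corner blocks. The null
hypothesis says that A vanishes wherever Σ does not, and the corners lie off the band, so the same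
holds for B. The matrix Σ₀ drops out for the same reason. The estimating functions become forms in
the data: e_i = ∑ A_jk x_j x_k y_j y_k and v_i = ∑ B_jk (x_j x_k + y_j y_k), where x and y are the
ith observations of the two halves, centred at their sample means.

Suppose first that the true mean is used for centring. Then the pairs (e_i, v_i) are independent,
centred, and e_i is uncorrelated with v_i, by Wick's formula and A_jk Σ_jk = B_jk Σ_jk = 0. Their
fourth moments are at most a universal constant times the squared variances, whatever p and Σ are.
Indeed a Gaussian quadratic form diagonalizes to ∑ l_i z_i², bounded kurtosis passes to sums of
independent centred variables, and by conditioning it passes to forms that are quadratic in each of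
two independent vectors. Dividing by standard deviations does not change the empirical likelihood
ratio (`elRatio_div`), so the pairs may be taken to have identity covariance and bounded fourth
moments. The central limit theorem then holds with no relation between p and n
(`tendsto_integral_chiSquared`).

Centring at the sample mean replaces an observation by a linear combination of observations whose
coefficients are a row of I - 11ᵀ/N. If Q_α denotes either statistic evaluated at the combination
with coefficients α, then E[Q_α Q_β] = (α·β)^k Var, with k = 4 for e and k = 2 for v. Hence the
normalized centring errors d_i have E[d_i d_j] = δ_ij - (δ_ij - 1/N)^k exactly
(`integral_centring_mul`). This is nonpositive for i ≠ j, so E(∑ d_i)² ≤ k, which is negligible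
against the N of the main sum.

The likelihood part is deterministic (`exists_neg_two_mul_log_elRatio`). A dual vector bounds the
ratio above, and explicit feasible weights bound it below. Both give -2 log of the ratio ≈ t₁² +
t₂², with t the standardized sum, as soon as the second moment matrix is near the identity and no
observation is large compared with √N. All the errors are collected in `remainder`, whose
expectation is O(1/N). Truncation and uniform continuity then transfer the limit law. -/

lemma log_one_add_ge {x : ℝ} (hx : |x| ≤ 1 / 2) :
    x - x ^ 2 / 2 - 2 * |x| ^ 3 ≤ Real.log (1 + x) := by
  have h1 : |(-x)| < 1 := by rw [abs_neg]; linarith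
  have h := Real.abs_log_sub_add_sum_range_le h1 2
  simp only [Finset.sum_range_succ, Finset.sum_range_zero, abs_neg] at h
  have h2 : |x| ^ (2 + 1) / (1 - |x|) ≤ 2 * |x| ^ 3 := by
    rw [div_le_iff₀ (by linarith)]
    have : 0 ≤ |x| ^ 3 := by positivity
    norm_num
    nlinarith
  have h3 := (abs_le.1 (h.trans h2)).1
  have h4 : (1 - -x) = 1 + x := by ring
  rw [h4] at h3
  norm_num at h3
  linarith

/-- Sums of `log (1 + xᵢ)` for uniformly small `xᵢ`. -/
lemma sum_log_one_add_ge {N : ℕ} (x : Fin N → ℝ) {η : ℝ} (hη : η ≤ 1 / 2)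
    (hx : ∀ i, |x i| ≤ η) :
    ∑ i, x i - (1 / 2 + 2 * η) * ∑ i, x i ^ 2 ≤ ∑ i, Real.log (1 + x i) := by
  rw [Finset.mul_sum, ← Finset.sum_sub_distrib]
  refine Finset.sum_le_sum fun i _ => ?_
  have h := log_one_add_ge ((hx i).trans hη)
  have h3 : |x i| ^ 3 = |x i| * x i ^ 2 := by rw [pow_succ, sq_abs]; ring
  have : |x i| * x i ^ 2 ≤ η * x i ^ 2 := mul_le_mul_of_nonneg_right (hx i) (sq_nonneg _)
  rw [h3] at h
  linarith

/-- An upper bound on the empirical likelihood ratio from a dual vector. -/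
lemma elRatio_le {N : ℕ} (R : Fin N → ℝ × ℝ) (l₁ l₂ : ℝ)
    (h : ∀ i, 0 < 1 + (l₁ * (R i).1 + l₂ * (R i).2)) :
    elRatio R ≤
      ENNReal.ofReal (Real.exp (-∑ i, Real.log (1 + (l₁ * (R i).1 + l₂ * (R i).2)))) := by
  refine iSup₂_le fun w hw => ENNReal.ofReal_le_ofReal ?_
  obtain ⟨hw0, hw1, hwR⟩ := hw
  have hR1 : ∑ i, w i * (R i).1 = 0 := by
    have := congrArg Prod.fst hwR; simpa [Prod.fst_sum] using this
  have hR2 : ∑ i, w i * (R i).2 = 0 := by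
    have := congrArg Prod.snd hwR; simpa [Prod.snd_sum] using this
  -- This is the arithmetic–geometric mean inequality: t ≤ exp (t - 1) for every factor, and the
  -- constraints on the weights make the exponents sum to zero.
  have hprod : ∏ i, ((N : ℝ) * w i * (1 + (l₁ * (R i).1 + l₂ * (R i).2))) ≤ 1 := by
    calc ∏ i, ((N : ℝ) * w i * (1 + (l₁ * (R i).1 + l₂ * (R i).2)))
        ≤ ∏ i, Real.exp ((N : ℝ) * w i * (1 + (l₁ * (R i).1 + l₂ * (R i).2)) - 1) := by
          refine Finset.prod_le_prod (fun i _ => ?_) fun i _ => ?_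
          · exact mul_nonneg (mul_nonneg (Nat.cast_nonneg _) (hw0 i)) (h i).le
          · have := Real.add_one_le_exp
              ((N : ℝ) * w i * (1 + (l₁ * (R i).1 + l₂ * (R i).2)) - 1)
            linarith
      _ = 1 := by
          rw [← Real.exp_sum, Real.exp_eq_one_iff, Finset.sum_sub_distrib]
          have : ∑ i, (N : ℝ) * w i * (1 + (l₁ * (R i).1 + l₂ * (R i).2)) =
              N * ∑ i, w i + N * l₁ * ∑ i, w i * (R i).1 + N * l₂ * ∑ i, w i * (R i).2 := by
            simp only [Finset.mul_sum, ← Finset.sum_add_distrib]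
            exact Finset.sum_congr rfl fun i _ => by ring
          rw [this, hw1, hR1, hR2]
          simp
  rw [Finset.prod_mul_distrib] at hprod
  rw [Real.exp_neg, Real.exp_sum, ← one_div,
    Finset.prod_congr rfl fun i _ => Real.exp_log (h i)]
  rw [le_div_iff₀ (Finset.prod_pos fun i _ => h i)]
  exact hprod

/-- A lower bound on the empirical likelihood ratio from weights `(1 + xᵢ) / N`. -/
lemma le_elRatio {N : ℕ} (hN : 0 < N) (R : Fin N → ℝ × ℝ) (x : Fin N → ℝ)
    (hx : ∀ i, 0 < 1 + x i) (hx0 : ∑ i, x i = 0)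
    (h1 : ∑ i, (1 + x i) * (R i).1 = 0) (h2 : ∑ i, (1 + x i) * (R i).2 = 0) :
    ENNReal.ofReal (Real.exp (∑ i, Real.log (1 + x i))) ≤ elRatio R := by
  have hN' : (N : ℝ) ≠ 0 := by positivity
  have key : ENNReal.ofReal (∏ i, (N : ℝ) * ((N : ℝ)⁻¹ * (1 + x i))) ≤ elRatio R := by
    refine le_iSup₂_of_le (fun i => (N : ℝ)⁻¹ * (1 + x i)) ⟨fun i => ?_, ?_, ?_⟩ le_rfl
    · have := (hx i).le; positivity
    · rw [← Finset.mul_sum, Finset.sum_add_distrib, hx0]; simp [hN']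
    · simp only [mul_smul, ← Finset.smul_sum]
      have : ∑ i, (1 + x i) • R i = 0 := by
        ext
        · simpa [Prod.fst_sum] using h1
        · simpa [Prod.snd_sum] using h2
      rw [this, smul_zero]
  rwa [Real.exp_sum, Finset.prod_congr rfl fun i _ => Real.exp_log (hx i),
    ← Finset.prod_congr rfl fun i _ => mul_inv_cancel_left₀ hN' (1 + x i)]

/-- If the empirical likelihood ratio is bracketed by exponentials, then minus twice its logarithm
is a real number between the exponents. -/
lemma exists_neg_two_mul_log_eq {L : ENNReal} {a b : ℝ}
    (ha : ENNReal.ofReal (Real.exp (-(a / 2))) ≤ L)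
    (hb : L ≤ ENNReal.ofReal (Real.exp (-(b / 2)))) :
    ∃ r : ℝ, -2 * ENNReal.log L = (r : EReal) ∧ b ≤ r ∧ r ≤ a := by
  have hL : L ≠ ⊤ := (hb.trans_lt ENNReal.ofReal_lt_top).ne
  have hpos : 0 < L := lt_of_lt_of_le (by simpa using Real.exp_pos _) ha
  have hp' := ENNReal.toReal_pos hpos.ne' hL
  refine ⟨-2 * Real.log L.toReal, ?_, ?_, ?_⟩
  · rw [ENNReal.log_pos_real hpos.ne' hL, EReal.coe_mul, EReal.coe_neg]; rfl
  · have := (ENNReal.le_ofReal_iff_toReal_le hL (Real.exp_pos _).le).1 hb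
    have := (Real.log_le_iff_le_exp hp').2 this
    linarith
  · have := (ENNReal.ofReal_le_iff_le_toReal hL).1 ha
    have := (Real.le_log_iff_exp_le hp').2 this
    linarith

/-- A perturbed identity system of two linear equations. -/
lemma exists_solution_near {A B D t₁ t₂ C ε : ℝ} (hA : |A - 1| ≤ ε) (hB : |B| ≤ ε)
    (hD : |D - 1| ≤ ε) (hε : ε ≤ 1 / 8) (h₁ : |t₁| ≤ C) (h₂ : |t₂| ≤ C) :
    ∃ b₁ b₂ : ℝ, A * b₁ + B * b₂ = t₁ ∧ B * b₁ + D * b₂ = t₂ ∧ |b₁| ≤ 2 * C ∧ |b₂| ≤ 2 * C ∧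
      |b₁ - t₁| ≤ 4 * C * ε ∧ |b₂ - t₂| ≤ 4 * C * ε := by
  have hε0 : 0 ≤ ε := (abs_nonneg _).trans hB
  have hΔ : 0 < A * D - B * B := by
    rw [abs_le] at hA hB hD; nlinarith
  set b₁ := (D * t₁ - B * t₂) / (A * D - B * B) with hb₁
  set b₂ := (A * t₂ - B * t₁) / (A * D - B * B) with hb₂
  have e₁ : A * b₁ + B * b₂ = t₁ := by
    rw [hb₁, hb₂, ← mul_div_assoc, ← mul_div_assoc, ← add_div, div_eq_iff hΔ.ne']; ring
  have e₂ : B * b₁ + D * b₂ = t₂ := by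
    rw [hb₁, hb₂, ← mul_div_assoc, ← mul_div_assoc, ← add_div, div_eq_iff hΔ.ne']; ring
  -- The solution is compared with the right-hand side through the equations themselves, so that no
  -- bound on the inverse determinant is needed.
  have d₁ : |b₁ - t₁| ≤ ε * |b₁| + ε * |b₂| := by
    have : b₁ - t₁ = -((A - 1) * b₁ + B * b₂) := by rw [← e₁]; ring
    rw [this, abs_neg]
    refine (abs_add_le _ _).trans ?_
    rw [abs_mul, abs_mul]
    gcongr
  have d₂ : |b₂ - t₂| ≤ ε * |b₁| + ε * |b₂| := by
    have : b₂ - t₂ = -(B * b₁ + (D - 1) * b₂) := by rw [← e₂]; ring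
    rw [this, abs_neg]
    refine (abs_add_le _ _).trans ?_
    rw [abs_mul, abs_mul]
    gcongr
  have m₁ : |b₁| ≤ |t₁| + |b₁ - t₁| := by
    have := abs_add_le t₁ (b₁ - t₁); rwa [add_sub_cancel] at this
  have m₂ : |b₂| ≤ |t₂| + |b₂ - t₂| := by
    have := abs_add_le t₂ (b₂ - t₂); rwa [add_sub_cancel] at this
  have k₁ := abs_nonneg b₁
  have k₂ := abs_nonneg b₂
  have hC : 0 ≤ C := (abs_nonneg _).trans h₁
  have s₁ := mul_le_mul_of_nonneg_right hε k₁
  have s₂ := mul_le_mul_of_nonneg_right hε k₂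
  -- With s = |b₁| + |b₂| the bounds so far add up to s ≤ 2C + 2εs ≤ 2C + s/4.
  have s : |b₁| + |b₂| ≤ 8 / 3 * C := by linarith
  have hs : ε * |b₁| + ε * |b₂| ≤ 8 / 3 * C * ε := by
    have := mul_le_mul_of_nonneg_left s hε0; linarith
  have hs' : 8 / 3 * C * ε ≤ C / 3 := by
    have := mul_le_mul_of_nonneg_left hε hC; linarith
  have hs'' : 8 / 3 * C * ε ≤ 4 * C * ε := by have := mul_nonneg hC hε0; linarith
  exact ⟨b₁, b₂, e₁, e₂, by linarith, by linarith, by linarith, by linarith⟩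

set_option maxHeartbeats 800000 in
/-- Second-order expansion of minus twice the logarithm of the empirical likelihood ratio: it is
close to the squared norm of the standardized sum when the second moment matrix is close to the
identity and the observations are uniformly small compared with the square root of their number. -/
theorem exists_neg_two_mul_log_elRatio {N : ℕ} {a b : Fin N → ℝ} {m t₁ t₂ C δ : ℝ} (hm : 0 < m)
    (hmN : m ^ 2 = N) (hC : 1 ≤ C) (hδ0 : 0 < δ) (hδ : C * δ ≤ 1 / 16)
    (ha : ∑ i, a i = m * t₁) (hb : ∑ i, b i = m * t₂) (ht₁ : |t₁| ≤ C) (ht₂ : |t₂| ≤ C)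
    (hai : ∀ i, |a i| ≤ δ * m) (hbi : ∀ i, |b i| ≤ δ * m)
    (haa : |∑ i, a i ^ 2 - m ^ 2| ≤ δ * m ^ 2) (hbb : |∑ i, b i ^ 2 - m ^ 2| ≤ δ * m ^ 2)
    (hab : |∑ i, a i * b i| ≤ δ * m ^ 2) :
    ∃ r : ℝ, -2 * ENNReal.log (elRatio fun i => (a i, b i)) = (r : EReal) ∧
      |r - (t₁ ^ 2 + t₂ ^ 2)| ≤ 200 * C ^ 3 * δ := by
  have hN : 0 < N := by
    have : (0 : ℝ) < N := by rw [← hmN]; positivity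
    exact_mod_cast this
  have hm2 : (0 : ℝ) < m ^ 2 := by positivity
  have hC0 : 0 < C := by linarith
  have hCδ : 0 < C * δ := by positivity
  set A := (∑ i, a i ^ 2) / m ^ 2 with hA
  set B := (∑ i, a i * b i) / m ^ 2 with hB
  set D := (∑ i, b i ^ 2) / m ^ 2 with hD
  have eA : ∑ i, a i ^ 2 = A * m ^ 2 := by rw [hA]; field_simp
  have eB : ∑ i, a i * b i = B * m ^ 2 := by rw [hB]; field_simp
  have eD : ∑ i, b i ^ 2 = D * m ^ 2 := by rw [hD]; field_simp
  have bA : |A - 1| ≤ δ := by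
    rw [eA, show A * m ^ 2 - m ^ 2 = (A - 1) * m ^ 2 by ring, abs_mul, abs_of_pos hm2] at haa
    exact le_of_mul_le_mul_right haa hm2
  have bD : |D - 1| ≤ δ := by
    rw [eD, show D * m ^ 2 - m ^ 2 = (D - 1) * m ^ 2 by ring, abs_mul, abs_of_pos hm2] at hbb
    exact le_of_mul_le_mul_right hbb hm2
  have bB : |B| ≤ δ := by
    rw [eB, abs_mul, abs_of_pos hm2] at hab
    exact le_of_mul_le_mul_right hab hm2
  have hδ16 : δ ≤ 1 / 16 := by nlinarith
  have hQ : t₁ ^ 2 + t₂ ^ 2 ≤ 2 * C ^ 2 := by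
    have := sq_le_sq' (abs_le.1 ht₁).1 (abs_le.1 ht₁).2
    have := sq_le_sq' (abs_le.1 ht₂).1 (abs_le.1 ht₂).2
    linarith
  have hQ0 : 0 ≤ t₁ ^ 2 + t₂ ^ 2 := by positivity
  -- linear combinations of the observations are small
  have small : ∀ (u v c K : ℝ), |u| ≤ c → |v| ≤ c → 0 ≤ K → ∀ s t : ℝ, |s| ≤ K * m → |t| ≤ K * m →
      |u / m * s + v / m * t| ≤ 2 * c * K := by
    intro u v c K hu hv hK s t hs ht
    have h1 : |u / m * s| ≤ c * K := by
      rw [abs_mul, abs_div, abs_of_pos hm, div_mul_eq_mul_div, div_le_iff₀ hm]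
      calc |u| * |s| ≤ c * (K * m) := by gcongr; exact (abs_nonneg _).trans hu
        _ = _ := by ring
    have h2 : |v / m * t| ≤ c * K := by
      rw [abs_mul, abs_div, abs_of_pos hm, div_mul_eq_mul_div, div_le_iff₀ hm]
      calc |v| * |t| ≤ c * (K * m) := by gcongr; exact (abs_nonneg _).trans hv
        _ = _ := by ring
    have := abs_add_le (u / m * s) (v / m * t)
    linarith
  -- the upper bound
  have upper : elRatio (fun i => (a i, b i)) ≤ ENNReal.ofReal (Real.exp
      (-((t₁ ^ 2 + t₂ ^ 2 - 200 * C ^ 3 * δ) / 2))) := by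
    -- The dual vector t/m is the Lagrange multiplier to first order: linearizing the stationarity
    -- condition gives (second moment sum) · λ = m t, and the second moment sum is close to m² times
    -- the identity.
    set x : Fin N → ℝ := fun i => t₁ / m * a i + t₂ / m * b i with hx
    have hxi : ∀ i, |x i| ≤ 2 * C * δ := fun i =>
      small t₁ t₂ C δ ht₁ ht₂ hδ0.le _ _ (hai i) (hbi i)
    have hsum : ∑ i, x i = t₁ ^ 2 + t₂ ^ 2 := by
      rw [hx, Finset.sum_add_distrib, ← Finset.mul_sum, ← Finset.mul_sum, ha, hb]
      field_simp
    have hsq : ∑ i, x i ^ 2 = A * t₁ ^ 2 + 2 * B * (t₁ * t₂) + D * t₂ ^ 2 := by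
      have : ∑ i, x i ^ 2 = (t₁ / m) ^ 2 * ∑ i, a i ^ 2 + 2 * (t₁ / m) * (t₂ / m) * ∑ i, a i * b i
          + (t₂ / m) ^ 2 * ∑ i, b i ^ 2 := by
        simp only [Finset.mul_sum, ← Finset.sum_add_distrib]
        exact Finset.sum_congr rfl fun i _ => by rw [hx]; ring
      rw [this, eA, eB, eD]
      field_simp
    have hsqle : ∑ i, x i ^ 2 ≤ t₁ ^ 2 + t₂ ^ 2 + 4 * C ^ 2 * δ := by
      have h12 : |t₁ * t₂| ≤ C ^ 2 := by
        rw [abs_mul, sq]; gcongr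
      have hB' : B * (t₁ * t₂) ≤ δ * C ^ 2 := by
        refine (le_abs_self _).trans ?_
        rw [abs_mul]; gcongr
      rw [hsq]
      have h1 := mul_nonneg (sub_nonneg.2 (abs_le.1 bA).2) (sq_nonneg t₁)
      have h2 := mul_nonneg (sub_nonneg.2 (abs_le.1 bD).2) (sq_nonneg t₂)
      have h3 := mul_nonneg hδ0.le (sub_nonneg.2 hQ)
      linarith
    have hlog := sum_log_one_add_ge x (η := 2 * C * δ) (by linarith) hxi
    refine (elRatio_le _ (t₁ / m) (t₂ / m) fun i => ?_).trans
      (ENNReal.ofReal_le_ofReal (Real.exp_le_exp.2 ?_))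
    · have := (abs_le.1 (hxi i)).1
      change 0 < 1 + x i
      linarith
    · change -∑ i, Real.log (1 + x i) ≤ _
      have h1 : (1 / 2 + 2 * (2 * C * δ)) * ∑ i, x i ^ 2 ≤
          (1 / 2 + 2 * (2 * C * δ)) * (t₁ ^ 2 + t₂ ^ 2 + 4 * C ^ 2 * δ) := by gcongr
      have h2 : C * δ * (t₁ ^ 2 + t₂ ^ 2) ≤ C * δ * (2 * C ^ 2) := by gcongr
      have h3 : C ^ 2 * δ ≤ C ^ 3 * δ := by gcongr; norm_num
      have h4 : C * δ * (C ^ 2 * δ) ≤ 1 / 16 * (C ^ 2 * δ) := by gcongr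
      have h5 : 0 < C ^ 3 * δ := by positivity
      have h6 : (1 / 2 + 2 * (2 * C * δ)) * (t₁ ^ 2 + t₂ ^ 2 + 4 * C ^ 2 * δ) =
          (t₁ ^ 2 + t₂ ^ 2) / 2 + 2 * (C ^ 2 * δ) + 4 * (C * δ * (t₁ ^ 2 + t₂ ^ 2)) +
            16 * (C * δ * (C ^ 2 * δ)) := by ring
      have h7 : C * δ * (2 * C ^ 2) = 2 * (C ^ 3 * δ) := by ring
      rw [hsum] at hlog
      linarith
  -- the lower bound
  have mean : ∀ {c : Fin N → ℝ} {t : ℝ}, ∑ i, c i = m * t → (∀ i, |c i| ≤ δ * m) →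
      |t / m| ≤ δ * m := by
    intro c t hc hci
    have : |∑ i, c i| ≤ m ^ 2 * (δ * m) := by
      refine (Finset.abs_sum_le_sum_abs _ _).trans ((Finset.sum_le_sum fun i _ => hci i).trans ?_)
      simp [hmN]
    rw [hc, abs_mul, abs_of_pos hm] at this
    rw [abs_div, abs_of_pos hm, div_le_iff₀ hm]
    have h' : m * |t| ≤ m * (δ * m * m) := by linarith
    exact le_of_mul_le_mul_left h' hm
  have hta := mean ha hai
  have htb := mean hb hbi
  have prod : ∀ s t : ℝ, |s / m| ≤ δ * m → |t| ≤ C → |s * t / m ^ 2| ≤ C * δ := by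
    intro s t hs ht
    rw [show s * t / m ^ 2 = s / m * t / m by field_simp, abs_div, abs_of_pos hm, div_le_iff₀ hm,
      abs_mul]
    calc |s / m| * |t| ≤ δ * m * C := by gcongr
      _ = _ := by ring
  have hδC : δ ≤ C * δ := by nlinarith
  -- The weights will be linear in the centred observations, so the system involves the empirical
  -- covariance matrix instead of the second moment matrix. Its distance from the identity is at
  -- most δ + Cδ ≤ 2Cδ ≤ 1/8.
  obtain ⟨b₁, b₂, e₁, e₂, hb₁, hb₂, hd₁, hd₂⟩ := exists_solution_near
    (A := A - t₁ * t₁ / m ^ 2) (B := B - t₁ * t₂ / m ^ 2) (D := D - t₂ * t₂ / m ^ 2)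
    (ε := 2 * (C * δ)) (t₁ := t₁) (t₂ := t₂) (C := C)
    (by
      rw [show A - t₁ * t₁ / m ^ 2 - 1 = (A - 1) - t₁ * t₁ / m ^ 2 by ring]
      have := abs_sub (A - 1) (t₁ * t₁ / m ^ 2)
      have := prod t₁ t₁ hta ht₁
      linarith)
    (by
      have := abs_sub B (t₁ * t₂ / m ^ 2)
      have := prod t₁ t₂ hta ht₂
      linarith)
    (by
      rw [show D - t₂ * t₂ / m ^ 2 - 1 = (D - 1) - t₂ * t₂ / m ^ 2 by ring]
      have := abs_sub (D - 1) (t₂ * t₂ / m ^ 2)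
      have := prod t₂ t₂ htb ht₂
      linarith)
    (by linarith) ht₁ ht₂
  have lower : ENNReal.ofReal (Real.exp (-((t₁ ^ 2 + t₂ ^ 2 + 200 * C ^ 3 * δ) / 2))) ≤
      elRatio (fun i => (a i, b i)) := by
    -- Centring makes the x i sum to zero for every b, and the linear system for b is exactly the
    -- pair of moment constraints. The bound 8Cδ ≤ 1/2 comes from |b₁|, |b₂| ≤ 2C and from the
    -- centred observations being at most 2δm.
    set x : Fin N → ℝ := fun i => -(b₁ / m * (a i - t₁ / m) + b₂ / m * (b i - t₂ / m)) with hx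
    have hxi : ∀ i, |x i| ≤ 8 * C * δ := fun i => by
      have := small b₁ b₂ (2 * C) (2 * δ) hb₁ hb₂ (by linarith) (a i - t₁ / m) (b i - t₂ / m)
        ((abs_sub _ _).trans (by have := hai i; linarith))
        ((abs_sub _ _).trans (by have := hbi i; linarith))
      rw [hx, abs_neg]
      linarith
    have hcard : ∑ _i : Fin N, (1 : ℝ) = m ^ 2 := by simp [hmN]
    have hsum : ∑ i, x i = 0 := by
      have : ∑ i, x i = -(b₁ / m) * ∑ i, a i - b₂ / m * ∑ i, b i +
          (b₁ / m * (t₁ / m) + b₂ / m * (t₂ / m)) * ∑ _i : Fin N, (1 : ℝ) := by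
        simp only [Finset.mul_sum, ← Finset.sum_add_distrib, ← Finset.sum_sub_distrib]
        exact Finset.sum_congr rfl fun i _ => by rw [hx]; ring
      rw [this, ha, hb, hcard]
      field_simp
      ring
    have hsa : ∑ i, x i * a i = -(m * t₁) := by
      have : ∑ i, x i * a i = -(b₁ / m) * ∑ i, a i ^ 2 - b₂ / m * ∑ i, a i * b i +
          (b₁ / m * (t₁ / m) + b₂ / m * (t₂ / m)) * ∑ i, a i := by
        simp only [Finset.mul_sum, ← Finset.sum_add_distrib, ← Finset.sum_sub_distrib]
        exact Finset.sum_congr rfl fun i _ => by rw [hx]; ring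
      rw [this, eA, eB, ha]
      conv_rhs => rw [← e₁]
      field_simp
      ring
    have hsb : ∑ i, x i * b i = -(m * t₂) := by
      have : ∑ i, x i * b i = -(b₁ / m) * ∑ i, a i * b i - b₂ / m * ∑ i, b i ^ 2 +
          (b₁ / m * (t₁ / m) + b₂ / m * (t₂ / m)) * ∑ i, b i := by
        simp only [Finset.mul_sum, ← Finset.sum_add_distrib, ← Finset.sum_sub_distrib]
        exact Finset.sum_congr rfl fun i _ => by rw [hx]; ring
      rw [this, eD, eB, hb]
      conv_rhs => rw [← e₂]
      field_simp
      ring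
    -- One factor of the square is expanded, so that only the three sums already computed occur.
    have hsq : ∑ i, x i ^ 2 = b₁ * t₁ + b₂ * t₂ := by
      have : ∑ i, x i ^ 2 = -(b₁ / m) * ∑ i, x i * a i - b₂ / m * ∑ i, x i * b i +
          (b₁ / m * (t₁ / m) + b₂ / m * (t₂ / m)) * ∑ i, x i := by
        simp only [Finset.mul_sum, ← Finset.sum_add_distrib, ← Finset.sum_sub_distrib]
        exact Finset.sum_congr rfl fun i _ => by simp only [hx]; ring
      rw [this, hsa, hsb, hsum]
      field_simp
      ring
    have hsqle : ∑ i, x i ^ 2 ≤ t₁ ^ 2 + t₂ ^ 2 + 16 * C ^ 3 * δ := by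
      have h1 : (b₁ - t₁) * t₁ ≤ 4 * C * (2 * (C * δ)) * C := by
        refine (le_abs_self _).trans ?_
        rw [abs_mul]; gcongr
      have h2 : (b₂ - t₂) * t₂ ≤ 4 * C * (2 * (C * δ)) * C := by
        refine (le_abs_self _).trans ?_
        rw [abs_mul]; gcongr
      rw [hsq]
      linarith
    have hlog := sum_log_one_add_ge x (η := 8 * C * δ) (by linarith) hxi
    refine (ENNReal.ofReal_le_ofReal (Real.exp_le_exp.2 ?_)).trans
      (le_elRatio hN _ x (fun i => ?_) hsum ?_ ?_)
    · have h1 : (1 / 2 + 2 * (8 * C * δ)) * ∑ i, x i ^ 2 ≤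
          (1 / 2 + 2 * (8 * C * δ)) * (t₁ ^ 2 + t₂ ^ 2 + 16 * C ^ 3 * δ) := by gcongr
      have h2 : C * δ * (t₁ ^ 2 + t₂ ^ 2) ≤ C * δ * (2 * C ^ 2) := by gcongr
      have h4 : C * δ * (C ^ 3 * δ) ≤ 1 / 16 * (C ^ 3 * δ) := by gcongr
      have h5 : 0 < C ^ 3 * δ := by positivity
      have h6 : (1 / 2 + 2 * (8 * C * δ)) * (t₁ ^ 2 + t₂ ^ 2 + 16 * C ^ 3 * δ) =
          (t₁ ^ 2 + t₂ ^ 2) / 2 + 8 * (C ^ 3 * δ) + 16 * (C * δ * (t₁ ^ 2 + t₂ ^ 2)) +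
            256 * (C * δ * (C ^ 3 * δ)) := by ring
      have h7 : C * δ * (2 * C ^ 2) = 2 * (C ^ 3 * δ) := by ring
      rw [hsum] at hlog
      linarith
    · have := (abs_le.1 (hxi i)).1
      linarith
    · simp only [add_mul, one_mul, Finset.sum_add_distrib, ha, hsa]; ring
    · simp only [add_mul, one_mul, Finset.sum_add_distrib, hb, hsb]; ring
  obtain ⟨r, hr, h1, h2⟩ := exists_neg_two_mul_log_eq lower upper
  exact ⟨r, hr, abs_le.2 ⟨by linarith, by linarith⟩⟩

end BandTest

/-! ### Measurability and scale invariance of the empirical likelihood ratio. -/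

namespace BandTest

/-- The empirical likelihood ratio is attained, so its superlevel sets are projections of closed
sets along the compact simplex of weights. -/
lemma le_elRatio_iff {N : ℕ} (R : Fin N → ℝ × ℝ) {c : ENNReal} (hc : 0 < c) :
    c ≤ elRatio R ↔ ∃ w : stdSimplex ℝ (Fin N), ∑ i, w.1 i • R i = 0 ∧
      c ≤ ENNReal.ofReal (∏ i, (N : ℝ) * w.1 i) := by
  constructor
  · intro h
    set K : Set (stdSimplex ℝ (Fin N)) := {w | ∑ i, w.1 i • R i = 0} with hK
    have hKc : IsCompact K := by
      refine IsClosed.isCompact (isClosed_eq ?_ continuous_const)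
      exact continuous_finsetSum _ fun i _ =>
        ((continuous_apply i).comp continuous_subtype_val).smul continuous_const
    have hcont : Continuous fun w : stdSimplex ℝ (Fin N) =>
        ENNReal.ofReal (∏ i, (N : ℝ) * w.1 i) :=
      ENNReal.continuous_ofReal.comp <| continuous_finsetProd _ fun i _ =>
        continuous_const.mul ((continuous_apply i).comp continuous_subtype_val)
    rcases K.eq_empty_or_nonempty with h0 | hne
    · exfalso
      refine hc.not_ge (h.trans (iSup₂_le fun w hw => ?_))
      have : (⟨w, hw.1, hw.2.1⟩ : stdSimplex ℝ (Fin N)) ∈ K := hw.2.2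
      simp [h0] at this
    · obtain ⟨w, hw, hmax⟩ := hKc.exists_isMaxOn hne hcont.continuousOn
      refine ⟨w, hw, h.trans (iSup₂_le fun v hv => ?_)⟩
      exact hmax (show (⟨v, hv.1, hv.2.1⟩ : stdSimplex ℝ (Fin N)) ∈ K from hv.2.2)
  · rintro ⟨w, hw, h⟩
    exact h.trans (le_iSup₂_of_le w.1 ⟨w.2.1, w.2.2, hw⟩ le_rfl)

/-- The supremum is over uncountably many weights that depend on R, but projection along the compact
simplex is a closed map, so every superlevel set at a positive level is closed. -/
lemma measurable_elRatio {N : ℕ} : Measurable (elRatio : (Fin N → ℝ × ℝ) → ENNReal) := by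
  refine measurable_of_Ici fun c => ?_
  rcases eq_or_ne c 0 with rfl | hc
  · have : Set.Ici (0 : ENNReal) = Set.univ := by ext; simp
    simp [this]
  · have : elRatio ⁻¹' Set.Ici c = Prod.fst ''
        {q : (Fin N → ℝ × ℝ) × stdSimplex ℝ (Fin N) | ∑ i, q.2.1 i • q.1 i = 0 ∧
          c ≤ ENNReal.ofReal (∏ i, (N : ℝ) * q.2.1 i)} := by
      ext R
      simp only [Set.mem_preimage, Set.mem_Ici, le_elRatio_iff R (pos_iff_ne_zero.2 hc),
        Set.mem_image, Set.mem_ofPred_eq, Prod.exists, exists_and_right, exists_eq_right]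
    rw [this]
    refine (isClosedMap_fst_of_compactSpace _ ?_).measurableSet
    have hw : ∀ i, Continuous fun q : (Fin N → ℝ × ℝ) × stdSimplex ℝ (Fin N) => q.2.1 i :=
      fun i => (continuous_apply i).comp (continuous_subtype_val.comp continuous_snd)
    have hR : ∀ i, Continuous fun q : (Fin N → ℝ × ℝ) × stdSimplex ℝ (Fin N) => q.1 i :=
      fun i => (continuous_apply i).comp continuous_fst
    refine (isClosed_eq ?_ continuous_const).and (isClosed_le continuous_const ?_)
    · exact continuous_finsetSum _ fun i _ => (hw i).smul (hR i)
    · exact ENNReal.continuous_ofReal.comp <| continuous_finsetProd _ fun i _ =>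
        continuous_const.mul (hw i)

/-- Rescaling the coordinates does not change the empirical likelihood ratio. -/
lemma elRatio_div {N : ℕ} (a b : Fin N → ℝ) {s t : ℝ} (hs : s ≠ 0) (ht : t ≠ 0) :
    elRatio (fun i => (a i / s, b i / t)) = elRatio fun i => (a i, b i) := by
  unfold elRatio
  congr! 4 with w
  ext w
  simp only [Set.mem_ofPred_eq]
  refine and_congr_right fun _ => and_congr_right fun _ => ?_
  simp only [Prod.ext_iff, Prod.fst_sum, Prod.snd_sum, Prod.smul_mk, smul_eq_mul, Prod.fst_zero,
    Prod.snd_zero, ← mul_div_assoc, ← Finset.sum_div, div_eq_zero_iff, hs, ht, or_false]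

end BandTest

/-! ### A quantitative central limit theorem through characteristic functions. -/

namespace BandTest

/-- For |x| ≤ 1 this is the Taylor remainder of the exponential. For |x| > 1 every term of the
trivial bound 2 + |x| + x²/2 is absorbed by |x|³. The constant 5 is not sharp. -/
lemma norm_exp_mul_I_sub_taylor_le (x : ℝ) :
    ‖Complex.exp (x * Complex.I) - (1 + x * Complex.I - x ^ 2 / 2)‖ ≤ 5 * |x| ^ 3 := by
  have hn : ‖(x : ℂ) * Complex.I‖ = |x| := by simp
  rcases le_or_gt |x| 1 with h | h
  · have := Complex.exp_bound (x := x * Complex.I) (by rw [hn]; exact h) (n := 3) (by norm_num)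
    rw [hn] at this
    have e : ∑ m ∈ Finset.range 3, ((x : ℂ) * Complex.I) ^ m / (m.factorial : ℂ) =
        1 + x * Complex.I - x ^ 2 / 2 := by
      simp [Finset.sum_range_succ, Nat.factorial, mul_pow]
      ring
    rw [e] at this
    refine this.trans ?_
    rw [mul_comm]
    gcongr
    norm_num [Nat.factorial]
  · have h1 : ‖Complex.exp (x * Complex.I)‖ = 1 := Complex.norm_exp_ofReal_mul_I x
    have h2 : ‖(1 + x * Complex.I - x ^ 2 / 2 : ℂ)‖ ≤ 1 + |x| + |x| ^ 2 / 2 := by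
      refine (norm_sub_le _ _).trans (add_le_add ((norm_add_le _ _).trans (by simp)) ?_)
      simp
    have := norm_sub_le (Complex.exp (x * Complex.I)) (1 + x * Complex.I - x ^ 2 / 2)
    have h3 : |x| ≤ |x| ^ 3 := by
      calc |x| = |x| ^ 1 := (pow_one _).symm
        _ ≤ |x| ^ 3 := pow_le_pow_right₀ h.le (by norm_num)
    have h4 : |x| ^ 2 ≤ |x| ^ 3 := pow_le_pow_right₀ h.le (by norm_num)
    linarith

/-- Telescoping: the factors are exchanged one at a time, and the remaining ones have norm at most
one. -/
lemma norm_prod_sub_prod_le {ι : Type*} (s : Finset ι) (a b : ι → ℂ)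
    (ha : ∀ i ∈ s, ‖a i‖ ≤ 1) (hb : ∀ i ∈ s, ‖b i‖ ≤ 1) :
    ‖∏ i ∈ s, a i - ∏ i ∈ s, b i‖ ≤ ∑ i ∈ s, ‖a i - b i‖ := by
  classical
  induction s using Finset.induction with
  | empty => simp
  | insert i s hi ih =>
    rw [Finset.prod_insert hi, Finset.prod_insert hi, Finset.sum_insert hi]
    have h := ih (fun j hj => ha j (Finset.mem_insert_of_mem hj))
      (fun j hj => hb j (Finset.mem_insert_of_mem hj))
    have hB : ‖∏ j ∈ s, b j‖ ≤ 1 := by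
      rw [norm_prod]
      exact Finset.prod_le_one (fun _ _ => norm_nonneg _)
        fun j hj => hb j (Finset.mem_insert_of_mem hj)
    have hA := ha i (Finset.mem_insert_self i s)
    rw [show a i * ∏ j ∈ s, a j - b i * ∏ j ∈ s, b j =
      (a i - b i) * ∏ j ∈ s, b j + a i * (∏ j ∈ s, a j - ∏ j ∈ s, b j) by ring]
    refine (norm_add_le _ _).trans ?_
    rw [norm_mul, norm_mul]
    have h1 := mul_le_mul_of_nonneg_left hB (norm_nonneg (a i - b i))
    have h2 := mul_le_mul_of_nonneg_right hA (norm_nonneg (∏ j ∈ s, a j - ∏ j ∈ s, b j))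
    linarith

variable {Ω : Type*} [MeasurableSpace Ω] {P : Measure Ω} [IsProbabilityMeasure P]

/-- Second-order expansion of a characteristic function with a fourth moment bound. -/
lemma norm_charFun_sub_taylor_le {X : Ω → ℝ} (hX : MemLp X 4 P) (h0 : ∫ ω, X ω ∂P = 0)
    {ε : ℝ} (hε : 0 < ε) :
    ‖charFun (P.map X) 1 - (1 - ((∫ ω, X ω ^ 2 ∂P : ℝ) : ℂ) / 2)‖ ≤
      5 / 2 * (ε * ∫ ω, X ω ^ 2 ∂P + (∫ ω, X ω ^ 4 ∂P) / ε) := by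
  have hm := hX.aestronglyMeasurable.aemeasurable
  have i1 : Integrable X P := hX.integrable (by norm_num)
  have i2 : Integrable (fun ω => X ω ^ 2) P :=
    (hX.mono_exponent (p := 2) (by norm_num)).integrable_sq
  have i4 : Integrable (fun ω => X ω ^ 4) P := by
    have := hX.integrable_norm_pow (by norm_num : (4 : ℕ) ≠ 0)
    refine this.congr (Eventually.of_forall fun ω => ?_)
    simp only [Real.norm_eq_abs]
    exact Even.pow_abs (by decide) _
  have ie : Integrable (fun ω => Complex.exp (X ω * Complex.I)) P := by
    refine Integrable.of_bound (C := 1) (by fun_prop) (Eventually.of_forall fun ω => ?_)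
    rw [Complex.norm_exp_ofReal_mul_I]
  have e1 : charFun (P.map X) 1 = ∫ ω, Complex.exp (X ω * Complex.I) ∂P := by
    rw [charFun_apply_real, integral_map hm (by fun_prop)]
    simp
  have j1 : Integrable (fun ω => (X ω : ℂ) * Complex.I) P := i1.ofReal.mul_const _
  have j2 : Integrable (fun ω => (X ω : ℂ) ^ 2 / 2) P := by
    have := (i2.ofReal (𝕜 := ℂ)).div_const 2
    simpa using this
  have j3 : Integrable (fun ω => 1 + (X ω : ℂ) * Complex.I) P := (integrable_const _).add j1
  have j4 : Integrable (fun ω => 1 + (X ω : ℂ) * Complex.I - (X ω : ℂ) ^ 2 / 2) P := j3.sub j2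
  have e2 : (1 - ((∫ ω, X ω ^ 2 ∂P : ℝ) : ℂ) / 2) =
      ∫ ω, (1 + X ω * Complex.I - (X ω : ℂ) ^ 2 / 2) ∂P := by
    rw [integral_sub j3 j2, integral_add (integrable_const _) j1,
      integral_mul_const, integral_complex_ofReal, h0, integral_div, ← integral_complex_ofReal]
    simp
  rw [e1, e2, ← integral_sub ie j4]
  refine (norm_integral_le_integral_norm _).trans ?_
  have hb : ∀ ω, ‖Complex.exp (X ω * Complex.I) - (1 + X ω * Complex.I - (X ω : ℂ) ^ 2 / 2)‖ ≤
      5 / 2 * (ε * X ω ^ 2 + X ω ^ 4 / ε) := fun ω => by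
    refine (norm_exp_mul_I_sub_taylor_le (X ω)).trans ?_
    have h4 : X ω ^ 4 = |X ω| ^ 4 := (Even.pow_abs (by decide) _).symm
    rw [h4, ← sq_abs (X ω)]
    -- Completing a square trades the third absolute moment for the second and the fourth. The
    -- parameter ε is later taken to be 1/√N.
    have : 2 * |X ω| ^ 3 ≤ ε * |X ω| ^ 2 + |X ω| ^ 4 / ε := by
      have h5 : ε * |X ω| ^ 2 + |X ω| ^ 4 / ε - 2 * |X ω| ^ 3 = |X ω| ^ 2 * (ε - |X ω|) ^ 2 / ε := by
        field_simp; ring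
      have : 0 ≤ |X ω| ^ 2 * (ε - |X ω|) ^ 2 / ε := by positivity
      linarith
    linarith
  have hi : Integrable (fun ω => 5 / 2 * (ε * X ω ^ 2 + X ω ^ 4 / ε)) P :=
    ((i2.const_mul _).add (i4.div_const _)).const_mul _
  refine (integral_mono (ie.sub j4).norm hi hb).trans_eq ?_
  rw [integral_const_mul, integral_add (i2.const_mul _) (i4.div_const _), integral_const_mul,
    integral_div]

/-- A quantitative central limit theorem for independent variables with bounded fourth moments. -/
lemma norm_charFun_sum_sub_le {N : ℕ} (hN : 0 < N) {L : Fin N → Ω → ℝ} (hL : ∀ i, MemLp (L i) 4 P)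
    (hind : iIndepFun L P) (h0 : ∀ i, ∫ ω, L i ω ∂P = 0) {v K : ℝ}
    (h2 : ∀ i, ∫ ω, L i ω ^ 2 ∂P = v) (h4 : ∀ i, ∫ ω, L i ω ^ 4 ∂P ≤ K) (hvN : v / 2 ≤ N) :
    ‖charFun (P.map fun ω => (√N)⁻¹ * ∑ i, L i ω) 1 - Complex.exp (-v / 2)‖ ≤
      5 / 2 * (v + K) / √N + (v / 2) ^ 2 / N := by
  have hN' : (0 : ℝ) < N := by exact_mod_cast hN
  have hs : 0 < √(N : ℝ) := Real.sqrt_pos.2 hN'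
  have hss : √(N : ℝ) ^ 2 = N := Real.sq_sqrt hN'.le
  have hv : 0 ≤ v := by
    rw [← h2 ⟨0, hN⟩]; exact integral_nonneg fun ω => sq_nonneg _
  set X : Fin N → Ω → ℝ := fun i ω => (√N)⁻¹ * L i ω with hX
  have hXL : ∀ i, MemLp (X i) 4 P := fun i => (hL i).const_mul _
  have hXi : iIndepFun X P := hind.comp (fun _ x => (√N)⁻¹ * x) (fun _ => by fun_prop)
  have hX0 : ∀ i, ∫ ω, X i ω ∂P = 0 := fun i => by
    simp only [hX]; rw [integral_const_mul, h0, mul_zero]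
  have hX2 : ∀ i, ∫ ω, X i ω ^ 2 ∂P = v / N := fun i => by
    simp only [hX, mul_pow]
    rw [integral_const_mul, h2, inv_pow, hss]; field_simp
  have hX4 : ∀ i, ∫ ω, X i ω ^ 4 ∂P ≤ K / N ^ 2 := fun i => by
    simp only [hX, mul_pow]
    rw [integral_const_mul, inv_pow, show √(N : ℝ) ^ 4 = (√(N : ℝ) ^ 2) ^ 2 by ring, hss,
      inv_mul_eq_div]
    gcongr
    exact h4 i
  have e1 : charFun (P.map fun ω => (√N)⁻¹ * ∑ i, L i ω) 1 = ∏ i, charFun (P.map (X i)) 1 := by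
    simp only [Finset.mul_sum]
    have := hXi.charFun_map_fun_sum_eq_prod fun i => (hXL i).aestronglyMeasurable.aemeasurable
    rw [show (fun ω => ∑ i, (√(N : ℝ))⁻¹ * L i ω) = fun ω => ∑ i, X i ω from rfl, this,
      Finset.prod_apply]
  -- The limit is split into N equal factors to allow a factorwise comparison of products.
  have e2 : Complex.exp (-v / 2) = ∏ _i : Fin N, ((Real.exp (-(v / 2 / N)) : ℝ) : ℂ) := by
    rw [Finset.prod_const, Finset.card_univ, Fintype.card_fin, Complex.ofReal_exp,
      ← Complex.exp_nat_mul]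
    congr 1
    have : (N : ℂ) ≠ 0 := by exact_mod_cast hN.ne'
    push_cast
    field_simp
  rw [e1, e2]
  have hpm : ∀ i, IsProbabilityMeasure (P.map (X i)) := fun i =>
    Measure.isProbabilityMeasure_map (hXL i).aestronglyMeasurable.aemeasurable
  refine (norm_prod_sub_prod_le _ _ _ (fun i _ => ?_) fun i _ => ?_).trans ?_
  · exact norm_charFun_le_one _
  · rw [Complex.norm_real, Real.norm_eq_abs, abs_of_pos (Real.exp_pos _), Real.exp_le_one_iff]
    have : 0 ≤ v / 2 / N := by positivity
    linarith
  have hu : |v / 2 / N| ≤ 1 := by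
    rw [abs_of_nonneg (by positivity), div_le_one hN']; exact hvN
  have hterm : ∀ i, ‖charFun (P.map (X i)) 1 - ((Real.exp (-(v / 2 / N)) : ℝ) : ℂ)‖ ≤
      5 / 2 * (v + K) / √N / N + (v / 2) ^ 2 / N / N := by
    intro i
    have a := norm_charFun_sub_taylor_le (hXL i) (hX0 i) (inv_pos.2 hs)
    have b := Real.abs_exp_sub_one_sub_id_le (x := -(v / 2 / N)) (by rwa [abs_neg])
    rw [hX2] at a
    have a' : 5 / 2 * ((√(N : ℝ))⁻¹ * (v / N) + (∫ ω, X i ω ^ 4 ∂P) / (√(N : ℝ))⁻¹) ≤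
        5 / 2 * (v + K) / √N / N := by
      calc _ ≤ 5 / 2 * ((√(N : ℝ))⁻¹ * (v / N) + (K / N ^ 2) / (√(N : ℝ))⁻¹) := by
            gcongr; exact hX4 i
        _ = _ := by
            field_simp
            rw [hss]; ring
    have b' : ‖(1 - ((v / N : ℝ) : ℂ) / 2) - ((Real.exp (-(v / 2 / N)) : ℝ) : ℂ)‖ ≤
        (v / 2) ^ 2 / N / N := by
      have e : (1 - ((v / N : ℝ) : ℂ) / 2) - ((Real.exp (-(v / 2 / N)) : ℝ) : ℂ) =
          ((-(Real.exp (-(v / 2 / N)) - 1 - -(v / 2 / N)) : ℝ) : ℂ) := by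
        push_cast; ring
      rw [e, Complex.norm_real, Real.norm_eq_abs, abs_neg]
      refine b.trans_eq ?_
      field_simp
    have := norm_sub_le_norm_sub_add_norm_sub (charFun (P.map (X i)) 1)
      (1 - ((v / N : ℝ) : ℂ) / 2) ((Real.exp (-(v / 2 / N)) : ℝ) : ℂ)
    linarith
  refine (Finset.sum_le_sum fun i _ => hterm i).trans_eq ?_
  rw [Finset.sum_const, Finset.card_univ, Fintype.card_fin, nsmul_eq_mul]
  field_simp

end BandTest

/-! ### Standardized pairs and their central limit theorem. -/

namespace BandTest

/-- Independent pairs of random variables with mean zero, identity covariance matrix and fourth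
moments at most `K`. -/
structure IsStandardSample {Ω : Type*} [MeasurableSpace Ω] {N : ℕ} (e v : Fin N → Ω → ℝ) (K : ℝ)
    (P : Measure Ω) : Prop where
  indep : iIndepFun (fun i ω => (e i ω, v i ω)) P
  memLp_fst : ∀ i, MemLp (e i) 4 P
  memLp_snd : ∀ i, MemLp (v i) 4 P
  mean_fst : ∀ i, ∫ ω, e i ω ∂P = 0
  mean_snd : ∀ i, ∫ ω, v i ω ∂P = 0
  sq_fst : ∀ i, ∫ ω, e i ω ^ 2 ∂P = 1
  sq_snd : ∀ i, ∫ ω, v i ω ^ 2 ∂P = 1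
  cross : ∀ i, ∫ ω, e i ω * v i ω ∂P = 0
  fourth_fst : ∀ i, ∫ ω, e i ω ^ 4 ∂P ≤ K
  fourth_snd : ∀ i, ∫ ω, v i ω ^ 4 ∂P ≤ K

section

variable {Ω : Type*} [MeasurableSpace Ω] {P : Measure Ω}

lemma integrable_pow_four {X : Ω → ℝ} (hX : MemLp X 4 P) : Integrable (fun ω => X ω ^ 4) P := by
  refine (hX.integrable_norm_pow (by norm_num : (4 : ℕ) ≠ 0)).congr
    (Eventually.of_forall fun ω => ?_)
  simp only [Real.norm_eq_abs]
  exact Even.pow_abs (by decide) _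

variable [IsProbabilityMeasure P]

lemma memLp_two_of_four {X : Ω → ℝ} (hX : MemLp X 4 P) : MemLp X 2 P :=
  hX.mono_exponent (by norm_num)

/-- Cramér–Wold reduction: the identity covariance gives s e + t v the variance s² + t², and (x +
y)⁴ ≤ 8 (x⁴ + y⁴) bounds its fourth moment. -/
lemma IsStandardSample.norm_charFun_sub_le {N : ℕ} (hN : 0 < N) {e v : Fin N → Ω → ℝ} {K : ℝ}
    (h : IsStandardSample e v K P) (s t : ℝ) (hst : (s ^ 2 + t ^ 2) / 2 ≤ N) :
    ‖charFun (P.map fun ω => (√N)⁻¹ * ∑ i, (s * e i ω + t * v i ω)) 1 -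
        Complex.exp (-((s ^ 2 + t ^ 2 : ℝ) : ℂ) / 2)‖ ≤
      5 / 2 * (s ^ 2 + t ^ 2 + 8 * (s ^ 4 + t ^ 4) * K) / √N + ((s ^ 2 + t ^ 2) / 2) ^ 2 / N := by
  have he1 : ∀ i, Integrable (e i) P := fun i => (h.memLp_fst i).integrable (by norm_num)
  have hv1 : ∀ i, Integrable (v i) P := fun i => (h.memLp_snd i).integrable (by norm_num)
  have he2 := fun i => (memLp_two_of_four (h.memLp_fst i)).integrable_sq
  have hv2 := fun i => (memLp_two_of_four (h.memLp_snd i)).integrable_sq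
  have hev : ∀ i, Integrable (fun ω => e i ω * v i ω) P := fun i => (memLp_two_of_four (h.memLp_fst i)).integrable_mul
    (memLp_two_of_four (h.memLp_snd i))
  have he4 := fun i => integrable_pow_four (h.memLp_fst i)
  have hv4 := fun i => integrable_pow_four (h.memLp_snd i)
  have hL : ∀ i, MemLp (fun ω => s * e i ω + t * v i ω) 4 P := fun i =>
    ((h.memLp_fst i).const_mul s).add ((h.memLp_snd i).const_mul t)
  refine norm_charFun_sum_sub_le hN hL
    (h.indep.comp (fun _ q => s * q.1 + t * q.2) fun _ => by fun_prop) (fun i => ?_) (fun i => ?_)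
    (fun i => ?_) hst
  · rw [integral_add ((he1 i).const_mul _) ((hv1 i).const_mul _), integral_const_mul,
      integral_const_mul, h.mean_fst, h.mean_snd]
    simp
  · have : ∀ ω, (s * e i ω + t * v i ω) ^ 2 =
        s ^ 2 * e i ω ^ 2 + t ^ 2 * v i ω ^ 2 + 2 * s * t * (e i ω * v i ω) := fun ω => by ring
    simp only [this]
    have j1 : Integrable (fun ω => s ^ 2 * e i ω ^ 2 + t ^ 2 * v i ω ^ 2) P :=
      ((he2 i).const_mul _).add ((hv2 i).const_mul _)
    rw [integral_add j1 ((hev i).const_mul _),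
      integral_add ((he2 i).const_mul _) ((hv2 i).const_mul _)]
    simp only [integral_const_mul]
    have hc := h.cross i
    simp only [h.sq_fst, h.sq_snd, hc]
    ring
  · have : ∀ ω, (s * e i ω + t * v i ω) ^ 4 ≤ 8 * s ^ 4 * e i ω ^ 4 + 8 * t ^ 4 * v i ω ^ 4 := by
      intro ω
      have h1 := Even.add_pow_le (n := 4) (by decide) (a := s * e i ω) (b := t * v i ω)
      rw [mul_pow, mul_pow] at h1
      norm_num at h1
      linarith
    refine (integral_mono (integrable_pow_four (hL i))
      (((he4 i).const_mul _).add ((hv4 i).const_mul _)) this).trans ?_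
    rw [Pi.add_def, integral_add ((he4 i).const_mul _) ((hv4 i).const_mul _), integral_const_mul,
      integral_const_mul]
    have a := mul_le_mul_of_nonneg_left (h.fourth_fst i) (show 0 ≤ 8 * s ^ 4 by positivity)
    have b := mul_le_mul_of_nonneg_left (h.fourth_snd i) (show 0 ≤ 8 * t ^ 4 by positivity)
    linarith

end

lemma integral_chiSquared_two (g : ℝ → ℝ) (hg : Continuous g) :
    ∫ z, g z ∂(chiSquared 2) =
      ∫ x, g (x 0 ^ 2 + x 1 ^ 2) ∂(stdGaussian (EuclideanSpace ℝ (Fin 2))) := by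
  rw [chiSquared, integral_map (Measurable.aemeasurable (by fun_prop)) (by fun_prop), ← map_pi_eq_stdGaussian,
    integral_map (by fun_prop) (by fun_prop)]
  simp [Fin.sum_univ_two]

/-- The central limit theorem for triangular arrays of standardized pairs, in terms of the squared
norm of the standardized sum. -/
theorem tendsto_integral_chiSquared {Ω : ℕ → Type*} [∀ n, MeasurableSpace (Ω n)]
    {P : ∀ n, Measure (Ω n)} [∀ n, IsProbabilityMeasure (P n)] {N : ℕ → ℕ}
    (hN : Tendsto N atTop atTop) {e v : ∀ n, Fin (N n) → Ω n → ℝ} {K : ℝ}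
    (hem : ∀ n i, AEMeasurable (e n i) (P n)) (hvm : ∀ n i, AEMeasurable (v n i) (P n))
    (h : ∀ᶠ n in atTop, IsStandardSample (e n) (v n) K (P n)) {g : ℝ → ℝ} (hg : Continuous g)
    {M : ℝ} (hgM : ∀ x, |g x| ≤ M) :
    Tendsto (fun n => ∫ ω, g (((√(N n))⁻¹ * ∑ i, e n i ω) ^ 2 +
        ((√(N n))⁻¹ * ∑ i, v n i ω) ^ 2) ∂(P n)) atTop (𝓝 (∫ z, g z ∂(chiSquared 2))) := by
  set T : ∀ n, Ω n → EuclideanSpace ℝ (Fin 2) := fun n ω =>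
    !₂[(√(N n))⁻¹ * ∑ i, e n i ω, (√(N n))⁻¹ * ∑ i, v n i ω] with hT
  have hTm : ∀ n, AEMeasurable (T n) (P n) := fun n => by
    have h1 : AEMeasurable (fun ω => ![(√(N n))⁻¹ * ∑ i, e n i ω, (√(N n))⁻¹ * ∑ i, v n i ω])
        (P n) := by
      refine aemeasurable_pi_lambda _ fun k => ?_
      fin_cases k
      · exact (Finset.aemeasurable_fun_sum _ fun i _ => hem n i).const_mul _
      · exact (Finset.aemeasurable_fun_sum _ fun i _ => hvm n i).const_mul _
    exact (WithLp.measurable_toLp 2 _).comp_aemeasurable h1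
  let ν : ℕ → ProbabilityMeasure (EuclideanSpace ℝ (Fin 2)) := fun n =>
    ⟨(P n).map (T n), Measure.isProbabilityMeasure_map (hTm n)⟩
  let γ : ProbabilityMeasure (EuclideanSpace ℝ (Fin 2)) := ⟨stdGaussian _, inferInstance⟩
  have hconv : Tendsto ν atTop (𝓝 γ) := by
    refine ProbabilityMeasure.tendsto_of_tendsto_charFun fun t => ?_
    change Tendsto (fun n => charFun ((P n).map (T n)) t) atTop (𝓝 (charFun (stdGaussian _) t))
    rw [charFun_stdGaussian, tendsto_iff_norm_sub_tendsto_zero]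
    have hNr : Tendsto (fun n => (N n : ℝ)) atTop atTop :=
      tendsto_natCast_atTop_atTop.comp hN
    have hlim : Tendsto (fun n => 5 / 2 * (t 0 ^ 2 + t 1 ^ 2 + 8 * (t 0 ^ 4 + t 1 ^ 4) * K) / √(N n)
        + ((t 0 ^ 2 + t 1 ^ 2) / 2) ^ 2 / N n) atTop (𝓝 0) := by
      rw [← add_zero (0 : ℝ)]
      exact (tendsto_const_nhds.div_atTop (Real.tendsto_sqrt_atTop.comp hNr)).add
        (tendsto_const_nhds.div_atTop hNr)
    refine squeeze_zero' (Eventually.of_forall fun _ => norm_nonneg _) ?_ hlim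
    filter_upwards [h, hN.eventually_gt_atTop 0,
      hNr.eventually_ge_atTop ((t 0 ^ 2 + t 1 ^ 2) / 2)] with n hn hN0 hNt
    have key := hn.norm_charFun_sub_le hN0 (t 0) (t 1) hNt
    have e1 : charFun ((P n).map (T n)) t =
        charFun ((P n).map fun ω => (√(N n))⁻¹ * ∑ i, (t 0 * e n i ω + t 1 * v n i ω)) 1 := by
      have hm : AEMeasurable (fun ω => (√(N n))⁻¹ * ∑ i, (t 0 * e n i ω + t 1 * v n i ω)) (P n) :=
        (Finset.aemeasurable_fun_sum _ fun i _ =>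
          ((hem n i).const_mul _).add ((hvm n i).const_mul _)).const_mul _
      rw [charFun_apply, integral_map (hTm n) (by fun_prop), charFun_apply_real,
        integral_map hm (by fun_prop)]
      congr with ω
      congr 2
      simp only [hT, PiLp.inner_apply, Fin.sum_univ_two, Finset.sum_add_distrib, ← Finset.mul_sum]
      simp
      ring
    have e2 : ‖t‖ ^ 2 = t 0 ^ 2 + t 1 ^ 2 := by
      rw [EuclideanSpace.real_norm_sq_eq, Fin.sum_univ_two]
    rw [e1, ← Complex.ofReal_pow, e2]
    exact key
  have hgc : Continuous fun x : EuclideanSpace ℝ (Fin 2) => g (x 0 ^ 2 + x 1 ^ 2) := by fun_prop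
  let G : BoundedContinuousFunction (EuclideanSpace ℝ (Fin 2)) ℝ :=
    BoundedContinuousFunction.ofNormedAddCommGroup _ hgc M fun x => hgM _
  have := (ProbabilityMeasure.tendsto_iff_forall_integral_tendsto.1 hconv) G
  rw [integral_chiSquared_two g hg]
  refine this.congr fun n => ?_
  change ∫ x, g (x 0 ^ 2 + x 1 ^ 2) ∂((P n).map (T n)) = _
  rw [integral_map (hTm n) hgc.aestronglyMeasurable]
  simp [hT]

end BandTest

/-! ### Finite moments, kurtosis of independent sums, and moments of the normal law. -/

namespace BandTest

/-- A random variable with finite moments of all orders. -/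
def HasMoments {Ω : Type*} [MeasurableSpace Ω] (f : Ω → ℝ) (P : Measure Ω) : Prop :=
  ∀ n : ℕ, MemLp f n P

namespace HasMoments

variable {Ω : Type*} [MeasurableSpace Ω] {P : Measure Ω} {f g : Ω → ℝ}

lemma const [IsFiniteMeasure P] (c : ℝ) : HasMoments (fun _ => c) P := fun _ => memLp_const c

lemma add (hf : HasMoments f P) (hg : HasMoments g P) : HasMoments (fun ω => f ω + g ω) P :=
  fun n => (hf n).add (hg n)

lemma sub (hf : HasMoments f P) (hg : HasMoments g P) : HasMoments (fun ω => f ω - g ω) P :=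
  fun n => (hf n).sub (hg n)

lemma const_mul (hf : HasMoments f P) (c : ℝ) : HasMoments (fun ω => c * f ω) P :=
  fun n => (hf n).const_mul c

lemma mul (hf : HasMoments f P) (hg : HasMoments g P) : HasMoments (fun ω => f ω * g ω) P := by
  intro n
  have : ENNReal.HolderTriple ((2 * n : ℕ) : ENNReal) ((2 * n : ℕ) : ENNReal) n := by
    constructor
    rcases eq_or_ne n 0 with rfl | hn
    · simp
    · rw [Nat.cast_mul, ENNReal.mul_inv (by simp) (by simp), ← add_mul]
      simp [ENNReal.inv_two_add_inv_two]
  exact (hg (2 * n)).mul' (hf (2 * n))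

lemma pow [IsFiniteMeasure P] (hf : HasMoments f P) (k : ℕ) : HasMoments (fun ω => f ω ^ k) P := by
  induction k with
  | zero => simpa using const 1
  | succ k ih => simpa only [pow_succ] using ih.mul hf

lemma sum {ι : Type*} {s : Finset ι} {F : ι → Ω → ℝ} (hF : ∀ i ∈ s, HasMoments (F i) P) :
    HasMoments (fun ω => ∑ i ∈ s, F i ω) P :=
  fun n => memLp_finsetSum s fun i hi => hF i hi n

lemma div_const (hf : HasMoments f P) (c : ℝ) : HasMoments (fun ω => f ω / c) P := by
  simpa only [div_eq_inv_mul] using hf.const_mul c⁻¹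

lemma aestronglyMeasurable (hf : HasMoments f P) : AEStronglyMeasurable f P :=
  (hf 0).aestronglyMeasurable

lemma aemeasurable (hf : HasMoments f P) : AEMeasurable f P :=
  hf.aestronglyMeasurable.aemeasurable

lemma integrable (hf : HasMoments f P) : Integrable f P :=
  memLp_one_iff_integrable.1 (by simpa using hf 1)

lemma memLp_two (hf : HasMoments f P) : MemLp f 2 P := by simpa using hf 2

lemma memLp_four (hf : HasMoments f P) : MemLp f 4 P := by simpa using hf 4

lemma comp_measurePreserving {Ω' : Type*} [MeasurableSpace Ω'] {P' : Measure Ω'}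
    (hf : HasMoments f P) {φ : Ω' → Ω} (hφ : MeasurePreserving φ P' P) :
    HasMoments (fun ω => f (φ ω)) P' :=
  fun n => (hf n).comp_measurePreserving hφ

end HasMoments

section

variable {Ω : Type*} [MeasurableSpace Ω] {P : Measure Ω}

lemma integrable_fun_add {f g : Ω → ℝ} (hf : Integrable f P) (hg : Integrable g P) :
    Integrable (fun ω => f ω + g ω) P := hf.add hg

/-- The Cauchy–Schwarz inequality for squares of random variables. -/
lemma integral_sq_mul_sq_le {f g : Ω → ℝ} (hf : MemLp f 4 P) (hg : MemLp g 4 P) :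
    ∫ ω, f ω ^ 2 * g ω ^ 2 ∂P ≤ √(∫ ω, f ω ^ 4 ∂P) * √(∫ ω, g ω ^ 4 ∂P) := by
  have sq : ∀ {h : Ω → ℝ}, MemLp h 4 P → MemLp (fun ω => h ω ^ 2) (ENNReal.ofReal 2) P := by
    intro h hh
    have hm := hh.aestronglyMeasurable
    have : ENNReal.ofReal 2 = 2 := by simp
    rw [this, memLp_two_iff_integrable_sq (by fun_prop)]
    simpa only [← pow_mul] using integrable_pow_four hh
  have := integral_mul_le_Lp_mul_Lq_of_nonneg (μ := P) Real.HolderConjugate.two_two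
    (Eventually.of_forall fun ω => sq_nonneg (f ω)) (Eventually.of_forall fun ω => sq_nonneg (g ω))
    (sq hf) (sq hg)
  refine this.trans_eq ?_
  simp only [Real.rpow_two, ← pow_mul, Real.sqrt_eq_rpow]

lemma integral_sq_mul_sq_le_of_fourth_le {f g : Ω → ℝ} (hf : MemLp f 4 P) (hg : MemLp g 4 P)
    {K a b : ℝ} (hK : 0 ≤ K) (ha : 0 ≤ a) (hb : 0 ≤ b) (h1 : ∫ ω, f ω ^ 4 ∂P ≤ K * a ^ 2)
    (h2 : ∫ ω, g ω ^ 4 ∂P ≤ K * b ^ 2) : ∫ ω, f ω ^ 2 * g ω ^ 2 ∂P ≤ K * (a * b) := by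
  refine (integral_sq_mul_sq_le hf hg).trans ?_
  calc √(∫ ω, f ω ^ 4 ∂P) * √(∫ ω, g ω ^ 4 ∂P) ≤ √(K * a ^ 2) * √(K * b ^ 2) := by gcongr
    _ = K * (a * b) := by
      rw [Real.sqrt_mul hK, Real.sqrt_mul hK, Real.sqrt_sq ha, Real.sqrt_sq hb]
      linear_combination (a * b) * Real.mul_self_sqrt hK

/-- Bounded kurtosis passes to sums of two independent centred random variables. -/
lemma fourth_moment_add_le [IsProbabilityMeasure P] {X Y : Ω → ℝ} (hX : HasMoments X P) (hY : HasMoments Y P)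
    (hXY : IndepFun X Y P) (hX0 : ∫ ω, X ω ∂P = 0) (hY0 : ∫ ω, Y ω ∂P = 0) {K : ℝ} (hK : 3 ≤ K)
    (hX4 : ∫ ω, X ω ^ 4 ∂P ≤ K * (∫ ω, X ω ^ 2 ∂P) ^ 2)
    (hY4 : ∫ ω, Y ω ^ 4 ∂P ≤ K * (∫ ω, Y ω ^ 2 ∂P) ^ 2) :
    ∫ ω, (X ω + Y ω) ^ 4 ∂P ≤ K * (∫ ω, (X ω + Y ω) ^ 2 ∂P) ^ 2 := by
  have hprod : ∀ k l : ℕ, ∫ ω, X ω ^ k * Y ω ^ l ∂P = (∫ ω, X ω ^ k ∂P) * ∫ ω, Y ω ^ l ∂P :=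
    fun k l => hXY.integral_fun_comp_mul_comp (f := fun x => x ^ k) (g := fun y => y ^ l)
      hX.aemeasurable hY.aemeasurable (by fun_prop) (by fun_prop)
  have hi : ∀ k l : ℕ, Integrable (fun ω => X ω ^ k * Y ω ^ l) P :=
    fun k l => ((hX.pow k).mul (hY.pow l)).integrable
  have e2 : ∫ ω, (X ω + Y ω) ^ 2 ∂P = ∫ ω, X ω ^ 2 ∂P + ∫ ω, Y ω ^ 2 ∂P := by
    have : ∀ ω, (X ω + Y ω) ^ 2 = X ω ^ 2 * Y ω ^ 0 + X ω ^ 0 * Y ω ^ 2 + 2 * (X ω ^ 1 * Y ω ^ 1) :=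
      fun ω => by ring
    simp only [this]
    rw [integral_add (integrable_fun_add (hi 2 0) (hi 0 2)) ((hi 1 1).const_mul _),
      integral_add (hi 2 0) (hi 0 2), integral_const_mul, hprod, hprod, hprod]
    simp [hX0]
  have e4 : ∫ ω, (X ω + Y ω) ^ 4 ∂P =
      ∫ ω, X ω ^ 4 ∂P + ∫ ω, Y ω ^ 4 ∂P + 6 * ((∫ ω, X ω ^ 2 ∂P) * ∫ ω, Y ω ^ 2 ∂P) := by
    have : ∀ ω, (X ω + Y ω) ^ 4 = X ω ^ 4 * Y ω ^ 0 + X ω ^ 0 * Y ω ^ 4 +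
        6 * (X ω ^ 2 * Y ω ^ 2) + 4 * (X ω ^ 3 * Y ω ^ 1) + 4 * (X ω ^ 1 * Y ω ^ 3) :=
      fun ω => by ring
    simp only [this]
    have i1 := integrable_fun_add (hi 4 0) (hi 0 4)
    have i2 := integrable_fun_add i1 ((hi 2 2).const_mul 6)
    have i3 := integrable_fun_add i2 ((hi 3 1).const_mul 4)
    rw [integral_add i3 ((hi 1 3).const_mul _), integral_add i2 ((hi 3 1).const_mul _),
      integral_add i1 ((hi 2 2).const_mul _), integral_add (hi 4 0) (hi 0 4)]
    simp only [integral_const_mul, hprod]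
    simp [hX0, hY0]
  rw [e2, e4]
  have hx : 0 ≤ ∫ ω, X ω ^ 2 ∂P := integral_nonneg fun ω => sq_nonneg _
  have hy : 0 ≤ ∫ ω, Y ω ^ 2 ∂P := integral_nonneg fun ω => sq_nonneg _
  -- The mixed term is 6 xy on the left and 2K xy on the right; this is where 3 ≤ K is needed.
  nlinarith [mul_nonneg hx hy]

variable [IsProbabilityMeasure P]

/-- Bounded kurtosis passes to sums of independent centred random variables. -/
lemma fourth_moment_sum_le {ι : Type*} {X : ι → Ω → ℝ} (hX : ∀ i, HasMoments (X i) P)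
    (hind : iIndepFun X P) (hX0 : ∀ i, ∫ ω, X i ω ∂P = 0) {K : ℝ} (hK : 3 ≤ K)
    (hX4 : ∀ i, ∫ ω, X i ω ^ 4 ∂P ≤ K * (∫ ω, X i ω ^ 2 ∂P) ^ 2) (s : Finset ι) :
    ∫ ω, (∑ i ∈ s, X i ω) ^ 4 ∂P ≤ K * (∫ ω, (∑ i ∈ s, X i ω) ^ 2 ∂P) ^ 2 := by
  classical
  induction s using Finset.induction with
  | empty => simp
  | insert i s hi ih =>
    simp only [Finset.sum_insert hi]
    refine fourth_moment_add_le (hX i) (.sum fun j _ => hX j) ?_ (hX0 i) ?_ hK (hX4 i) ih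
    · have := (hind.indepFun_finsetSum_of_notMem₀ (fun j => (hX j).aemeasurable) hi).symm
      convert this using 1
      ext ω
      simp
    · rw [integral_finsetSum _ fun j _ => (hX j).integrable]
      simp [hX0]

end

lemma hasMoments_id_gaussianReal (m : ℝ) (v : NNReal) :
    HasMoments (fun x => x) (gaussianReal m v) :=
  fun n => memLp_id_gaussianReal' n (by simp)

lemma integral_gaussianReal_zero (v : NNReal) (f : ℝ → ℝ) (hf : Measurable f) :
    ∫ x, f x ∂(gaussianReal 0 v) = ∫ x, f (√v * x) ∂(gaussianReal 0 1) := by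
  have h : (gaussianReal 0 1).map (√(v : ℝ) * ·) = gaussianReal 0 v := by
    rw [gaussianReal_map_const_mul]
    congr 1
    · simp
    · ext; simp
  rw [← h, integral_map (by fun_prop) hf.aestronglyMeasurable]

lemma integral_sq_gaussianReal_zero_one : ∫ x, x ^ 2 ∂(gaussianReal 0 1) = 1 := by
  have h := variance_fun_id_gaussianReal (μ := 0) (v := 1)
  rw [variance_eq_integral (by fun_prop)] at h
  simpa using h

/-- The sum of two independent standard normals is √2 times a standard normal, so the fourth moment
m satisfies 4m = 2m + 6. -/
lemma integral_fourth_gaussianReal_zero_one : ∫ x, x ^ 4 ∂(gaussianReal 0 1) = 3 := by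
  have hm := hasMoments_id_gaussianReal 0 1
  have h1 : ∫ x, x ^ 4 ∂(gaussianReal 0 2) = 4 * ∫ x, x ^ 4 ∂(gaussianReal 0 1) := by
    rw [integral_gaussianReal_zero 2 (fun x => x ^ 4) (by fun_prop), ← integral_const_mul]
    congr with x
    rw [mul_pow, show √((2 : NNReal) : ℝ) ^ 4 = (√((2 : NNReal) : ℝ) ^ 2) ^ 2 by ring,
      Real.sq_sqrt (by positivity)]
    norm_num
  have h2 : ∫ x, x ^ 4 ∂(gaussianReal 0 2) =
      ∫ q : ℝ × ℝ, (q.1 + q.2) ^ 4 ∂((gaussianReal 0 1).prod (gaussianReal 0 1)) := by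
    have : gaussianReal 0 2 = (gaussianReal 0 1).conv (gaussianReal 0 1) := by
      rw [gaussianReal_conv_gaussianReal]
      norm_num
    rw [this, Measure.conv, integral_map (by fun_prop) (by fun_prop)]
  have hp : ∀ k l : ℕ, ∫ q : ℝ × ℝ, q.1 ^ k * q.2 ^ l ∂((gaussianReal 0 1).prod (gaussianReal 0 1)) =
      (∫ x, x ^ k ∂(gaussianReal 0 1)) * ∫ x, x ^ l ∂(gaussianReal 0 1) := fun k l =>
    integral_prod_mul (fun x : ℝ => x ^ k) (fun x : ℝ => x ^ l)
  have hi : ∀ k l : ℕ, Integrable (fun q : ℝ × ℝ => q.1 ^ k * q.2 ^ l)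
      ((gaussianReal 0 1).prod (gaussianReal 0 1)) := fun k l =>
    ((hm.pow k).integrable).mul_prod ((hm.pow l).integrable)
  have e4 : ∫ q : ℝ × ℝ, (q.1 + q.2) ^ 4 ∂((gaussianReal 0 1).prod (gaussianReal 0 1)) =
      2 * ∫ x, x ^ 4 ∂(gaussianReal 0 1) + 6 := by
    have : ∀ q : ℝ × ℝ, (q.1 + q.2) ^ 4 = q.1 ^ 4 * q.2 ^ 0 + q.1 ^ 0 * q.2 ^ 4 +
        6 * (q.1 ^ 2 * q.2 ^ 2) + 4 * (q.1 ^ 3 * q.2 ^ 1) + 4 * (q.1 ^ 1 * q.2 ^ 3) :=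
      fun q => by ring
    simp only [this]
    have i1 := integrable_fun_add (hi 4 0) (hi 0 4)
    have i2 := integrable_fun_add i1 ((hi 2 2).const_mul 6)
    have i3 := integrable_fun_add i2 ((hi 3 1).const_mul 4)
    rw [integral_add i3 ((hi 1 3).const_mul _), integral_add i2 ((hi 3 1).const_mul _),
      integral_add i1 ((hi 2 2).const_mul _), integral_add (hi 4 0) (hi 0 4)]
    simp only [integral_const_mul, hp, integral_sq_gaussianReal_zero_one]
    simp
    ring
  linarith

lemma integral_fourth_gaussianReal (v : NNReal) :
    ∫ x, x ^ 4 ∂(gaussianReal 0 v) = 3 * (v : ℝ) ^ 2 := by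
  rw [integral_gaussianReal_zero v (fun x => x ^ 4) (by fun_prop)]
  simp only [mul_pow]
  rw [integral_const_mul, integral_fourth_gaussianReal_zero_one,
    show √(v : ℝ) ^ 4 = (√(v : ℝ) ^ 2) ^ 2 by ring, Real.sq_sqrt v.coe_nonneg]
  ring

/-- A bound on the kurtosis of centred quadratic forms of Gaussian vectors. -/
noncomputable def chaosConst : ℝ := 3 + ∫ x, (x ^ 2 - 1) ^ 4 ∂(gaussianReal 0 1)

lemma three_le_chaosConst : 3 ≤ chaosConst := by
  have : 0 ≤ ∫ x, (x ^ 2 - 1) ^ 4 ∂(gaussianReal 0 1) :=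
    integral_nonneg fun x => by positivity
  unfold chaosConst
  linarith

lemma integral_sq_sub_one_gaussianReal :
    ∫ x, (x ^ 2 - 1) ∂(gaussianReal 0 1) = 0 ∧ ∫ x, (x ^ 2 - 1) ^ 2 ∂(gaussianReal 0 1) = 2 := by
  have hm := hasMoments_id_gaussianReal 0 1
  constructor
  · rw [integral_sub (hm.pow 2).integrable (integrable_const _), integral_sq_gaussianReal_zero_one]
    simp
  · have : ∀ x : ℝ, (x ^ 2 - 1) ^ 2 = x ^ 4 - 2 * x ^ 2 + 1 := fun x => by ring
    simp only [this]
    rw [integral_add ((hm.pow 4).sub ((hm.pow 2).const_mul 2)).integrable (integrable_const _),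
      integral_sub (hm.pow 4).integrable ((hm.pow 2).const_mul 2).integrable, integral_const_mul,
      integral_sq_gaussianReal_zero_one, integral_fourth_gaussianReal_zero_one]
    simp
    norm_num

end BandTest

/-! ### Kurtosis of quadratic forms of a Gaussian vector. -/

namespace BandTest

lemma hasMoments_eval_pi {ι : Type*} [Fintype ι] (i : ι) :
    HasMoments (fun x : ι → ℝ => x i) (Measure.pi fun _ : ι => gaussianReal 0 1) :=
  (hasMoments_id_gaussianReal 0 1).comp_measurePreserving
    (measurePreserving_eval (fun _ : ι => gaussianReal 0 1) i)

/-- The kurtosis bound for centred weighted sums of squares of independent standard Gaussian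
variables. -/
lemma fourth_moment_sum_mul_sq_le {ι : Type*} [Fintype ι] (l : ι → ℝ)
    (h0 : ∫ x, ∑ i, l i * x i ^ 2 ∂(Measure.pi fun _ : ι => gaussianReal 0 1) = 0) :
    ∫ x, (∑ i, l i * x i ^ 2) ^ 4 ∂(Measure.pi fun _ : ι => gaussianReal 0 1) ≤
      chaosConst * (∫ x, (∑ i, l i * x i ^ 2) ^ 2
        ∂(Measure.pi fun _ : ι => gaussianReal 0 1)) ^ 2 := by
  set P := Measure.pi fun _ : ι => gaussianReal 0 1 with hP
  have hev : ∀ (i : ι) (f : ℝ → ℝ), Measurable f →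
      ∫ x, f (x i) ∂P = ∫ x, f x ∂(gaussianReal 0 1) := fun i f hf => by
    rw [← (measurePreserving_eval (fun _ : ι => gaussianReal 0 1) i).map_eq,
      integral_map (measurable_pi_apply i).aemeasurable (by fun_prop)]
  -- The form being centred means that the weights sum to zero, so each square may be replaced by
  -- its centred version; the form is then a sum of independent centred variables.
  have hsum : ∑ i, l i = 0 := by
    rw [integral_finsetSum _ fun i _ => (((hasMoments_eval_pi i).pow 2).const_mul _).integrable]
      at h0
    rw [← h0]
    refine Finset.sum_congr rfl fun i _ => ?_
    rw [integral_const_mul, hev i (fun x => x ^ 2) (by fun_prop),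
      integral_sq_gaussianReal_zero_one, mul_one]
  have hm : ∀ i, HasMoments (fun x : ι → ℝ => l i * (x i ^ 2 - 1)) P := fun i =>
    (((hasMoments_eval_pi i).pow 2).sub (.const 1)).const_mul _
  have hind : iIndepFun (fun i (x : ι → ℝ) => l i * (x i ^ 2 - 1)) P :=
    iIndepFun_pi (μ := fun _ : ι => gaussianReal 0 1) (X := fun i x => l i * (x ^ 2 - 1))
      fun i => by fun_prop
  have key := fourth_moment_sum_le hm hind (fun i => ?_) three_le_chaosConst (fun i => ?_)
    Finset.univ
  · have : ∀ x : ι → ℝ, ∑ i, l i * (x i ^ 2 - 1) = ∑ i, l i * x i ^ 2 := fun x => by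
      simp only [mul_sub, Finset.sum_sub_distrib, mul_one, hsum, sub_zero]
    simpa only [this] using key
  · rw [integral_const_mul, hev i (fun x => x ^ 2 - 1) (by fun_prop),
      integral_sq_sub_one_gaussianReal.1, mul_zero]
  · simp only [mul_pow]
    rw [integral_const_mul, integral_const_mul, hev i (fun x => (x ^ 2 - 1) ^ 4) (by fun_prop),
      hev i (fun x => (x ^ 2 - 1) ^ 2) (by fun_prop), integral_sq_sub_one_gaussianReal.2,
      mul_pow, ← pow_mul, show chaosConst * (l i ^ (2 * 2) * 2 ^ 2) =
        l i ^ 4 * (4 * chaosConst) by ring]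
    gcongr
    have := three_le_chaosConst
    unfold chaosConst at this ⊢
    linarith

section

variable {E : Type*} [NormedAddCommGroup E] [InnerProductSpace ℝ E] [FiniteDimensional ℝ E]
  [MeasurableSpace E] [BorelSpace E]

open scoped RealInnerProductSpace in
/-- A quadratic form of a standard Gaussian vector is distributed as a weighted sum of squares of
independent standard Gaussian variables. -/
lemma exists_map_inner_stdGaussian {A : E →ₗ[ℝ] E} (hA : A.IsSymmetric) :
    ∃ l : Fin (Module.finrank ℝ E) → ℝ, ∀ f : ℝ → ℝ, Continuous f →
      ∫ z, f ⟪z, A z⟫ ∂(stdGaussian E) =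
        ∫ x, f (∑ i, l i * x i ^ 2) ∂(Measure.pi fun _ => gaussianReal 0 1) := by
  refine ⟨hA.eigenvalues rfl, fun f hf => ?_⟩
  have hA' : Continuous A := A.continuous_of_finiteDimensional
  -- Rotation invariance: the standard Gaussian has independent standard coordinates in an
  -- eigenbasis of A too.
  rw [stdGaussian_eq_map_pi_orthonormalBasis (hA.eigenvectorBasis rfl),
    integral_map (Measurable.aemeasurable (by fun_prop))
      (Continuous.aestronglyMeasurable (by fun_prop))]
  congr with x
  congr 1
  simp only [map_sum, map_smul, hA.apply_eigenvectorBasis]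
  simp only [smul_smul, RCLike.ofReal_real_eq_id, id]
  rw [sum_inner]
  refine Finset.sum_congr rfl fun i _ => ?_
  rw [real_inner_smul_left, (hA.eigenvectorBasis rfl).orthonormal.inner_right_fintype
    (fun j => x j * hA.eigenvalues rfl j) i]
  ring

end

/-- The quadratic form of a matrix. -/
noncomputable def quadForm {ι : Type*} [Fintype ι] (M : Matrix ι ι ℝ) (x : ι → ℝ) : ℝ :=
  ∑ j, ∑ k, M j k * (x j * x k)

section

variable {ι : Type*} [Fintype ι] [DecidableEq ι] {S : Matrix ι ι ℝ}

lemma inner_toEuclideanCLM_eq_quadForm (M : Matrix ι ι ℝ) (x : EuclideanSpace ℝ ι) :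
    inner ℝ x (Matrix.toEuclideanCLM (𝕜 := ℝ) M x) = quadForm M x := by
  rw [Matrix.inner_toEuclideanCLM]
  simp only [quadForm, dotProduct, Matrix.mulVec, Finset.mul_sum]
  exact Finset.sum_congr rfl fun j _ => Finset.sum_congr rfl fun k _ =>
    mul_left_comm _ _ _

open scoped MatrixOrder Matrix.Norms.L2Operator in
/-- A quadratic form of a centred Gaussian vector is distributed as a weighted sum of squares of
independent standard Gaussian variables. -/
lemma exists_map_quadForm_multivariateGaussian {M : Matrix ι ι ℝ} (hM : M.IsHermitian) :
    ∃ (n : ℕ) (l : Fin n → ℝ), ∀ f : ℝ → ℝ, Continuous f →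
      ∫ x, f (quadForm M x) ∂(multivariateGaussian 0 S) =
        ∫ x, f (∑ i, l i * x i ^ 2) ∂(Measure.pi fun _ => gaussianReal 0 1) := by
  set T := Matrix.toEuclideanCLM (𝕜 := ℝ) (CFC.sqrt S) with hT
  set B := Matrix.toEuclideanCLM (𝕜 := ℝ) M with hB
  have hTs : IsSelfAdjoint T := (CFC.sqrt_nonneg S).isSelfAdjoint.map _
  have hBs : IsSelfAdjoint B := (show IsSelfAdjoint M from hM).map _
  -- The Gaussian vector is T z with z standard and T the self-adjoint square root of S, so its
  -- quadratic form in M is that of z in T M T.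
  have hA : ((T ∘L B ∘L T : EuclideanSpace ℝ ι →L[ℝ] EuclideanSpace ℝ ι) :
      EuclideanSpace ℝ ι →ₗ[ℝ] EuclideanSpace ℝ ι).IsSymmetric := by
    intro u w
    have h1 := hTs.isSymmetric
    have h2 := hBs.isSymmetric
    change inner ℝ (T (B (T u))) w = inner ℝ u (T (B (T w)))
    rw [show inner ℝ (T (B (T u))) w = inner ℝ (B (T u)) (T w) from h1 _ _,
      show inner ℝ (B (T u)) (T w) = inner ℝ (T u) (B (T w)) from h2 _ _,
      show inner ℝ (T u) (B (T w)) = inner ℝ u (T (B (T w))) from h1 _ _]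
  obtain ⟨l, hl⟩ := exists_map_inner_stdGaussian hA
  refine ⟨_, l, fun f hf => ?_⟩
  rw [← hl f hf, multivariateGaussian, integral_map (by fun_prop)]
  · congr with z
    congr 1
    rw [zero_add, ← inner_toEuclideanCLM_eq_quadForm]
    exact hTs.isSymmetric _ _
  · refine Continuous.aestronglyMeasurable (hf.comp ?_)
    unfold quadForm
    fun_prop

/-- The kurtosis bound for centred quadratic forms of Gaussian vectors. -/
lemma fourth_moment_quadForm_le {M : Matrix ι ι ℝ} (hM : M.IsHermitian)
    (h0 : ∫ x, quadForm M x ∂(multivariateGaussian 0 S) = 0) :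
    ∫ x, quadForm M x ^ 4 ∂(multivariateGaussian 0 S) ≤
      chaosConst * (∫ x, quadForm M x ^ 2 ∂(multivariateGaussian 0 S)) ^ 2 := by
  obtain ⟨n, l, hl⟩ := exists_map_quadForm_multivariateGaussian (S := S) hM
  rw [hl (fun t => t ^ 4) (by fun_prop), hl (fun t => t ^ 2) (by fun_prop)]
  refine fourth_moment_sum_mul_sq_le l ?_
  rw [← hl (fun t => t) (by fun_prop)]
  exact h0

lemma hasMoments_eval_multivariateGaussian (m : EuclideanSpace ℝ ι) (hS : S.PosSemidef) (j : ι) :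
    HasMoments (fun x : EuclideanSpace ℝ ι => x j) (multivariateGaussian m S) :=
  (hasMoments_id_gaussianReal _ _).comp_measurePreserving
    (measurePreserving_eval_multivariateGaussian hS (i := j))

lemma integral_eval_multivariateGaussian (m : EuclideanSpace ℝ ι) (hS : S.PosSemidef) (j : ι) :
    ∫ x, x j ∂(multivariateGaussian m S) = m j := by
  have h := measurePreserving_eval_multivariateGaussian (μ := m) hS (i := j)
  rw [← integral_id_gaussianReal (μ := m j) (v := (S j j).toNNReal), ← h.map_eq,
    integral_map h.measurable.aemeasurable (by fun_prop)]

lemma integral_mul_multivariateGaussian (hS : S.PosSemidef) (j k : ι) :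
    ∫ x, x j * x k ∂(multivariateGaussian 0 S) = S j k := by
  rw [← covariance_eval_multivariateGaussian (μ := 0) hS j k, covariance_eq_sub
    (hasMoments_eval_multivariateGaussian 0 hS j).memLp_two
    (hasMoments_eval_multivariateGaussian 0 hS k).memLp_two,
    integral_eval_multivariateGaussian 0 hS]
  simp

/-- The mean of a quadratic form that does not involve correlated coordinates is zero. -/
lemma integral_quadForm_eq_zero (hS : S.PosSemidef) {M : Matrix ι ι ℝ}
    (hMS : ∀ j k, M j k * S j k = 0) : ∫ x, quadForm M x ∂(multivariateGaussian 0 S) = 0 := by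
  have hi : ∀ j k, Integrable (fun x : EuclideanSpace ℝ ι => M j k * (x j * x k))
      (multivariateGaussian 0 S) := fun j k =>
    (((hasMoments_eval_multivariateGaussian 0 hS j).mul
      (hasMoments_eval_multivariateGaussian 0 hS k)).const_mul _).integrable
  unfold quadForm
  rw [integral_finsetSum _ fun j _ => integrable_finsetSum _ fun k _ => hi j k]
  refine Finset.sum_eq_zero fun j _ => ?_
  rw [integral_finsetSum _ fun k _ => hi j k]
  refine Finset.sum_eq_zero fun k _ => ?_
  rw [integral_const_mul, integral_mul_multivariateGaussian hS, hMS]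

end

end BandTest

/-! ### Kurtosis of forms quadratic in each of two independent Gaussian vectors. -/

namespace BandTest

/-- Bounded kurtosis in each of two independent variables separately implies bounded kurtosis. -/
lemma fourth_moment_prod_le {α β : Type*} [MeasurableSpace α] [MeasurableSpace β] {γ : Measure α}
    {η : Measure β} [IsProbabilityMeasure γ] [IsProbabilityMeasure η] {F : α → β → ℝ} {K : ℝ}
    (hK : 0 ≤ K) (hF : HasMoments (fun q : α × β => F q.1 q.2) (γ.prod η))
    (hF₁ : HasMoments (fun q : β × (α × α) => F q.2.1 q.1) (η.prod (γ.prod γ)))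
    (hF₂ : HasMoments (fun q : β × (α × α) => F q.2.2 q.1) (η.prod (γ.prod γ)))
    (hx : ∀ x, HasMoments (F x) η)
    (h₁ : ∀ y, ∫ x, F x y ^ 4 ∂γ ≤ K * (∫ x, F x y ^ 2 ∂γ) ^ 2)
    (h₂ : ∀ x, ∫ y, F x y ^ 4 ∂η ≤ K * (∫ y, F x y ^ 2 ∂η) ^ 2) :
    ∫ q : α × β, F q.1 q.2 ^ 4 ∂(γ.prod η) ≤
      K ^ 2 * (∫ q : α × β, F q.1 q.2 ^ 2 ∂(γ.prod η)) ^ 2 := by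
  set H : α → ℝ := fun x => ∫ y, F x y ^ 2 ∂η with hH
  have hH0 : ∀ x, 0 ≤ H x := fun x => integral_nonneg fun y => sq_nonneg _
  have hHi : Integrable H γ := (hF.pow 2).integrable.integral_prod_left
  have hHs : ∫ q : α × β, F q.1 q.2 ^ 2 ∂(γ.prod η) = ∫ x, H x ∂γ :=
    integral_prod _ (hF.pow 2).integrable
  -- The square becomes an integral over an independent copy of x, so that Fubini allows y to be
  -- integrated first.
  have hG : ∀ y, (∫ x, F x y ^ 2 ∂γ) ^ 2 =
      ∫ q : α × α, F q.1 y ^ 2 * F q.2 y ^ 2 ∂(γ.prod γ) := fun y => by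
    rw [sq, ← integral_prod_mul (fun x => F x y ^ 2) (fun x => F x y ^ 2)]
  have hI : Integrable (fun q : β × (α × α) => F q.2.1 q.1 ^ 2 * F q.2.2 q.1 ^ 2)
      (η.prod (γ.prod γ)) := ((hF₁.pow 2).mul (hF₂.pow 2)).integrable
  -- For fixed x and x', the Cauchy–Schwarz inequality and the kurtosis bound in y give ∫ F(x,y)²
  -- F(x',y)² dy ≤ K H(x) H(x'); integrating over both copies gives the square of ∫ H.
  have hG2 : ∫ y, (∫ x, F x y ^ 2 ∂γ) ^ 2 ∂η ≤ K * (∫ x, H x ∂γ) ^ 2 := by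
    simp only [hG]
    rw [integral_integral_swap (f := fun y (q : α × α) => F q.1 y ^ 2 * F q.2 y ^ 2) hI, sq,
      ← integral_prod_mul, ← integral_const_mul]
    refine integral_mono hI.integral_prod_right ((hHi.mul_prod hHi).const_mul K) fun q => ?_
    exact integral_sq_mul_sq_le_of_fourth_le (hx q.1).memLp_four (hx q.2).memLp_four hK (hH0 _)
      (hH0 _) (h₂ _) (h₂ _)
  rw [hHs, integral_prod_symm _ (hF.pow 4).integrable]
  calc ∫ y, ∫ x, F x y ^ 4 ∂γ ∂η ≤ ∫ y, K * (∫ x, F x y ^ 2 ∂γ) ^ 2 ∂η := by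
        refine integral_mono (hF.pow 4).integrable.integral_prod_right ?_ h₁
        simp only [hG]
        exact hI.integral_prod_left.const_mul K
    _ ≤ K * (K * (∫ x, H x ∂γ) ^ 2) := by
        rw [integral_const_mul]
        gcongr
    _ = _ := by ring

/-- The form `∑ D_{jk} x_j x_k y_j y_k`. -/
noncomputable def crossForm {ι : Type*} [Fintype ι] (D : Matrix ι ι ℝ) (x y : ι → ℝ) : ℝ :=
  ∑ j, ∑ k, D j k * (x j * x k * (y j * y k))

section

variable {ι : Type*} [Fintype ι] [DecidableEq ι] {S D : Matrix ι ι ℝ}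

omit [DecidableEq ι] in
lemma crossForm_eq_quadForm (x y : ι → ℝ) :
    crossForm D x y = quadForm (Matrix.of fun j k => D j k * (y j * y k)) x :=
  Finset.sum_congr rfl fun j _ => Finset.sum_congr rfl fun k _ => by
    simp only [Matrix.of_apply]; ring

omit [DecidableEq ι] in
lemma crossForm_comm (x y : ι → ℝ) : crossForm D x y = crossForm D y x :=
  Finset.sum_congr rfl fun j _ => Finset.sum_congr rfl fun k _ => by ring

/-- For fixed y this is a quadratic form in x with matrix D_jk y_j y_k. That matrix is symmetric and
still vanishes wherever S does not, so the form is centred for every single y and the quadratic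
bound applies conditionally. -/
lemma fourth_moment_crossForm_right_le (hS : S.PosSemidef) (hD : D.IsHermitian)
    (hDS : ∀ j k, D j k * S j k = 0) (y : ι → ℝ) :
    ∫ x, crossForm D x y ^ 4 ∂(multivariateGaussian 0 S) ≤
      chaosConst * (∫ x, crossForm D x y ^ 2 ∂(multivariateGaussian 0 S)) ^ 2 := by
  simp only [crossForm_eq_quadForm]
  refine fourth_moment_quadForm_le ?_ (integral_quadForm_eq_zero hS fun j k => ?_)
  · ext j k
    have : D k j = D j k := by simpa using hD.apply j k
    simp only [Matrix.conjTranspose_apply, Matrix.of_apply, this, star_trivial]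
    ring
  · rw [Matrix.of_apply, mul_right_comm, hDS, zero_mul]

omit [DecidableEq ι] in
lemma hasMoments_crossForm {Ω : Type*} [MeasurableSpace Ω] {P : Measure Ω} {x y : ι → Ω → ℝ}
    (hx : ∀ j, HasMoments (x j) P) (hy : ∀ j, HasMoments (y j) P) :
    HasMoments (fun ω => crossForm D (fun j => x j ω) (fun j => y j ω)) P :=
  .sum fun j _ => .sum fun k _ => (((hx j).mul (hx k)).mul ((hy j).mul (hy k))).const_mul _

omit [DecidableEq ι] in
lemma hasMoments_quadForm {Ω : Type*} [MeasurableSpace Ω] {P : Measure Ω} {x : ι → Ω → ℝ}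
    (hx : ∀ j, HasMoments (x j) P) :
    HasMoments (fun ω => quadForm D (fun j => x j ω)) P :=
  .sum fun j _ => .sum fun k _ => ((hx j).mul (hx k)).const_mul _

/-- The kurtosis bound for the form `∑ D_{jk} x_j x_k y_j y_k` of two independent Gaussian
vectors. -/
lemma fourth_moment_crossForm_le (hS : S.PosSemidef) (hD : D.IsHermitian)
    (hDS : ∀ j k, D j k * S j k = 0) :
    ∫ q, crossForm D q.1 q.2 ^ 4 ∂((multivariateGaussian 0 S).prod (multivariateGaussian 0 S)) ≤
      chaosConst ^ 2 * (∫ q, crossForm D q.1 q.2 ^ 2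
        ∂((multivariateGaussian 0 S).prod (multivariateGaussian 0 S))) ^ 2 := by
  have hm := hasMoments_eval_multivariateGaussian 0 hS
  refine fourth_moment_prod_le (F := fun x y : EuclideanSpace ℝ ι => crossForm D x y)
    (by have := three_le_chaosConst; linarith) ?_ ?_ ?_ (fun x => ?_) (fun y => ?_) (fun x => ?_)
  · exact hasMoments_crossForm (fun j => (hm j).comp_measurePreserving measurePreserving_fst)
      fun j => (hm j).comp_measurePreserving measurePreserving_snd
  · exact hasMoments_crossForm
      (fun j => (hm j).comp_measurePreserving (measurePreserving_fst.comp measurePreserving_snd))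
      fun j => (hm j).comp_measurePreserving measurePreserving_fst
  · exact hasMoments_crossForm
      (fun j => (hm j).comp_measurePreserving (measurePreserving_snd.comp measurePreserving_snd))
      fun j => (hm j).comp_measurePreserving measurePreserving_fst
  · exact hasMoments_crossForm (fun j => .const _) hm
  · exact fourth_moment_crossForm_right_le hS hD hDS y
  · simp only [crossForm_comm (D := D) x]
    exact fourth_moment_crossForm_right_le hS hD hDS x

end

end BandTest

/-! ### Gaussian spaces, Wick's formula and independence. -/

namespace BandTest

/-- A linear space of centred Gaussian random variables. -/
def IsCenteredGaussianSpace {Ω : Type*} [MeasurableSpace Ω] (G : Submodule ℝ (Ω → ℝ))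
    (P : Measure Ω) : Prop :=
  ∀ f ∈ G, HasGaussianLaw f P ∧ ∫ ω, f ω ∂P = 0

namespace IsCenteredGaussianSpace

variable {Ω : Type*} [MeasurableSpace Ω] {P : Measure Ω} {G : Submodule ℝ (Ω → ℝ)}

lemma hasMoments (hG : IsCenteredGaussianSpace G P) {f : Ω → ℝ} (hf : f ∈ G) : HasMoments f P :=
  fun _ => (hG f hf).1.memLp (by simp)

lemma integral_pow_four (hG : IsCenteredGaussianSpace G P) {f : Ω → ℝ} (hf : f ∈ G) :
    ∫ ω, f ω ^ 4 ∂P = 3 * (∫ ω, f ω ^ 2 ∂P) ^ 2 := by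
  obtain ⟨hg, h0⟩ := hG f hf
  have hP := hg.isProbabilityMeasure
  have hv : Var[f; P] = ∫ ω, f ω ^ 2 ∂P := by
    rw [variance_eq_integral hg.aemeasurable, h0]; simp
  have h := integral_fourth_gaussianReal Var[f; P].toNNReal
  have hmap := hg.map_eq_gaussianReal
  rw [h0] at hmap
  rw [← hmap, integral_map hg.aemeasurable (by fun_prop), Real.coe_toNNReal _ (variance_nonneg _ _),
    hv] at h
  exact h

/-- Wick's formula for the product of four centred Gaussian variables. -/
lemma integral_mul_four (hG : IsCenteredGaussianSpace G P) {a b c d : Ω → ℝ} (ha : a ∈ G)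
    (hb : b ∈ G) (hc : c ∈ G) (hd : d ∈ G) :
    ∫ ω, a ω * b ω * (c ω * d ω) ∂P =
      (∫ ω, a ω * b ω ∂P) * (∫ ω, c ω * d ω ∂P) + (∫ ω, a ω * c ω ∂P) * (∫ ω, b ω * d ω ∂P) +
        (∫ ω, a ω * d ω ∂P) * (∫ ω, b ω * c ω ∂P) := by
  have hP := (hG a ha).1.isProbabilityMeasure
  have ma := hG.hasMoments ha
  have mb := hG.hasMoments hb
  have mc := hG.hasMoments hc
  have md := hG.hasMoments hd
  have hsq : ∀ s t u : ℝ, ∫ ω, (a ω + s * b ω + t * c ω + u * d ω) ^ 2 ∂P =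
      ∫ ω, a ω * a ω ∂P + s ^ 2 * ∫ ω, b ω * b ω ∂P + t ^ 2 * ∫ ω, c ω * c ω ∂P +
      u ^ 2 * ∫ ω, d ω * d ω ∂P + 2 * s * ∫ ω, a ω * b ω ∂P + 2 * t * ∫ ω, a ω * c ω ∂P +
      2 * u * ∫ ω, a ω * d ω ∂P + 2 * s * t * ∫ ω, b ω * c ω ∂P +
      2 * s * u * ∫ ω, b ω * d ω ∂P + 2 * t * u * ∫ ω, c ω * d ω ∂P := by
    intro s t u
    have e : ∀ ω, (a ω + s * b ω + t * c ω + u * d ω) ^ 2 =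
        a ω * a ω + s ^ 2 * (b ω * b ω) + t ^ 2 * (c ω * c ω) + u ^ 2 * (d ω * d ω) +
        2 * s * (a ω * b ω) + 2 * t * (a ω * c ω) + 2 * u * (a ω * d ω) +
        2 * s * t * (b ω * c ω) + 2 * s * u * (b ω * d ω) + 2 * t * u * (c ω * d ω) :=
      fun ω => by ring
    have i1 := ma.mul ma
    have i2 := i1.add ((mb.mul mb).const_mul (s ^ 2))
    have i3 := i2.add ((mc.mul mc).const_mul (t ^ 2))
    have i4 := i3.add ((md.mul md).const_mul (u ^ 2))
    have i5 := i4.add ((ma.mul mb).const_mul (2 * s))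
    have i6 := i5.add ((ma.mul mc).const_mul (2 * t))
    have i7 := i6.add ((ma.mul md).const_mul (2 * u))
    have i8 := i7.add ((mb.mul mc).const_mul (2 * s * t))
    have i9 := i8.add ((mb.mul md).const_mul (2 * s * u))
    simp only [e]
    rw [integral_add i9.integrable ((mc.mul md).const_mul _).integrable,
      integral_add i8.integrable ((mb.mul md).const_mul _).integrable,
      integral_add i7.integrable ((mb.mul mc).const_mul _).integrable,
      integral_add i6.integrable ((ma.mul md).const_mul _).integrable,
      integral_add i5.integrable ((ma.mul mc).const_mul _).integrable,
      integral_add i4.integrable ((ma.mul mb).const_mul _).integrable,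
      integral_add i3.integrable ((md.mul md).const_mul _).integrable,
      integral_add i2.integrable ((mc.mul mc).const_mul _).integrable,
      integral_add i1.integrable ((mb.mul mb).const_mul _).integrable]
    simp only [integral_const_mul]
  have hmem : ∀ s t u : ℝ, (fun ω => a ω + s * b ω + t * c ω + u * d ω) ∈ G := fun s t u =>
    G.add_mem (G.add_mem (G.add_mem ha (G.smul_mem s hb)) (G.smul_mem t hc)) (G.smul_mem u hd)
  have h4 := fun s t u => (hG.integral_pow_four (hmem s t u)).trans (by rw [hsq s t u])
  have i4 := fun s t u => ((hG.hasMoments (hmem s t u)).pow 4).integrable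
  -- Polarization: the signed sum of fourth powers over the eight choices of signs is 8 · 4! = 192
  -- times the product. The identity E f⁴ = 3 (E f²)² for each combination then turns Wick's formula
  -- into polynomial algebra.
  have e : ∀ ω, a ω * b ω * (c ω * d ω) = 1 / 192 *
      ((((a ω + 1 * b ω + 1 * c ω + 1 * d ω) ^ 4 - (a ω + 1 * b ω + 1 * c ω + (-1) * d ω) ^ 4) -
        ((a ω + 1 * b ω + (-1) * c ω + 1 * d ω) ^ 4 -
          (a ω + 1 * b ω + (-1) * c ω + (-1) * d ω) ^ 4)) -
      (((a ω + (-1) * b ω + 1 * c ω + 1 * d ω) ^ 4 -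
          (a ω + (-1) * b ω + 1 * c ω + (-1) * d ω) ^ 4) -
        ((a ω + (-1) * b ω + (-1) * c ω + 1 * d ω) ^ 4 -
          (a ω + (-1) * b ω + (-1) * c ω + (-1) * d ω) ^ 4))) := fun ω => by ring
  have isub : ∀ {f g : Ω → ℝ}, Integrable f P → Integrable g P →
      Integrable (fun ω => f ω - g ω) P := fun hf hg => hf.sub hg
  have j1 := fun s t => isub (i4 s t 1) (i4 s t (-1))
  have j2 := fun s => isub (j1 s 1) (j1 s (-1))
  simp only [e]
  rw [integral_const_mul, integral_sub (j2 1) (j2 (-1)), integral_sub (j1 1 1) (j1 1 (-1)),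
    integral_sub (j1 (-1) 1) (j1 (-1) (-1)), integral_sub (i4 1 1 1) (i4 1 1 (-1)),
    integral_sub (i4 1 (-1) 1) (i4 1 (-1) (-1)), integral_sub (i4 (-1) 1 1) (i4 (-1) 1 (-1)),
    integral_sub (i4 (-1) (-1) 1) (i4 (-1) (-1) (-1))]
  simp only [h4]
  ring

/-- Finite families of elements of a Gaussian space are jointly Gaussian. -/
lemma hasGaussianLaw_pi (hG : IsCenteredGaussianSpace G P) {κ : Type*} [Fintype κ]
    {f : κ → Ω → ℝ} (hf : ∀ k, f k ∈ G) : HasGaussianLaw (fun ω k => f k ω) P := by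
  classical
  have hm : AEMeasurable (fun ω k => f k ω) P :=
    aemeasurable_pi_lambda _ fun k => (hG _ (hf k)).1.aemeasurable
  constructor
  constructor
  intro L
  -- A linear functional of the family lies in G again, hence is Gaussian; joint Gaussianity only
  -- asks for this.
  have hL : (L ∘ fun ω k => f k ω) ∈ G := by
    have : (L ∘ fun ω k => f k ω) = ∑ k, L (Pi.single k 1) • f k := by
      ext ω
      simp only [Function.comp_apply, Finset.sum_apply, Pi.smul_apply, smul_eq_mul]
      conv_lhs => rw [← Finset.univ_sum_single (fun k => f k ω), map_sum]
      refine Finset.sum_congr rfl fun k _ => ?_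
      rw [mul_comm, ← smul_eq_mul, ← map_smul]
      congr 1
      ext j
      simp [Pi.single_apply]
    rw [this]
    exact G.sum_mem fun k _ => G.smul_mem _ (hf k)
  rw [AEMeasurable.map_map_of_aemeasurable (by fun_prop) hm,
    integral_map hm (by fun_prop), variance_map (by fun_prop) hm]
  exact (hG _ hL).1.map_eq_gaussianReal

lemma covariance_eq (hG : IsCenteredGaussianSpace G P) {a b : Ω → ℝ} (ha : a ∈ G) (hb : b ∈ G) :
    cov[a, b; P] = ∫ ω, a ω * b ω ∂P := by
  have hP := (hG a ha).1.isProbabilityMeasure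
  rw [covariance_eq_sub (hG.hasMoments ha).memLp_two (hG.hasMoments hb).memLp_two, (hG a ha).2]
  simp

/-- Uncorrelated families in a Gaussian space are independent. -/
lemma indepFun (hG : IsCenteredGaussianSpace G P) {κ κ' : Type*} [Fintype κ] [Fintype κ']
    {f : κ → Ω → ℝ} {g : κ' → Ω → ℝ} (hf : ∀ k, f k ∈ G) (hg : ∀ k, g k ∈ G)
    (h : ∀ k l, ∫ ω, f k ω * g l ω ∂P = 0) :
    IndepFun (fun ω k => f k ω) (fun ω k => g k ω) P := by
  refine HasGaussianLaw.indepFun_of_covariance_eval ?_ fun k l => ?_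
  · have hs := hG.hasGaussianLaw_pi (f := Sum.elim f g) (Sum.rec hf hg)
    exact hs.map (ContinuousLinearMap.prod
      (ContinuousLinearMap.pi fun k => ContinuousLinearMap.proj (Sum.inl k))
      (ContinuousLinearMap.pi fun k => ContinuousLinearMap.proj (Sum.inr k)))
  · rw [hG.covariance_eq (hf k) (hg l), h]

/-- Pairwise uncorrelated families in a Gaussian space are independent. -/
lemma iIndepFun (hG : IsCenteredGaussianSpace G P) {ι κ : Type*} [Fintype ι] [Fintype κ]
    {f : ι → κ → Ω → ℝ} (hf : ∀ i k, f i k ∈ G)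
    (h : ∀ i j, i ≠ j → ∀ k l, ∫ ω, f i k ω * f j l ω ∂P = 0) :
    iIndepFun (fun i ω k => f i k ω) P := by
  refine HasGaussianLaw.iIndepFun_of_covariance_eval (κ := fun _ => κ) ?_ fun i j hij k l => ?_
  · have hs := hG.hasGaussianLaw_pi (f := fun q : ι × κ => f q.1 q.2) fun q => hf _ _
    let L : (ι × κ → ℝ) →L[ℝ] (ι → κ → ℝ) := ContinuousLinearMap.pi fun i =>
      ContinuousLinearMap.pi fun k => ContinuousLinearMap.proj (i, k)
    exact hs.map L
  · rw [hG.covariance_eq (hf i k) (hf j l), h i j hij]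

/-- The span of a finite jointly Gaussian centred family. -/
lemma span {κ : Type*} [Fintype κ] {f : κ → Ω → ℝ} (hf : HasGaussianLaw (fun ω k => f k ω) P)
    (h0 : ∀ k, ∫ ω, f k ω ∂P = 0) :
    IsCenteredGaussianSpace (Submodule.span ℝ (Set.range f)) P := by
  intro g hg
  obtain ⟨c, rfl⟩ := (Submodule.mem_span_range_iff_exists_fun ℝ).1 hg
  constructor
  · let L : (κ → ℝ) →L[ℝ] ℝ := ∑ k, c k • ContinuousLinearMap.proj k
    have e : ∑ k, c k • f k = L ∘ fun ω k => f k ω := by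
      ext ω
      simp [L]
    rw [e]
    exact hf.map L
  · have hi : ∀ k, Integrable (f k) P := fun k => (hf.eval k).integrable
    simp only [Finset.sum_apply, Pi.smul_apply, smul_eq_mul]
    rw [integral_finsetSum _ fun k _ => (hi k).const_mul _]
    simp [integral_const_mul, h0]

end IsCenteredGaussianSpace

end BandTest

/-! ### Exact second moments of the forms at linear combinations of observations. -/

namespace BandTest

/-- The linear combination `∑ αᵢ uᵢ` of the rows of an array. -/
def rowComb {N : ℕ} {ι : Type*} (α : Fin N → ℝ) (u : Fin N → ι → ℝ) (j : ι) : ℝ :=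
  ∑ i, α i * u i j

lemma rowComb_single {N : ℕ} {ι : Type*} (i : Fin N) (u : Fin N → ι → ℝ) :
    rowComb (Pi.single i 1) u = u i := by
  ext j
  simp [rowComb, Pi.single_apply]

lemma continuous_rowComb {N : ℕ} {ι : Type*} (α : Fin N → ℝ) (j : ι) :
    Continuous fun u : Fin N → ι → ℝ => rowComb α u j := by
  unfold rowComb
  fun_prop

/-- Two independent samples of size `N` of independent centred Gaussian vectors with covariance
matrix `S`, as elements of a Gaussian space `G`. -/
structure IsGaussianSamplePair {Ω : Type*} [MeasurableSpace Ω] {N : ℕ} {ι : Type*} [Fintype ι]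
    [DecidableEq ι] (G : Submodule ℝ (Ω → ℝ)) (S : Matrix ι ι ℝ) (X Y : Ω → Fin N → ι → ℝ)
    (P : Measure Ω) : Prop where
  space : IsCenteredGaussianSpace G P
  posSemidef : S.PosSemidef
  mem_fst : ∀ i j, (fun ω => X ω i j) ∈ G
  mem_snd : ∀ i j, (fun ω => Y ω i j) ∈ G
  cov_fst : ∀ i i' j k, ∫ ω, X ω i j * X ω i' k ∂P = if i = i' then S j k else 0
  cov_snd : ∀ i i' j k, ∫ ω, Y ω i j * Y ω i' k ∂P = if i = i' then S j k else 0
  cov_cross : ∀ i i' j k, ∫ ω, X ω i j * Y ω i' k ∂P = 0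
  law_fst : ∀ i, HasLaw (fun ω => WithLp.toLp 2 (X ω i)) (multivariateGaussian 0 S) P
  law_snd : ∀ i, HasLaw (fun ω => WithLp.toLp 2 (Y ω i)) (multivariateGaussian 0 S) P

/-- The covariance of `x_j x_k` and `x_l x_m` for Gaussian `x` with covariance matrix `S`. -/
def wick {ι : Type*} (S : Matrix ι ι ℝ) (q r : ι × ι) : ℝ :=
  S q.1 r.1 * S q.2 r.2 + S q.1 r.2 * S q.2 r.1

section

variable {ι : Type*} [Fintype ι]

/-- The variance of `∑ A_{jk} x_j x_k`. -/
def quadVar (S A : Matrix ι ι ℝ) : ℝ :=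
  ∑ q : ι × ι, ∑ r : ι × ι, A q.1 q.2 * A r.1 r.2 * wick S q r

/-- The variance of `∑ A_{jk} x_j x_k y_j y_k`. -/
def crossVar (S A : Matrix ι ι ℝ) : ℝ :=
  ∑ q : ι × ι, ∑ r : ι × ι, A q.1 q.2 * A r.1 r.2 * wick S q r ^ 2

lemma quadForm_eq_sum_prod (A : Matrix ι ι ℝ) (x : ι → ℝ) :
    quadForm A x = ∑ q : ι × ι, A q.1 q.2 * (x q.1 * x q.2) :=
  (Fintype.sum_prod_type' fun j k => A j k * (x j * x k)).symm

lemma crossForm_eq_sum_prod (A : Matrix ι ι ℝ) (x y : ι → ℝ) :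
    crossForm A x y = ∑ q : ι × ι, A q.1 q.2 * (x q.1 * x q.2 * (y q.1 * y q.2)) :=
  (Fintype.sum_prod_type' fun j k => A j k * (x j * x k * (y j * y k))).symm

end

namespace IsGaussianSamplePair

variable {Ω : Type*} [MeasurableSpace Ω] {P : Measure Ω} {N : ℕ} {ι : Type*} [Fintype ι]
  [DecidableEq ι] {G : Submodule ℝ (Ω → ℝ)} {S : Matrix ι ι ℝ} {X Y : Ω → Fin N → ι → ℝ}

lemma symm (h : IsGaussianSamplePair G S X Y P) : IsGaussianSamplePair G S Y X P where
  space := h.space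
  posSemidef := h.posSemidef
  mem_fst := h.mem_snd
  mem_snd := h.mem_fst
  cov_fst := h.cov_snd
  cov_snd := h.cov_fst
  cov_cross i i' j k := by
    rw [← h.cov_cross i' i k j]
    exact integral_congr_ae (Eventually.of_forall fun ω => mul_comm _ _)
  law_fst := h.law_snd
  law_snd := h.law_fst

lemma isProbabilityMeasure (h : IsGaussianSamplePair G S X Y P) : IsProbabilityMeasure P :=
  (h.space 0 G.zero_mem).1.isProbabilityMeasure

lemma rowComb_mem (h : IsGaussianSamplePair G S X Y P) (α : Fin N → ℝ) (j : ι) :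
    (fun ω => rowComb α (X ω) j) ∈ G := by
  have : (fun ω => rowComb α (X ω) j) = ∑ i, α i • fun ω => X ω i j := by
    ext ω; simp [rowComb]
  rw [this]
  exact G.sum_mem fun i _ => G.smul_mem _ (h.mem_fst i j)

lemma hasMoments_rowComb (h : IsGaussianSamplePair G S X Y P) (α : Fin N → ℝ) (j : ι) :
    HasMoments (fun ω => rowComb α (X ω) j) P :=
  h.space.hasMoments (h.rowComb_mem α j)

lemma integral_rowComb_mul (h : IsGaussianSamplePair G S X Y P) (α β : Fin N → ℝ) (j k : ι) :
    ∫ ω, rowComb α (X ω) j * rowComb β (X ω) k ∂P = (α ⬝ᵥ β) * S j k := by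
  have hi : ∀ i i', Integrable (fun ω => α i * β i' * (X ω i j * X ω i' k)) P := fun i i' =>
    (((h.space.hasMoments (h.mem_fst i j)).mul
      (h.space.hasMoments (h.mem_fst i' k))).const_mul _).integrable
  have e : ∀ ω, rowComb α (X ω) j * rowComb β (X ω) k =
      ∑ i, ∑ i', α i * β i' * (X ω i j * X ω i' k) := fun ω => by
    rw [rowComb, rowComb, Finset.sum_mul_sum]
    exact Finset.sum_congr rfl fun i _ => Finset.sum_congr rfl fun i' _ => by ring
  simp only [e]
  rw [integral_finsetSum _ fun i _ => integrable_finsetSum _ fun i' _ => hi i i', dotProduct,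
    Finset.sum_mul]
  refine Finset.sum_congr rfl fun i _ => ?_
  rw [integral_finsetSum _ fun i' _ => hi i i']
  simp [integral_const_mul, h.cov_fst]

/-- The first summand is the pairing within each index pair, the product of the means; it disappears
once multiplied by a matrix with A_jk S_jk = 0. The pairings across carry the factor (α·β)². -/
lemma integral_rowComb_mul_four (h : IsGaussianSamplePair G S X Y P) (α β : Fin N → ℝ)
    (q r : ι × ι) :
    ∫ ω, rowComb α (X ω) q.1 * rowComb α (X ω) q.2 *
        (rowComb β (X ω) r.1 * rowComb β (X ω) r.2) ∂P =
      (α ⬝ᵥ α) * S q.1 q.2 * ((β ⬝ᵥ β) * S r.1 r.2) + (α ⬝ᵥ β) ^ 2 * wick S q r := by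
  rw [h.space.integral_mul_four (h.rowComb_mem α _) (h.rowComb_mem α _) (h.rowComb_mem β _)
    (h.rowComb_mem β _)]
  simp only [h.integral_rowComb_mul]
  unfold wick
  ring

lemma indepFun (h : IsGaussianSamplePair G S X Y P) : IndepFun X Y P := by
  have := h.space.indepFun (f := fun (q : Fin N × ι) ω => X ω q.1 q.2)
    (g := fun (q : Fin N × ι) ω => Y ω q.1 q.2) (fun q => h.mem_fst _ _) (fun q => h.mem_snd _ _)
    fun q r => h.cov_cross _ _ _ _
  exact this.comp (φ := fun u i j => u (i, j)) (ψ := fun u i j => u (i, j)) (by fun_prop)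
    (by fun_prop)

lemma aemeasurable (h : IsGaussianSamplePair G S X Y P) : AEMeasurable X P :=
  aemeasurable_pi_lambda _ fun i => aemeasurable_pi_lambda _ fun j =>
    (h.space.hasMoments (h.mem_fst i j)).aemeasurable

lemma integral_mul (h : IsGaussianSamplePair G S X Y P) {f g : (Fin N → ι → ℝ) → ℝ}
    (hf : Continuous f) (hg : Continuous g) :
    ∫ ω, f (X ω) * g (Y ω) ∂P = (∫ ω, f (X ω) ∂P) * ∫ ω, g (Y ω) ∂P :=
  h.indepFun.integral_fun_comp_mul_comp h.aemeasurable h.symm.aemeasurable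
    hf.aestronglyMeasurable hg.aestronglyMeasurable

variable {A : Matrix ι ι ℝ}

lemma hasMoments_quadForm (h : IsGaussianSamplePair G S X Y P) (A : Matrix ι ι ℝ)
    (α : Fin N → ℝ) : HasMoments (fun ω => quadForm A (rowComb α (X ω))) P :=
  BandTest.hasMoments_quadForm (h.hasMoments_rowComb α)

lemma hasMoments_crossForm (h : IsGaussianSamplePair G S X Y P) (A : Matrix ι ι ℝ)
    (α : Fin N → ℝ) :
    HasMoments (fun ω => crossForm A (rowComb α (X ω)) (rowComb α (Y ω))) P :=
  BandTest.hasMoments_crossForm (h.hasMoments_rowComb α) (h.symm.hasMoments_rowComb α)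

lemma integral_quadForm (h : IsGaussianSamplePair G S X Y P) (hA : ∀ j k, A j k * S j k = 0)
    (α : Fin N → ℝ) : ∫ ω, quadForm A (rowComb α (X ω)) ∂P = 0 := by
  have hP := h.isProbabilityMeasure
  simp only [quadForm_eq_sum_prod]
  rw [integral_finsetSum _ fun q _ => (((h.hasMoments_rowComb α q.1).mul
    (h.hasMoments_rowComb α q.2)).const_mul _).integrable]
  refine Finset.sum_eq_zero fun q _ => ?_
  rw [integral_const_mul, h.integral_rowComb_mul, mul_left_comm, hA, mul_zero]

/-- Of the three Wick pairings only those linking q to r survive, so the dependence on the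
coefficients is through α·β alone. This exact formula is what makes the effect of centring
computable. -/
lemma integral_quadForm_mul (h : IsGaussianSamplePair G S X Y P)
    (hA : ∀ j k, A j k * S j k = 0) (α β : Fin N → ℝ) :
    ∫ ω, quadForm A (rowComb α (X ω)) * quadForm A (rowComb β (X ω)) ∂P =
      (α ⬝ᵥ β) ^ 2 * quadVar S A := by
  have hm := h.hasMoments_rowComb
  have hi : ∀ q r : ι × ι, Integrable (fun ω => A q.1 q.2 * A r.1 r.2 *
      (rowComb α (X ω) q.1 * rowComb α (X ω) q.2 *
        (rowComb β (X ω) r.1 * rowComb β (X ω) r.2))) P := fun q r =>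
    ((((hm α _).mul (hm α _)).mul ((hm β _).mul (hm β _))).const_mul _).integrable
  have e : ∀ ω, quadForm A (rowComb α (X ω)) * quadForm A (rowComb β (X ω)) =
      ∑ q : ι × ι, ∑ r : ι × ι, A q.1 q.2 * A r.1 r.2 *
        (rowComb α (X ω) q.1 * rowComb α (X ω) q.2 *
          (rowComb β (X ω) r.1 * rowComb β (X ω) r.2)) := fun ω => by
    rw [quadForm_eq_sum_prod, quadForm_eq_sum_prod, Finset.sum_mul_sum]
    exact Finset.sum_congr rfl fun q _ => Finset.sum_congr rfl fun r _ => by ring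
  simp only [e]
  rw [integral_finsetSum _ fun q _ => integrable_finsetSum _ fun r _ => hi q r, quadVar,
    Finset.mul_sum]
  refine Finset.sum_congr rfl fun q _ => ?_
  rw [integral_finsetSum _ fun r _ => hi q r, Finset.mul_sum]
  refine Finset.sum_congr rfl fun r _ => ?_
  rw [integral_const_mul, h.integral_rowComb_mul_four]
  linear_combination (α ⬝ᵥ α) * ((β ⬝ᵥ β) * S r.1 r.2) * A r.1 r.2 * hA q.1 q.2

/-- Independence of the halves multiplies two Wick expansions. Every term with a factor S_q is
killed by A_q, and the square of the remaining one gives the exponent 4. -/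
lemma integral_crossForm_mul (h : IsGaussianSamplePair G S X Y P)
    (hA : ∀ j k, A j k * S j k = 0) (α β : Fin N → ℝ) :
    ∫ ω, crossForm A (rowComb α (X ω)) (rowComb α (Y ω)) *
        crossForm A (rowComb β (X ω)) (rowComb β (Y ω)) ∂P =
      (α ⬝ᵥ β) ^ 4 * crossVar S A := by
  have hm := h.hasMoments_rowComb
  have hn := h.symm.hasMoments_rowComb
  have hi : ∀ q r : ι × ι, Integrable (fun ω => A q.1 q.2 * A r.1 r.2 *
      ((rowComb α (X ω) q.1 * rowComb α (X ω) q.2 *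
        (rowComb β (X ω) r.1 * rowComb β (X ω) r.2)) *
      (rowComb α (Y ω) q.1 * rowComb α (Y ω) q.2 *
        (rowComb β (Y ω) r.1 * rowComb β (Y ω) r.2)))) P := fun q r =>
    (((((hm α _).mul (hm α _)).mul ((hm β _).mul (hm β _))).mul
      (((hn α _).mul (hn α _)).mul ((hn β _).mul (hn β _)))).const_mul _).integrable
  have e : ∀ ω, crossForm A (rowComb α (X ω)) (rowComb α (Y ω)) *
        crossForm A (rowComb β (X ω)) (rowComb β (Y ω)) =
      ∑ q : ι × ι, ∑ r : ι × ι, A q.1 q.2 * A r.1 r.2 *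
        ((rowComb α (X ω) q.1 * rowComb α (X ω) q.2 *
          (rowComb β (X ω) r.1 * rowComb β (X ω) r.2)) *
        (rowComb α (Y ω) q.1 * rowComb α (Y ω) q.2 *
          (rowComb β (Y ω) r.1 * rowComb β (Y ω) r.2))) := fun ω => by
    rw [crossForm_eq_sum_prod, crossForm_eq_sum_prod, Finset.sum_mul_sum]
    exact Finset.sum_congr rfl fun q _ => Finset.sum_congr rfl fun r _ => by ring
  simp only [e]
  rw [integral_finsetSum _ fun q _ => integrable_finsetSum _ fun r _ => hi q r, crossVar,
    Finset.mul_sum]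
  refine Finset.sum_congr rfl fun q _ => ?_
  rw [integral_finsetSum _ fun r _ => hi q r, Finset.mul_sum]
  refine Finset.sum_congr rfl fun r _ => ?_
  have hc : Continuous fun u : Fin N → ι → ℝ => rowComb α u q.1 * rowComb α u q.2 *
      (rowComb β u r.1 * rowComb β u r.2) :=
    ((continuous_rowComb α _).mul (continuous_rowComb α _)).mul
      ((continuous_rowComb β _).mul (continuous_rowComb β _))
  rw [integral_const_mul, h.integral_mul hc hc, h.integral_rowComb_mul_four,
    h.symm.integral_rowComb_mul_four]
  linear_combination (((α ⬝ᵥ α) * ((β ⬝ᵥ β) * S r.1 r.2)) ^ 2 * S q.1 q.2 +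
    2 * (α ⬝ᵥ α) * ((β ⬝ᵥ β) * S r.1 r.2) * (α ⬝ᵥ β) ^ 2 * wick S q r) * A r.1 r.2 * hA q.1 q.2

/-- The second half enters only through the pair q, whose mean product is a multiple of S_q, and A_q
S_q = 0. Nothing is needed of B. -/
lemma integral_crossForm_mul_quadForm (h : IsGaussianSamplePair G S X Y P)
    (hA : ∀ j k, A j k * S j k = 0) (B : Matrix ι ι ℝ) (α β : Fin N → ℝ) :
    ∫ ω, crossForm A (rowComb α (X ω)) (rowComb α (Y ω)) * quadForm B (rowComb β (X ω)) ∂P = 0 := by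
  have hm := h.hasMoments_rowComb
  have hn := h.symm.hasMoments_rowComb
  have hi : ∀ q r : ι × ι, Integrable (fun ω => A q.1 q.2 * B r.1 r.2 *
      ((rowComb α (X ω) q.1 * rowComb α (X ω) q.2 *
        (rowComb β (X ω) r.1 * rowComb β (X ω) r.2)) *
      (rowComb α (Y ω) q.1 * rowComb α (Y ω) q.2))) P := fun q r =>
    (((((hm α _).mul (hm α _)).mul ((hm β _).mul (hm β _))).mul
      ((hn α _).mul (hn α _))).const_mul _).integrable
  have e : ∀ ω, crossForm A (rowComb α (X ω)) (rowComb α (Y ω)) * quadForm B (rowComb β (X ω)) =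
      ∑ q : ι × ι, ∑ r : ι × ι, A q.1 q.2 * B r.1 r.2 *
        ((rowComb α (X ω) q.1 * rowComb α (X ω) q.2 *
          (rowComb β (X ω) r.1 * rowComb β (X ω) r.2)) *
        (rowComb α (Y ω) q.1 * rowComb α (Y ω) q.2)) := fun ω => by
    rw [crossForm_eq_sum_prod, quadForm_eq_sum_prod, Finset.sum_mul_sum]
    exact Finset.sum_congr rfl fun q _ => Finset.sum_congr rfl fun r _ => by ring
  simp only [e]
  rw [integral_finsetSum _ fun q _ => integrable_finsetSum _ fun r _ => hi q r]
  refine Finset.sum_eq_zero fun q _ => ?_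
  rw [integral_finsetSum _ fun r _ => hi q r]
  refine Finset.sum_eq_zero fun r _ => ?_
  have hc : Continuous fun u : Fin N → ι → ℝ => rowComb α u q.1 * rowComb α u q.2 *
      (rowComb β u r.1 * rowComb β u r.2) :=
    ((continuous_rowComb α _).mul (continuous_rowComb α _)).mul
      ((continuous_rowComb β _).mul (continuous_rowComb β _))
  have hd : Continuous fun u : Fin N → ι → ℝ => rowComb α u q.1 * rowComb α u q.2 :=
    (continuous_rowComb α _).mul (continuous_rowComb α _)
  rw [integral_const_mul, h.integral_mul hc hd, h.symm.integral_rowComb_mul]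
  linear_combination (∫ ω, rowComb α (X ω) q.1 * rowComb α (X ω) q.2 *
      (rowComb β (X ω) r.1 * rowComb β (X ω) r.2) ∂P) * B r.1 r.2 * (α ⬝ᵥ α) * hA q.1 q.2

lemma integral_crossForm (h : IsGaussianSamplePair G S X Y P)
    (hA : ∀ j k, A j k * S j k = 0) (α : Fin N → ℝ) :
    ∫ ω, crossForm A (rowComb α (X ω)) (rowComb α (Y ω)) ∂P = 0 := by
  simp only [crossForm_eq_sum_prod]
  rw [integral_finsetSum _ fun q _ => ((((h.hasMoments_rowComb α q.1).mul
    (h.hasMoments_rowComb α q.2)).mul ((h.symm.hasMoments_rowComb α q.1).mul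
    (h.symm.hasMoments_rowComb α q.2))).const_mul _).integrable]
  refine Finset.sum_eq_zero fun q _ => ?_
  have hd : Continuous fun u : Fin N → ι → ℝ => rowComb α u q.1 * rowComb α u q.2 :=
    (continuous_rowComb α _).mul (continuous_rowComb α _)
  rw [integral_const_mul, h.integral_mul hd hd, h.integral_rowComb_mul]
  linear_combination ((α ⬝ᵥ α) * ∫ ω, rowComb α (Y ω) q.1 * rowComb α (Y ω) q.2 ∂P) * hA q.1 q.2

end IsGaussianSamplePair

end BandTest

/-! ### The normalized statistics as a standardized sample. -/

namespace BandTest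

lemma continuous_quadForm_rowComb {N : ℕ} {ι : Type*} [Fintype ι] (B : Matrix ι ι ℝ)
    (α : Fin N → ℝ) : Continuous fun u : Fin N → ι → ℝ => quadForm B (rowComb α u) := by
  have := continuous_rowComb (ι := ι) α
  unfold quadForm
  fun_prop

namespace IsGaussianSamplePair

variable {Ω : Type*} [MeasurableSpace Ω] {P : Measure Ω} {N : ℕ} {ι : Type*} [Fintype ι]
  [DecidableEq ι] {G : Submodule ℝ (Ω → ℝ)} {S : Matrix ι ι ℝ} {X Y : Ω → Fin N → ι → ℝ}
  {A B : Matrix ι ι ℝ}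

lemma hasMoments_quadForm_add (h : IsGaussianSamplePair G S X Y P) (B : Matrix ι ι ℝ)
    (α : Fin N → ℝ) :
    HasMoments (fun ω => quadForm B (rowComb α (X ω)) + quadForm B (rowComb α (Y ω))) P :=
  (h.hasMoments_quadForm B α).add (h.symm.hasMoments_quadForm B α)

lemma integral_quadForm_add (h : IsGaussianSamplePair G S X Y P) (hB : ∀ j k, B j k * S j k = 0)
    (α : Fin N → ℝ) :
    ∫ ω, (quadForm B (rowComb α (X ω)) + quadForm B (rowComb α (Y ω))) ∂P = 0 := by
  rw [integral_add (h.hasMoments_quadForm B α).integrable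
    (h.symm.hasMoments_quadForm B α).integrable, h.integral_quadForm hB,
    h.symm.integral_quadForm hB, add_zero]

lemma integral_quadForm_add_mul (h : IsGaussianSamplePair G S X Y P)
    (hB : ∀ j k, B j k * S j k = 0) (α β : Fin N → ℝ) :
    ∫ ω, (quadForm B (rowComb α (X ω)) + quadForm B (rowComb α (Y ω))) *
        (quadForm B (rowComb β (X ω)) + quadForm B (rowComb β (Y ω))) ∂P =
      (α ⬝ᵥ β) ^ 2 * (2 * quadVar S B) := by
  have hm := h.hasMoments_quadForm B
  have hn := h.symm.hasMoments_quadForm B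
  have hc := continuous_quadForm_rowComb (N := N) B
  have e : ∀ ω, (quadForm B (rowComb α (X ω)) + quadForm B (rowComb α (Y ω))) *
        (quadForm B (rowComb β (X ω)) + quadForm B (rowComb β (Y ω))) =
      (quadForm B (rowComb α (X ω)) * quadForm B (rowComb β (X ω)) +
        quadForm B (rowComb α (Y ω)) * quadForm B (rowComb β (Y ω))) +
      (quadForm B (rowComb α (X ω)) * quadForm B (rowComb β (Y ω)) +
        quadForm B (rowComb β (X ω)) * quadForm B (rowComb α (Y ω))) := fun ω => by ring
  simp only [e]
  rw [integral_add (((hm α).mul (hm β)).add ((hn α).mul (hn β))).integrable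
      (((hm α).mul (hn β)).add ((hm β).mul (hn α))).integrable,
    integral_add ((hm α).mul (hm β)).integrable ((hn α).mul (hn β)).integrable,
    integral_add ((hm α).mul (hn β)).integrable ((hm β).mul (hn α)).integrable,
    h.integral_quadForm_mul hB, h.symm.integral_quadForm_mul hB, h.integral_mul (hc α) (hc β),
    h.integral_mul (hc β) (hc α), h.integral_quadForm hB, h.integral_quadForm hB]
  ring

/-- The part of the quadratic form in the second half reduces to the first by exchanging the two
halves, under which the cross form is symmetric. -/
lemma integral_crossForm_mul_quadForm_add (h : IsGaussianSamplePair G S X Y P)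
    (hA : ∀ j k, A j k * S j k = 0) (B : Matrix ι ι ℝ) (α β : Fin N → ℝ) :
    ∫ ω, crossForm A (rowComb α (X ω)) (rowComb α (Y ω)) *
      (quadForm B (rowComb β (X ω)) + quadForm B (rowComb β (Y ω))) ∂P = 0 := by
  simp only [mul_add]
  rw [integral_add ((h.hasMoments_crossForm A α).mul (h.hasMoments_quadForm B β)).integrable
    ((h.hasMoments_crossForm A α).mul (h.symm.hasMoments_quadForm B β)).integrable,
    h.integral_crossForm_mul_quadForm hA]
  have := h.symm.integral_crossForm_mul_quadForm hA B α β
  simp only [fun ω => crossForm_comm (D := A) (rowComb α (Y ω)) (rowComb α (X ω))] at this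
  rw [this, add_zero]

lemma indepFun_apply (h : IsGaussianSamplePair G S X Y P) (i : Fin N) :
    IndepFun (fun ω => X ω i) (fun ω => Y ω i) P :=
  h.indepFun.comp (φ := fun u : Fin N → ι → ℝ => u i) (ψ := fun u : Fin N → ι → ℝ => u i)
    (measurable_pi_apply i) (measurable_pi_apply i)

lemma fourth_moment_crossForm_le (h : IsGaussianSamplePair G S X Y P) (hAh : A.IsHermitian)
    (hA : ∀ j k, A j k * S j k = 0) (i : Fin N) :
    ∫ ω, crossForm A (X ω i) (Y ω i) ^ 4 ∂P ≤ chaosConst ^ 2 * crossVar S A ^ 2 := by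
  have hP := h.isProbabilityMeasure
  have hlaw : HasLaw (fun ω => (WithLp.toLp 2 (X ω i), WithLp.toLp 2 (Y ω i)))
      ((multivariateGaussian 0 S).prod (multivariateGaussian 0 S)) P := by
    refine ⟨(h.law_fst i).aemeasurable.prodMk (h.law_snd i).aemeasurable, ?_⟩
    rw [(indepFun_iff_map_prod_eq_prod_map_map (h.law_fst i).aemeasurable
      (h.law_snd i).aemeasurable).1, (h.law_fst i).map_eq, (h.law_snd i).map_eq]
    exact (h.indepFun_apply i).comp (φ := WithLp.toLp 2) (ψ := WithLp.toLp 2)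
      (by fun_prop) (by fun_prop)
  have hc : Continuous fun q : EuclideanSpace ℝ ι × EuclideanSpace ℝ ι =>
      crossForm A q.1 q.2 := by
    unfold crossForm; fun_prop
  have e : ∀ k : ℕ, ∫ q, crossForm A q.1 q.2 ^ k
      ∂((multivariateGaussian 0 S).prod (multivariateGaussian 0 S)) =
      ∫ ω, crossForm A (X ω i) (Y ω i) ^ k ∂P := fun k =>
    (hlaw.integral_comp (f := fun q => crossForm A q.1 q.2 ^ k)
      (hc.pow k).aestronglyMeasurable).symm
  have := BandTest.fourth_moment_crossForm_le h.posSemidef hAh hA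
  rw [e, e] at this
  have h2 := h.integral_crossForm_mul hA (Pi.single i 1) (Pi.single i 1)
  simp only [rowComb_single, ← sq, single_one_dotProduct, Pi.single_eq_same, one_pow,
    one_mul] at h2
  rwa [h2] at this

lemma fourth_moment_quadForm_le (h : IsGaussianSamplePair G S X Y P) (hBh : B.IsHermitian)
    (hB : ∀ j k, B j k * S j k = 0) (i : Fin N) :
    ∫ ω, quadForm B (X ω i) ^ 4 ∂P ≤ chaosConst * (∫ ω, quadForm B (X ω i) ^ 2 ∂P) ^ 2 := by
  have hc : Continuous fun q : EuclideanSpace ℝ ι => quadForm B q := by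
    unfold quadForm; fun_prop
  have e : ∀ k : ℕ, ∫ q, quadForm B q ^ k ∂(multivariateGaussian 0 S) =
      ∫ ω, quadForm B (X ω i) ^ k ∂P := fun k =>
    ((h.law_fst i).integral_comp (f := fun q => quadForm B q ^ k)
      (hc.pow k).aestronglyMeasurable).symm
  have := BandTest.fourth_moment_quadForm_le (S := S) hBh
    (integral_quadForm_eq_zero h.posSemidef hB)
  rwa [e, e] at this

lemma fourth_moment_quadForm_add_le (h : IsGaussianSamplePair G S X Y P) (hBh : B.IsHermitian)
    (hB : ∀ j k, B j k * S j k = 0) (i : Fin N) :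
    ∫ ω, (quadForm B (X ω i) + quadForm B (Y ω i)) ^ 4 ∂P ≤
      chaosConst * (2 * quadVar S B) ^ 2 := by
  have hP := h.isProbabilityMeasure
  have m := h.hasMoments_quadForm B (Pi.single i 1)
  have m' := h.symm.hasMoments_quadForm B (Pi.single i 1)
  have z := h.integral_quadForm hB (Pi.single i 1)
  have z' := h.symm.integral_quadForm hB (Pi.single i 1)
  have h2 := h.integral_quadForm_add_mul hB (Pi.single i 1) (Pi.single i 1)
  simp only [rowComb_single, ← sq, single_one_dotProduct, Pi.single_eq_same, one_pow,
    one_mul] at m m' z z' h2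
  have hc : Continuous fun q : ι → ℝ => quadForm B q := by
    unfold quadForm; fun_prop
  have := fourth_moment_add_le m m' ((h.indepFun_apply i).comp (φ := quadForm B)
    (ψ := quadForm B) hc.measurable hc.measurable) z z' three_le_chaosConst
    (h.fourth_moment_quadForm_le hBh hB i) (h.symm.fourth_moment_quadForm_le hBh hB i)
  rwa [h2] at this

/-- The coordinates of X_i and Y_i are joined in one block; blocks with different indices are
uncorrelated in a Gaussian space, hence independent. -/
lemma iIndepFun (h : IsGaussianSamplePair G S X Y P) :
    iIndepFun (fun i ω => (X ω i, Y ω i)) P := by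
  have := h.space.iIndepFun
    (f := fun (i : Fin N) (q : ι ⊕ ι) ω => Sum.elim (X ω i) (Y ω i) q)
    (by rintro i (j | j); exacts [h.mem_fst i j, h.mem_snd i j])
    (by
      rintro i j hij (k | k) (l | l)
      · simp [h.cov_fst, hij]
      · simp [h.cov_cross]
      · simp [h.symm.cov_cross]
      · simp [h.cov_snd, hij])
  exact this.comp (g := fun _ u => (fun j => u (Sum.inl j), fun j => u (Sum.inr j)))
    fun _ => by fun_prop

/-- The normalized quadratic statistics of the pairs of observations. -/
theorem isStandardSample (h : IsGaussianSamplePair G S X Y P) (hAh : A.IsHermitian)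
    (hA : ∀ j k, A j k * S j k = 0) (hBh : B.IsHermitian) (hB : ∀ j k, B j k * S j k = 0)
    (hA0 : 0 < crossVar S A) (hB0 : 0 < quadVar S B) :
    IsStandardSample (fun i ω => crossForm A (X ω i) (Y ω i) / √(crossVar S A))
      (fun i ω => (quadForm B (X ω i) + quadForm B (Y ω i)) / √(2 * quadVar S B))
      (chaosConst ^ 2) P := by
  have hP := h.isProbabilityMeasure
  have hs : √(crossVar S A) ^ 2 = crossVar S A := Real.sq_sqrt hA0.le
  have ht : √(2 * quadVar S B) ^ 2 = 2 * quadVar S B := Real.sq_sqrt (by positivity)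
  have hcA : Continuous fun q : (ι → ℝ) × (ι → ℝ) => crossForm A q.1 q.2 := by
    unfold crossForm; fun_prop
  have hcB : Continuous fun q : ι → ℝ => quadForm B q := by
    unfold quadForm; fun_prop
  have me := fun i => h.hasMoments_crossForm A (Pi.single i 1)
  have mv := fun i => h.hasMoments_quadForm_add B (Pi.single i 1)
  have ze := fun i => h.integral_crossForm hA (Pi.single i 1)
  have zv := fun i => h.integral_quadForm_add hB (Pi.single i 1)
  have se := fun i => h.integral_crossForm_mul hA (Pi.single i 1) (Pi.single i 1)
  have sv := fun i => h.integral_quadForm_add_mul hB (Pi.single i 1) (Pi.single i 1)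
  have cr := fun i => h.integral_crossForm_mul_quadForm_add hA B (Pi.single i 1) (Pi.single i 1)
  simp only [rowComb_single, single_one_dotProduct, Pi.single_eq_same, one_pow,
    one_mul, ← sq] at me mv ze zv se sv cr
  refine ⟨?_, fun i => ((me i).div_const _).memLp_four, fun i => ((mv i).div_const _).memLp_four,
    fun i => ?_, fun i => ?_, fun i => ?_, fun i => ?_, fun i => ?_, fun i => ?_, fun i => ?_⟩
  · refine h.iIndepFun.comp (g := fun _ q => (crossForm A q.1 q.2 / √(crossVar S A),
      (quadForm B q.1 + quadForm B q.2) / √(2 * quadVar S B))) fun _ => ?_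
    have h1 : Continuous fun q : (ι → ℝ) × (ι → ℝ) => quadForm B q.1 := hcB.comp continuous_fst
    have h2 : Continuous fun q : (ι → ℝ) × (ι → ℝ) => quadForm B q.2 := hcB.comp continuous_snd
    exact ((hcA.div_const _).prodMk ((h1.add h2).div_const _)).measurable
  · rw [integral_div, ze, zero_div]
  · rw [integral_div, zv, zero_div]
  · simp only [div_pow, hs]
    rw [integral_div, se, div_self hA0.ne']
  · simp only [div_pow, ht]
    rw [integral_div, sv, div_self (by positivity)]
  · simp only [div_mul_div_comm]
    rw [integral_div, cr, zero_div]
  · simp only [div_pow, show √(crossVar S A) ^ 4 = (√(crossVar S A) ^ 2) ^ 2 by ring, hs]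
    rw [integral_div, div_le_iff₀ (by positivity)]
    exact h.fourth_moment_crossForm_le hAh hA i
  · simp only [div_pow, show √(2 * quadVar S B) ^ 4 = (√(2 * quadVar S B) ^ 2) ^ 2 by ring, ht]
    rw [integral_div, div_le_iff₀ (by positivity)]
    -- Since `chaosConst` is at least 3, it is at most its square, and one constant serves both
    -- coordinates.
    refine (h.fourth_moment_quadForm_add_le hBh hB i).trans ?_
    have := three_le_chaosConst
    gcongr
    nlinarith

end IsGaussianSamplePair

end BandTest

/-! ### Remainder terms: their effect on the ratio and their expectation. -/

namespace BandTest

/-- The remainder terms that control the empirical likelihood ratio of the pairs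
`(eᵢ + dᵢ, vᵢ + fᵢ)`. -/
noncomputable def remainder {N : ℕ} (e v d f : Fin N → ℝ) : ℝ :=
  ((√N)⁻¹ * ∑ i, d i) ^ 2 + ((√N)⁻¹ * ∑ i, f i) ^ 2 + (N : ℝ)⁻¹ * ∑ i, d i ^ 2 +
    (N : ℝ)⁻¹ * ∑ i, f i ^ 2 + ((N : ℝ)⁻¹ * ∑ i, (e i ^ 2 - 1)) ^ 2 +
    ((N : ℝ)⁻¹ * ∑ i, (v i ^ 2 - 1)) ^ 2 + ((N : ℝ)⁻¹ * ∑ i, e i * v i) ^ 2 +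
    (N : ℝ)⁻¹ ^ 2 * ∑ i, e i ^ 4 + (N : ℝ)⁻¹ ^ 2 * ∑ i, v i ^ 4

lemma remainder_nonneg {N : ℕ} (e v d f : Fin N → ℝ) : 0 ≤ remainder e v d f := by
  have h2 : ∀ g : Fin N → ℝ, 0 ≤ ∑ i, g i ^ 2 := fun g => Finset.sum_nonneg fun i _ => sq_nonneg _
  have h4 : ∀ g : Fin N → ℝ, 0 ≤ ∑ i, g i ^ 4 := fun g => Finset.sum_nonneg fun i _ => by positivity
  have := h2 d
  have := h2 f
  have := h4 e
  have := h4 v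
  unfold remainder
  positivity

lemma abs_sum_mul_le_of_sum_sq_le {N : ℕ} {e d : Fin N → ℝ} {A B : ℝ} (hA : 0 ≤ A) (hB : 0 ≤ B)
    (he : ∑ i, e i ^ 2 ≤ A ^ 2) (hd : ∑ i, d i ^ 2 ≤ B ^ 2) : |∑ i, e i * d i| ≤ A * B := by
  refine abs_le_of_sq_le_sq ?_ (by positivity)
  refine (Finset.sum_mul_sq_le_sq_mul_sq _ e d).trans ?_
  rw [mul_pow]
  exact mul_le_mul he hd (Finset.sum_nonneg fun i _ => sq_nonneg _) (sq_nonneg _)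

/-- The bounds on the individual terms that follow from a bound on the remainder. -/
structure IsNegligible {N : ℕ} (e v d f : Fin N → ℝ) (m η : ℝ) : Prop where
  sum_fst : |m⁻¹ * ∑ i, d i| ≤ η ^ 2
  sum_snd : |m⁻¹ * ∑ i, f i| ≤ η ^ 2
  sq_fst : ∑ i, d i ^ 2 ≤ (η ^ 2 * m) ^ 2
  sq_snd : ∑ i, f i ^ 2 ≤ (η ^ 2 * m) ^ 2
  var_fst : |∑ i, e i ^ 2 - m ^ 2| ≤ η ^ 2 * m ^ 2
  var_snd : |∑ i, v i ^ 2 - m ^ 2| ≤ η ^ 2 * m ^ 2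
  cov : |∑ i, e i * v i| ≤ η ^ 2 * m ^ 2
  max_fst : ∀ i, |e i| ≤ η * m
  max_snd : ∀ i, |v i| ≤ η * m

/-- The level η⁴ gives η² after a square root for the squared terms, and η after a fourth root for
the maxima, which are controlled by |g i|⁴ ≤ ∑ g⁴ ≤ η⁴ N². -/
lemma isNegligible_of_remainder_le {N : ℕ} (hN : 0 < N) {e v d f : Fin N → ℝ} {η : ℝ}
    (hη : 0 < η) (hR : remainder e v d f ≤ η ^ 4) : IsNegligible e v d f (√N) η := by
  have hN0 : (0 : ℝ) < N := by exact_mod_cast hN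
  have hmN : √(N : ℝ) ^ 2 = N := Real.sq_sqrt hN0.le
  have h2 : ∀ g : Fin N → ℝ, 0 ≤ ∑ i, g i ^ 2 := fun g => Finset.sum_nonneg fun i _ => sq_nonneg _
  have h4 : ∀ g : Fin N → ℝ, 0 ≤ ∑ i, g i ^ 4 := fun g => Finset.sum_nonneg fun i _ => by positivity
  have n1 : 0 ≤ (N : ℝ)⁻¹ * ∑ i, d i ^ 2 := mul_nonneg (by positivity) (h2 d)
  have n2 : 0 ≤ (N : ℝ)⁻¹ * ∑ i, f i ^ 2 := mul_nonneg (by positivity) (h2 f)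
  have n3 : 0 ≤ (N : ℝ)⁻¹ ^ 2 * ∑ i, e i ^ 4 := mul_nonneg (by positivity) (h4 e)
  have n4 : 0 ≤ (N : ℝ)⁻¹ ^ 2 * ∑ i, v i ^ 4 := mul_nonneg (by positivity) (h4 v)
  have s1 := sq_nonneg ((√N)⁻¹ * ∑ i, d i)
  have s2 := sq_nonneg ((√N)⁻¹ * ∑ i, f i)
  have s3 := sq_nonneg ((N : ℝ)⁻¹ * ∑ i, (e i ^ 2 - 1))
  have s4 := sq_nonneg ((N : ℝ)⁻¹ * ∑ i, (v i ^ 2 - 1))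
  have s5 := sq_nonneg ((N : ℝ)⁻¹ * ∑ i, e i * v i)
  unfold remainder at hR
  have sqle : ∀ x : ℝ, x ^ 2 ≤ η ^ 4 → |x| ≤ η ^ 2 := fun x hx =>
    abs_le_of_sq_le_sq (by linarith [show (η ^ 2) ^ 2 = η ^ 4 by ring]) (by positivity)
  have mN : ∀ x : ℝ, |(N : ℝ)⁻¹ * x| ≤ η ^ 2 → |x| ≤ η ^ 2 * √N ^ 2 := fun x hx => by
    rwa [abs_mul, abs_of_pos (by positivity), inv_mul_le_iff₀ hN0, mul_comm, ← hmN] at hx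
  have sum : ∀ g : Fin N → ℝ, (N : ℝ)⁻¹ * ∑ i, g i ^ 2 ≤ η ^ 4 →
      ∑ i, g i ^ 2 ≤ (η ^ 2 * √N) ^ 2 := by
    intro g hg
    rw [inv_mul_le_iff₀ hN0] at hg
    rw [mul_pow, hmN]
    linarith
  have var : ∀ g : Fin N → ℝ, ((N : ℝ)⁻¹ * ∑ i, (g i ^ 2 - 1)) ^ 2 ≤ η ^ 4 →
      |∑ i, g i ^ 2 - √N ^ 2| ≤ η ^ 2 * √N ^ 2 := by
    intro g hg
    have := mN _ (sqle _ hg)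
    rw [hmN] at this ⊢
    simpa only [Finset.sum_sub_distrib, Finset.sum_const, Finset.card_univ, Fintype.card_fin,
      nsmul_eq_mul, mul_one] using this
  have four : ∀ g : Fin N → ℝ, (N : ℝ)⁻¹ ^ 2 * ∑ i, g i ^ 4 ≤ η ^ 4 → ∀ i, |g i| ≤ η * √N := by
    intro g hg i
    rw [inv_pow, inv_mul_le_iff₀ (by positivity)] at hg
    have := Finset.single_le_sum (f := fun i => g i ^ 4) (fun i _ => by positivity)
      (Finset.mem_univ i)
    refine le_of_pow_le_pow_left₀ (n := 4) (by norm_num) (by positivity) ?_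
    rw [Even.pow_abs (by decide), mul_pow, show √(N : ℝ) ^ 4 = (√(N : ℝ) ^ 2) ^ 2 by ring, hmN]
    linarith
  exact ⟨sqle _ (by linarith), sqle _ (by linarith), sum d (by linarith), sum f (by linarith),
    var e (by linarith), var v (by linarith), mN _ (sqle _ (by linarith)), four e (by linarith),
    four v (by linarith)⟩

/-- The expansion is applied to the perturbed pairs with δ = 6η. The factor 6 counts error terms,
each at most η² m²: 1 + 4 + 1 for the second moments and 1 + 2 + 2 + 1 for the mixed moment, the
perturbation sums being bounded by Cauchy–Schwarz. The constant C + 1 allows for the shift of the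
standardized sums. -/
lemma exists_neg_two_mul_log_elRatio_of_isNegligible {N : ℕ} {e v d f : Fin N → ℝ} {m C η : ℝ}
    (hm : 0 < m) (hmN : m ^ 2 = N) (hC : 1 ≤ C) (hη : 0 < η) (hη1 : (C + 1) * (6 * η) ≤ 1 / 16)
    (he : |m⁻¹ * ∑ i, e i| ≤ C) (hv : |m⁻¹ * ∑ i, v i| ≤ C) (h : IsNegligible e v d f m η) :
    ∃ r : ℝ, -2 * ENNReal.log (elRatio fun i => (e i + d i, v i + f i)) = (r : EReal) ∧
      |r - ((m⁻¹ * ∑ i, e i + m⁻¹ * ∑ i, d i) ^ 2 + (m⁻¹ * ∑ i, v i + m⁻¹ * ∑ i, f i) ^ 2)| ≤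
        200 * (C + 1) ^ 3 * (6 * η) := by
  have hη2 : η ≤ 1 / 192 := by nlinarith
  have hηs : η ^ 2 ≤ η := by nlinarith
  have hηm : η ^ 2 * m ^ 2 ≤ η * m ^ 2 := by gcongr
  have hηm' : η ^ 2 * m ≤ η * m := by gcongr
  have hq : (η ^ 2 * m) * (η ^ 2 * m) ≤ η ^ 2 * m ^ 2 := by
    have : η ^ 2 * η ^ 2 ≤ η ^ 2 * 1 := by gcongr; linarith
    have := mul_le_mul_of_nonneg_right this (sq_nonneg m)
    linarith
  have ηm0 : 0 ≤ η * m := by positivity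
  have ηm : 0 ≤ η ^ 2 * m := by positivity
  have ηm2 : 0 ≤ η ^ 2 * m ^ 2 := by positivity
  have hη2m : η ^ 2 * m ^ 2 ≤ m ^ 2 := by
    have : η ^ 2 ≤ 1 := by linarith
    exact mul_le_of_le_one_left (sq_nonneg m) this
  have he2 := abs_le.1 h.var_fst
  have hv2 := abs_le.1 h.var_snd
  have he2' : ∑ i, e i ^ 2 ≤ (2 * m) ^ 2 := by linarith [sq_nonneg m]
  have hv2' : ∑ i, v i ^ 2 ≤ (2 * m) ^ 2 := by linarith [sq_nonneg m]
  have two : ∀ g : Fin N → ℝ, ∑ i, g i ^ 2 ≤ (η ^ 2 * m) ^ 2 → ∀ i, |g i| ≤ η * m := by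
    intro g hg i
    have := Finset.single_le_sum (f := fun i => g i ^ 2) (fun i _ => by positivity)
      (Finset.mem_univ i)
    exact (abs_le_of_sq_le_sq (this.trans hg) ηm).trans hηm'
  have hdi := two d h.sq_fst
  have hfi := two f h.sq_snd
  have hed := abs_le.1 (abs_sum_mul_le_of_sum_sq_le (by positivity) ηm he2' h.sq_fst)
  have hvf := abs_le.1 (abs_sum_mul_le_of_sum_sq_le (by positivity) ηm hv2' h.sq_snd)
  have hef := abs_le.1 (abs_sum_mul_le_of_sum_sq_le (by positivity) ηm he2' h.sq_snd)
  have hvd := abs_le.1 (abs_sum_mul_le_of_sum_sq_le (by positivity) ηm hv2' h.sq_fst)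
  have hdf := abs_le.1 (abs_sum_mul_le_of_sum_sq_le ηm ηm h.sq_fst h.sq_snd)
  have hev := abs_le.1 h.cov
  have hd0 : 0 ≤ ∑ i, d i ^ 2 := Finset.sum_nonneg fun i _ => sq_nonneg _
  have hf0 : 0 ≤ ∑ i, f i ^ 2 := Finset.sum_nonneg fun i _ => sq_nonneg _
  have hd2 := h.sq_fst
  have hf2 := h.sq_snd
  have e1 : ∑ i, (e i + d i) ^ 2 = ∑ i, e i ^ 2 + 2 * ∑ i, e i * d i + ∑ i, d i ^ 2 := by
    simp only [Finset.mul_sum, ← Finset.sum_add_distrib]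
    exact Finset.sum_congr rfl fun i _ => by ring
  have e2 : ∑ i, (v i + f i) ^ 2 = ∑ i, v i ^ 2 + 2 * ∑ i, v i * f i + ∑ i, f i ^ 2 := by
    simp only [Finset.mul_sum, ← Finset.sum_add_distrib]
    exact Finset.sum_congr rfl fun i _ => by ring
  have e3 : ∑ i, (e i + d i) * (v i + f i) =
      ∑ i, e i * v i + ∑ i, e i * f i + ∑ i, v i * d i + ∑ i, d i * f i := by
    simp only [← Finset.sum_add_distrib]
    exact Finset.sum_congr rfl fun i _ => by ring
  have mt : ∀ x : ℝ, m * (m⁻¹ * x) = x := fun x => by field_simp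
  refine exists_neg_two_mul_log_elRatio hm hmN (by linarith) (by positivity) hη1
    (by rw [Finset.sum_add_distrib, mul_add, mt, mt])
    (by rw [Finset.sum_add_distrib, mul_add, mt, mt])
    ((abs_add_le _ _).trans ?_) ((abs_add_le _ _).trans ?_)
    (fun i => (abs_add_le _ _).trans ?_) (fun i => (abs_add_le _ _).trans ?_) ?_ ?_ ?_
  · linarith [h.sum_fst]
  · linarith [h.sum_snd]
  · linarith [h.max_fst i, hdi i]
  · linarith [h.max_snd i, hfi i]
  · rw [e1, abs_le]; constructor <;> linarith
  · rw [e2, abs_le]; constructor <;> linarith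
  · rw [e3, abs_le]; constructor <;> linarith

/-- If the remainder terms are small, then `-2 log` of the empirical likelihood ratio is close to
the squared norm of the standardized sum. -/
theorem exists_neg_two_mul_log_elRatio_add {N : ℕ} (hN : 0 < N) {e v d f : Fin N → ℝ} {C η : ℝ}
    (hC : 1 ≤ C) (hη : 0 < η) (hη1 : (C + 1) * (6 * η) ≤ 1 / 16)
    (he : |(√N)⁻¹ * ∑ i, e i| ≤ C) (hv : |(√N)⁻¹ * ∑ i, v i| ≤ C)
    (hR : remainder e v d f ≤ η ^ 4) :
    ∃ r : ℝ, -2 * ENNReal.log (elRatio fun i => (e i + d i, v i + f i)) = (r : EReal) ∧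
      |r - (((√N)⁻¹ * ∑ i, e i) ^ 2 + ((√N)⁻¹ * ∑ i, v i) ^ 2)| ≤ 1300 * (C + 1) ^ 3 * η := by
  have hN0 : (0 : ℝ) < N := by exact_mod_cast hN
  have h := isNegligible_of_remainder_le hN hη hR
  obtain ⟨r, hr, hrb⟩ := exists_neg_two_mul_log_elRatio_of_isNegligible (by positivity)
    (Real.sq_sqrt hN0.le) hC hη hη1 he hv h
  refine ⟨r, hr, ?_⟩
  have hηs : η ^ 2 ≤ η := by nlinarith
  have hη2 : η ≤ 1 := by nlinarith
  have key : ∀ x y : ℝ, |x| ≤ C → |y| ≤ η → |(x + y) ^ 2 - x ^ 2| ≤ (2 * C + 1) * η := by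
    intro x y hx hy
    rw [show (x + y) ^ 2 - x ^ 2 = (2 * x + y) * y by ring, abs_mul]
    refine mul_le_mul ((abs_add_le _ _).trans ?_) hy (abs_nonneg _) (by positivity)
    rw [abs_mul, abs_two]
    linarith
  have k1 := key _ _ he (h.sum_fst.trans hηs)
  have k2 := key _ _ hv (h.sum_snd.trans hηs)
  -- The expansion costs 200 · 6 = 1200; the shift of the two squares costs at most 4 (C + 1) η,
  -- which the remaining 100 absorbs.
  have hC3 : (C + 1) * η ≤ (C + 1) ^ 3 * η := by
    gcongr
    exact le_self_pow₀ (by linarith) (by norm_num)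
  rw [abs_le] at *
  constructor <;> linarith

section

variable {Ω : Type*} [MeasurableSpace Ω] {P : Measure Ω} {N : ℕ}

lemma integral_sq_sum_eq {d : Fin N → Ω → ℝ} (hd : ∀ i, HasMoments (d i) P) :
    ∫ ω, (∑ i, d i ω) ^ 2 ∂P = ∑ i, ∑ j, ∫ ω, d i ω * d j ω ∂P := by
  simp only [sq, Finset.sum_mul_sum]
  rw [integral_finsetSum _ fun i _ => integrable_finsetSum _ fun j _ =>
    ((hd i).mul (hd j)).integrable]
  exact Finset.sum_congr rfl fun i _ =>
    integral_finsetSum _ fun j _ => ((hd i).mul (hd j)).integrable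

lemma one_sub_pow_le (hN : 0 < N) {k : ℕ} : 1 - (1 - (N : ℝ)⁻¹) ^ k ≤ k * (N : ℝ)⁻¹ := by
  have h1 : (N : ℝ)⁻¹ ≤ 1 := inv_le_one_of_one_le₀ (by exact_mod_cast hN)
  have := one_add_mul_le_pow (a := -(N : ℝ)⁻¹) (by linarith) k
  rw [← sub_eq_add_neg] at this
  linarith

/-- The effect of centring on the individual terms. -/
lemma integral_sq_le_of_centring {d : Fin N → Ω → ℝ} {k : ℕ} (i : Fin N)
    (h : ∀ i j, ∫ ω, d i ω * d j ω ∂P =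
      (if i = j then 1 else 0) - ((if i = j then 1 else 0) - (N : ℝ)⁻¹) ^ k) :
    ∫ ω, d i ω ^ 2 ∂P ≤ k * (N : ℝ)⁻¹ := by
  simp only [sq, h]
  simpa using one_sub_pow_le i.pos

/-- The effect of centring on the sum. -/
lemma integral_sq_sum_le_of_centring {d : Fin N → Ω → ℝ} (hd : ∀ i, HasMoments (d i) P) {k : ℕ}
    (hk : Even k) (h : ∀ i j, ∫ ω, d i ω * d j ω ∂P =
      (if i = j then 1 else 0) - ((if i = j then 1 else 0) - (N : ℝ)⁻¹) ^ k) :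
    ∫ ω, (∑ i, d i ω) ^ 2 ∂P ≤ k := by
  rw [integral_sq_sum_eq hd]
  -- Off the diagonal the covariance is -(1/N)^k ≤ 0 because k is even, so only the N diagonal
  -- terms, each at most k/N, contribute.
  calc ∑ i, ∑ j, ∫ ω, d i ω * d j ω ∂P ≤ ∑ i : Fin N, ∑ j, if i = j then k * (N : ℝ)⁻¹ else 0 := by
        refine Finset.sum_le_sum fun i _ => Finset.sum_le_sum fun j _ => ?_
        rw [h]
        split_ifs
        · exact one_sub_pow_le i.pos
        · have := hk.pow_nonneg (0 - (N : ℝ)⁻¹)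
          linarith
    _ ≤ k := by
        rcases N.eq_zero_or_pos with rfl | hN
        · simp
        · have : (0 : ℝ) < N := by exact_mod_cast hN
          simp only [Finset.sum_ite_eq, Finset.mem_univ, if_true, Finset.sum_const,
            Finset.card_univ, Fintype.card_fin, nsmul_eq_mul]
          apply le_of_eq
          field_simp

lemma integral_sq_mean_le [IsProbabilityMeasure P] {g : Fin N → Ω → ℝ} (hg : ∀ i, MemLp (g i) 2 P)
    (hind : iIndepFun g P) (h0 : ∀ i, ∫ ω, g i ω ∂P = 0) {K : ℝ}
    (hK : ∀ i, ∫ ω, g i ω ^ 2 ∂P ≤ K) :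
    ∫ ω, ((N : ℝ)⁻¹ * ∑ i, g i ω) ^ 2 ∂P ≤ K * (N : ℝ)⁻¹ := by
  have hv : Var[∑ i, g i; P] = ∑ i, Var[g i; P] :=
    IndepFun.variance_sum (fun i _ => hg i) fun i _ j _ hij => hind.indepFun hij
  have hv' : ∀ i, Var[g i; P] = ∫ ω, g i ω ^ 2 ∂P := fun i => by
    rw [variance_eq_integral (hg i).aestronglyMeasurable.aemeasurable, h0]; simp
  rw [variance_eq_integral (memLp_finsetSum' _ fun i _ => hg i).aestronglyMeasurable.aemeasurable]
    at hv
  simp only [Finset.sum_apply] at hv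
  rw [integral_finsetSum _ fun i _ => (hg i).integrable (by norm_num),
    Finset.sum_eq_zero fun i _ => h0 i] at hv
  simp only [sub_zero, hv'] at hv
  simp only [mul_pow]
  rw [integral_const_mul, hv]
  rcases N.eq_zero_or_pos with rfl | hN
  · simp
  · have hN0 : (0 : ℝ) < N := by exact_mod_cast hN
    have : ∑ i, ∫ ω, g i ω ^ 2 ∂P ≤ N * K := by
      refine (Finset.sum_le_sum fun i _ => hK i).trans (by simp)
    calc (N : ℝ)⁻¹ ^ 2 * ∑ i, ∫ ω, g i ω ^ 2 ∂P ≤ (N : ℝ)⁻¹ ^ 2 * (N * K) := by gcongr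
      _ = K * (N : ℝ)⁻¹ := by field_simp

lemma IsStandardSample.integral_sq_mul_sq_le {e v : Fin N → Ω → ℝ} {K : ℝ}
    (h : IsStandardSample e v K P) (i : Fin N) : ∫ ω, e i ω ^ 2 * v i ω ^ 2 ∂P ≤ K := by
  have hK : 0 ≤ K := (integral_nonneg fun ω => by positivity).trans (h.fourth_fst i)
  simpa using integral_sq_mul_sq_le_of_fourth_le (h.memLp_fst i) (h.memLp_snd i) hK zero_le_one
    zero_le_one (by simpa using h.fourth_fst i) (by simpa using h.fourth_snd i)

/-- The expectation of the remainder terms is of order `N⁻¹`. -/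
theorem integral_remainder_le [IsProbabilityMeasure P] {e v d f : Fin N → Ω → ℝ} {K : ℝ}
    (h : IsStandardSample e v K P) (he : ∀ i, HasMoments (e i) P) (hv : ∀ i, HasMoments (v i) P)
    (hd : ∀ i, HasMoments (d i) P) (hf : ∀ i, HasMoments (f i) P)
    (hdd : ∀ i j, ∫ ω, d i ω * d j ω ∂P =
      (if i = j then 1 else 0) - ((if i = j then 1 else 0) - (N : ℝ)⁻¹) ^ 4)
    (hff : ∀ i j, ∫ ω, f i ω * f j ω ∂P =
      (if i = j then 1 else 0) - ((if i = j then 1 else 0) - (N : ℝ)⁻¹) ^ 2) :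
    Integrable (fun ω => remainder (e · ω) (v · ω) (d · ω) (f · ω)) P ∧
    ∫ ω, remainder (e · ω) (v · ω) (d · ω) (f · ω) ∂P ≤ (12 + 5 * K) * (N : ℝ)⁻¹ := by
  have m1 := ((HasMoments.sum fun i (_ : i ∈ Finset.univ) => hd i).const_mul (√N)⁻¹).pow 2
  have m2 := ((HasMoments.sum fun i (_ : i ∈ Finset.univ) => hf i).const_mul (√N)⁻¹).pow 2
  have m3 := (HasMoments.sum fun i (_ : i ∈ Finset.univ) => (hd i).pow 2).const_mul (N : ℝ)⁻¹
  have m4 := (HasMoments.sum fun i (_ : i ∈ Finset.univ) => (hf i).pow 2).const_mul (N : ℝ)⁻¹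
  have m5 := ((HasMoments.sum fun i (_ : i ∈ Finset.univ) =>
    ((he i).pow 2).sub (.const 1)).const_mul (N : ℝ)⁻¹).pow 2
  have m6 := ((HasMoments.sum fun i (_ : i ∈ Finset.univ) =>
    ((hv i).pow 2).sub (.const 1)).const_mul (N : ℝ)⁻¹).pow 2
  have m7 := ((HasMoments.sum fun i (_ : i ∈ Finset.univ) =>
    (he i).mul (hv i)).const_mul (N : ℝ)⁻¹).pow 2
  have m8 := (HasMoments.sum fun i (_ : i ∈ Finset.univ) =>
    (he i).pow 4).const_mul ((N : ℝ)⁻¹ ^ 2)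
  have m9 := (HasMoments.sum fun i (_ : i ∈ Finset.univ) =>
    (hv i).pow 4).const_mul ((N : ℝ)⁻¹ ^ 2)
  have hN2 : (√(N : ℝ))⁻¹ ^ 2 = (N : ℝ)⁻¹ := by
    rw [inv_pow, Real.sq_sqrt (Nat.cast_nonneg N)]
  have hNN : ∀ c : ℝ, (N : ℝ)⁻¹ * (N * (c * (N : ℝ)⁻¹)) = c * (N : ℝ)⁻¹ := fun c => by
    rcases N.eq_zero_or_pos with rfl | hN
    · simp
    · have : (N : ℝ) ≠ 0 := by exact_mod_cast hN.ne'
      field_simp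
  have hNN' : ∀ c : ℝ, (N : ℝ)⁻¹ ^ 2 * (N * c) = c * (N : ℝ)⁻¹ := fun c => by
    rcases N.eq_zero_or_pos with rfl | hN
    · simp
    · have : (N : ℝ) ≠ 0 := by exact_mod_cast hN.ne'
      field_simp
  have b1 : ∫ ω, ((√N)⁻¹ * ∑ i, d i ω) ^ 2 ∂P ≤ 4 * (N : ℝ)⁻¹ := by
    simp only [mul_pow, hN2]
    rw [integral_const_mul, mul_comm]
    gcongr
    exact_mod_cast integral_sq_sum_le_of_centring hd (by decide) hdd
  have b2 : ∫ ω, ((√N)⁻¹ * ∑ i, f i ω) ^ 2 ∂P ≤ 2 * (N : ℝ)⁻¹ := by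
    simp only [mul_pow, hN2]
    rw [integral_const_mul, mul_comm]
    gcongr
    exact_mod_cast integral_sq_sum_le_of_centring hf (by decide) hff
  have b3 : ∫ ω, (N : ℝ)⁻¹ * ∑ i, d i ω ^ 2 ∂P ≤ 4 * (N : ℝ)⁻¹ := by
    rw [integral_const_mul, integral_finsetSum _ fun i _ => ((hd i).pow 2).integrable, ← hNN 4]
    gcongr
    refine (Finset.sum_le_sum fun i _ => integral_sq_le_of_centring i hdd).trans (by simp)
  have b4 : ∫ ω, (N : ℝ)⁻¹ * ∑ i, f i ω ^ 2 ∂P ≤ 2 * (N : ℝ)⁻¹ := by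
    rw [integral_const_mul, integral_finsetSum _ fun i _ => ((hf i).pow 2).integrable, ← hNN 2]
    gcongr
    refine (Finset.sum_le_sum fun i _ => integral_sq_le_of_centring i hff).trans (by simp)
  have sqvar : ∀ {g : Fin N → Ω → ℝ}, (∀ i, HasMoments (g i) P) → (∀ i, ∫ ω, g i ω ^ 2 ∂P = 1) →
      (∀ i, ∫ ω, g i ω ^ 4 ∂P ≤ K) → ∀ i, ∫ ω, (g i ω ^ 2 - 1) ^ 2 ∂P ≤ K := by
    intro g hg h2 h4 i
    have : ∀ ω, (g i ω ^ 2 - 1) ^ 2 = g i ω ^ 4 - 2 * g i ω ^ 2 + 1 := fun ω => by ring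
    simp only [this]
    rw [integral_add (((hg i).pow 4).sub (((hg i).pow 2).const_mul 2)).integrable
      (integrable_const _), integral_sub ((hg i).pow 4).integrable
      (((hg i).pow 2).const_mul 2).integrable, integral_const_mul, h2]
    have := h4 i
    simp only [integral_const, probReal_univ, smul_eq_mul]
    linarith
  have sq0 : ∀ {g : Fin N → Ω → ℝ}, (∀ i, HasMoments (g i) P) → (∀ i, ∫ ω, g i ω ^ 2 ∂P = 1) →
      ∀ i, ∫ ω, (g i ω ^ 2 - 1) ∂P = 0 := by
    intro g hg h2 i
    rw [integral_sub ((hg i).pow 2).integrable (integrable_const _), h2]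
    simp
  have b5 := integral_sq_mean_le (fun i => (((he i).pow 2).sub (.const 1)).memLp_two)
    (h.indep.comp (g := fun _ q => q.1 ^ 2 - 1) fun _ => by fun_prop) (sq0 he h.sq_fst)
    (sqvar he h.sq_fst h.fourth_fst)
  have b6 := integral_sq_mean_le (fun i => (((hv i).pow 2).sub (.const 1)).memLp_two)
    (h.indep.comp (g := fun _ q => q.2 ^ 2 - 1) fun _ => by fun_prop) (sq0 hv h.sq_snd)
    (sqvar hv h.sq_snd h.fourth_snd)
  have b7 := integral_sq_mean_le (fun i => ((he i).mul (hv i)).memLp_two)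
    (h.indep.comp (g := fun _ q => q.1 * q.2) fun _ => by fun_prop) h.cross
    (fun i => by simpa only [mul_pow] using h.integral_sq_mul_sq_le i)
  have b8 : ∫ ω, (N : ℝ)⁻¹ ^ 2 * ∑ i, e i ω ^ 4 ∂P ≤ K * (N : ℝ)⁻¹ := by
    rw [integral_const_mul, integral_finsetSum _ fun i _ => ((he i).pow 4).integrable, ← hNN' K]
    gcongr
    refine (Finset.sum_le_sum fun i _ => h.fourth_fst i).trans (by simp)
  have b9 : ∫ ω, (N : ℝ)⁻¹ ^ 2 * ∑ i, v i ω ^ 4 ∂P ≤ K * (N : ℝ)⁻¹ := by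
    rw [integral_const_mul, integral_finsetSum _ fun i _ => ((hv i).pow 4).integrable, ← hNN' K]
    gcongr
    refine (Finset.sum_le_sum fun i _ => h.fourth_snd i).trans (by simp)
  have m12 := m1.add m2
  have m13 := m12.add m3
  have m14 := m13.add m4
  have m15 := m14.add m5
  have m16 := m15.add m6
  have m17 := m16.add m7
  have m18 := m17.add m8
  refine ⟨(m18.add m9).integrable, ?_⟩
  unfold remainder
  rw [integral_add m18.integrable m9.integrable, integral_add m17.integrable m8.integrable,
    integral_add m16.integrable m7.integrable, integral_add m15.integrable m6.integrable,
    integral_add m14.integrable m5.integrable, integral_add m13.integrable m4.integrable,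
    integral_add m12.integrable m3.integrable, integral_add m1.integrable m2.integrable]
  -- The four centring terms contribute 4 + 2 + 4 + 2 = 12, and each of the other five contributes
  -- K.
  exact (add_le_add (add_le_add (add_le_add (add_le_add (add_le_add (add_le_add (add_le_add
    (add_le_add b1 b2) b3) b4) b5) b6) b7) b8) b9).trans (by linarith)

end

end BandTest

/-! ### The effect of centring, and convergence of the ratio for perturbed arrays. -/

namespace BandTest

/-- The coefficients of the `i`th observation centred at the sample mean. -/
noncomputable def centringCoeff {N : ℕ} (i : Fin N) : Fin N → ℝ :=
  Pi.single i 1 - fun _ => (N : ℝ)⁻¹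

lemma centringCoeff_dotProduct_single {N : ℕ} (i j : Fin N) :
    centringCoeff i ⬝ᵥ Pi.single j 1 = (if i = j then 1 else 0) - (N : ℝ)⁻¹ := by
  simp [centringCoeff, Pi.single_apply, eq_comm]

/-- The centring coefficients are the rows of the orthogonal projection I - 11ᵀ/N, so they have the
same inner products with one another as with the unit vectors. -/
lemma centringCoeff_dotProduct {N : ℕ} (i j : Fin N) :
    centringCoeff i ⬝ᵥ centringCoeff j = (if i = j then 1 else 0) - (N : ℝ)⁻¹ := by
  have : (N : ℝ) ≠ 0 := by exact_mod_cast i.pos.ne'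
  have h : centringCoeff j = Pi.single j 1 - fun _ => (N : ℝ)⁻¹ := rfl
  rw [h, dotProduct_sub, centringCoeff_dotProduct_single]
  simp [dotProduct, centringCoeff, ← Finset.sum_mul, Finset.sum_sub_distrib, this]

lemma rowComb_centringCoeff {N : ℕ} {ι : Type*} (i : Fin N) (u : Fin N → ι → ℝ) (j : ι) :
    rowComb (centringCoeff i) u j = u i j - (N : ℝ)⁻¹ * ∑ k, u k j := by
  simp [rowComb, centringCoeff, sub_mul, Finset.sum_sub_distrib, Pi.single_apply, Finset.mul_sum]

/-- Expanding the product gives four second moments. With G = I - 11ᵀ/N they contribute G_ij^k +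
δ_ij - 2 G_ij^k, because a centred row has inner product G_ij with a centred row and with a unit
vector alike. -/
lemma integral_centring_mul {Ω : Type*} [MeasurableSpace Ω] {P : Measure Ω} {N : ℕ}
    {Q : (Fin N → ℝ) → Ω → ℝ} (hQ : ∀ α, HasMoments (Q α) P) {k : ℕ} (hk : k ≠ 0) {c : ℝ}
    (hc : 0 < c) (h : ∀ α β, ∫ ω, Q α ω * Q β ω ∂P = (α ⬝ᵥ β) ^ k * c) (i j : Fin N) :
    ∫ ω, (Q (centringCoeff i) ω / √c - Q (Pi.single i 1) ω / √c) *
      (Q (centringCoeff j) ω / √c - Q (Pi.single j 1) ω / √c) ∂P =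
      (if i = j then 1 else 0) - ((if i = j then 1 else 0) - (N : ℝ)⁻¹) ^ k := by
  have hs : √c * √c = c := Real.mul_self_sqrt hc.le
  have e : ∀ ω, (Q (centringCoeff i) ω / √c - Q (Pi.single i 1) ω / √c) *
      (Q (centringCoeff j) ω / √c - Q (Pi.single j 1) ω / √c) =
      ((Q (centringCoeff i) ω * Q (centringCoeff j) ω + Q (Pi.single i 1) ω * Q (Pi.single j 1) ω) -
      (Q (centringCoeff i) ω * Q (Pi.single j 1) ω + Q (centringCoeff j) ω * Q (Pi.single i 1) ω)) /
        c := by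
    intro ω
    rw [← sub_div, ← sub_div, div_mul_div_comm, hs]
    ring
  have hi : ∀ α β, Integrable (fun ω => Q α ω * Q β ω) P := fun α β =>
    ((hQ α).mul (hQ β)).integrable
  simp only [e]
  rw [integral_div, integral_sub (integrable_fun_add (hi _ _) (hi _ _))
      (integrable_fun_add (hi _ _) (hi _ _)),
    integral_add (hi _ _) (hi _ _), integral_add (hi _ _) (hi _ _), h, h, h, h,
    centringCoeff_dotProduct, centringCoeff_dotProduct_single, centringCoeff_dotProduct_single,
    single_one_dotProduct, Pi.single_apply, ite_pow, one_pow, zero_pow hk, div_eq_iff hc.ne']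
  simp only [eq_comm (a := j)]
  ring

lemma IsStandardSample.integral_sq_sum_le {Ω : Type*} [MeasurableSpace Ω] {P : Measure Ω}
    [IsProbabilityMeasure P] {N : ℕ} {e v : Fin N → Ω → ℝ} {K : ℝ}
    (h : IsStandardSample e v K P) :
    ∫ ω, ((√N)⁻¹ * ∑ i, e i ω) ^ 2 ∂P ≤ 1 ∧ ∫ ω, ((√N)⁻¹ * ∑ i, v i ω) ^ 2 ∂P ≤ 1 := by
  have key : ∀ {g : Fin N → Ω → ℝ}, ∫ ω, ((N : ℝ)⁻¹ * ∑ i, g i ω) ^ 2 ∂P ≤ 1 * (N : ℝ)⁻¹ →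
      ∫ ω, ((√N)⁻¹ * ∑ i, g i ω) ^ 2 ∂P ≤ 1 := by
    intro g hg
    rcases N.eq_zero_or_pos with rfl | hN
    · simp
    have hN0 : (0 : ℝ) < N := by exact_mod_cast hN
    have : ∀ ω, ((√N)⁻¹ * ∑ i, g i ω) ^ 2 = N * ((N : ℝ)⁻¹ * ∑ i, g i ω) ^ 2 := fun ω => by
      rw [mul_pow, mul_pow, inv_pow, Real.sq_sqrt hN0.le]
      field_simp
    simp only [this]
    rw [integral_const_mul]
    calc (N : ℝ) * ∫ ω, ((N : ℝ)⁻¹ * ∑ i, g i ω) ^ 2 ∂P ≤ N * (1 * (N : ℝ)⁻¹) := by gcongr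
      _ = 1 := by field_simp
  exact ⟨key (integral_sq_mean_le (fun i => memLp_two_of_four (h.memLp_fst i))
      (h.indep.comp (g := fun _ q => q.1) fun _ => by fun_prop) h.mean_fst fun i => (h.sq_fst i).le),
    key (integral_sq_mean_le (fun i => memLp_two_of_four (h.memLp_snd i))
      (h.indep.comp (g := fun _ q => q.2) fun _ => by fun_prop) h.mean_snd fun i => (h.sq_snd i).le)⟩

/-- Convergence of the empirical likelihood ratio of a perturbed triangular array of standardized
pairs. -/
theorem tendstoInDistribution_elRatio {Ω : ℕ → Type*} [∀ n, MeasurableSpace (Ω n)]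
    {P : ∀ n, Measure (Ω n)} [∀ n, IsProbabilityMeasure (P n)] {N : ℕ → ℕ}
    (hN : Tendsto N atTop atTop) {e v d f : ∀ n, Fin (N n) → Ω n → ℝ} {K c : ℝ}
    (hem : ∀ n i, AEMeasurable (e n i) (P n)) (hvm : ∀ n i, AEMeasurable (v n i) (P n))
    (h : ∀ᶠ n in atTop, IsStandardSample (e n) (v n) K (P n))
    (hR : ∀ᶠ n in atTop,
      Integrable (fun ω => remainder (e n · ω) (v n · ω) (d n · ω) (f n · ω)) (P n) ∧
      ∫ ω, remainder (e n · ω) (v n · ω) (d n · ω) (f n · ω) ∂(P n) ≤ c * (N n : ℝ)⁻¹)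
    {L : ∀ n, Ω n → ENNReal} (hLm : ∀ n, AEMeasurable (L n) (P n))
    (hL : ∀ᶠ n in atTop, ∀ ω,
      L n ω = elRatio fun i => (e n i ω + d n i ω, v n i ω + f n i ω)) :
    TendstoInDistribution (fun n ω => -2 * ENNReal.log (L n ω)) atTop (fun z : ℝ => (z : EReal)) P
      (chiSquared 2) := by
  have hm : ∀ n, AEMeasurable (fun ω => -2 * ENNReal.log (L n ω)) (P n) := fun n =>
    (ENNReal.measurable_log.comp_aemeasurable (hLm n)).const_mul _
  have hcm : Measurable (fun z : ℝ => (z : EReal)) := measurable_coe_real_ereal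
  refine ⟨hm, hcm.aemeasurable, ?_⟩
  refine ProbabilityMeasure.tendsto_iff_forall_integral_tendsto.2 fun φ => ?_
  change Tendsto (fun n => ∫ x, φ x ∂(P n).map fun ω => -2 * ENNReal.log (L n ω)) atTop
    (𝓝 (∫ x, φ x ∂(chiSquared 2).map fun z : ℝ => (z : EReal)))
  rw [integral_map hcm.aemeasurable φ.continuous.aestronglyMeasurable]
  simp only [fun n => integral_map (hm n) φ.continuous.aestronglyMeasurable]
  have hφM : ∀ x, |φ x| ≤ ‖φ‖ := fun x => φ.norm_coe_le_norm x
  set M := ‖φ‖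
  have hM : 0 ≤ M := norm_nonneg _
  have hg : Continuous fun z : ℝ => φ (z : EReal) := φ.continuous.comp continuous_coe_real_ereal
  have hclt := tendsto_integral_chiSquared hN hem hvm h hg fun x => hφM x
  -- The test function at the squared norm has the right limit, so it remains to compare the two
  -- expectations.
  refine hclt.congr_dist ?_
  rw [Metric.tendsto_nhds]
  intro ε hε
  -- The squared norm has mean at most 2, so this C makes the truncation at C² cost at most ε/4.
  obtain ⟨C, hC1, hC⟩ : ∃ C : ℝ, 1 ≤ C ∧ 2 * M * (2 / C ^ 2) ≤ ε / 4 := by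
    refine ⟨16 * M / ε + 1, by have : 0 ≤ 16 * M / ε := by positivity
                               linarith, ?_⟩
    set D := 16 * M / ε with hD
    have hD0 : 0 ≤ D := by positivity
    have hMD : M = D * ε / 16 := by rw [hD]; field_simp
    have h1 : 2 * M * (2 / (D + 1) ^ 2) = ε / 4 * (D / (D + 1) ^ 2) := by rw [hMD]; field_simp; ring
    rw [h1]
    refine mul_le_of_le_one_right (by positivity) ?_
    rw [div_le_one (by positivity)]
    nlinarith
  -- After truncation both the squared norm, at most C², and the statistic, within 1 of it, lie in
  -- this interval.
  obtain ⟨δ, hδ, hδg⟩ := Metric.uniformContinuousOn_iff_le.1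
    ((isCompact_Icc (a := (-1 : ℝ)) (b := 2 * C ^ 2 + 1)).uniformContinuousOn_of_continuous
      hg.continuousOn) (ε / 4) (by positivity)
  obtain ⟨η, hη, hη1, hη2, hη3⟩ : ∃ η : ℝ, 0 < η ∧ (C + 1) * (6 * η) ≤ 1 / 16 ∧
      1300 * (C + 1) ^ 3 * η ≤ 1 ∧ 1300 * (C + 1) ^ 3 * η ≤ δ := by
    have hc3 : C + 1 ≤ (C + 1) ^ 3 := le_self_pow₀ (by linarith) (by norm_num)
    have h3 : 0 < 1300 * (C + 1) ^ 3 := by positivity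
    have h4 : 1300 * (C + 1) ^ 3 * (min 1 δ / (1300 * (C + 1) ^ 3)) = min 1 δ := by field_simp
    have h5 : 0 < min 1 δ / (1300 * (C + 1) ^ 3) := by positivity
    refine ⟨_, h5, ?_, h4.trans_le (min_le_left _ _), h4.trans_le (min_le_right _ _)⟩
    have h6 := h4.trans_le (min_le_left _ _)
    have h7 := mul_le_mul_of_nonneg_right hc3 h5.le
    linarith
  have hsmall : ∀ᶠ n in atTop, 2 * M / η ^ 4 * (c * (N n : ℝ)⁻¹) < ε / 4 := by
    have : Tendsto (fun n => 2 * M / η ^ 4 * (c * (N n : ℝ)⁻¹)) atTop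
        (𝓝 (2 * M / η ^ 4 * (c * 0))) :=
      ((tendsto_inv_atTop_zero.comp (tendsto_natCast_atTop_atTop.comp hN)).const_mul c).const_mul _
    rw [mul_zero, mul_zero] at this
    exact this.eventually_lt_const (by positivity)
  filter_upwards [h, hR, hL, hsmall, hN.eventually_gt_atTop 0] with n hn hRn hLn hsn hNn
  rw [Real.dist_0_eq_abs, abs_of_nonneg dist_nonneg]
  set t : Ω n → ℝ := fun ω => (√(N n))⁻¹ * ∑ i, e n i ω
  set u : Ω n → ℝ := fun ω => (√(N n))⁻¹ * ∑ i, v n i ω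
  set Z : Ω n → ℝ := fun ω => remainder (e n · ω) (v n · ω) (d n · ω) (f n · ω)
  have ht : MemLp t 2 (P n) :=
    (memLp_finsetSum _ fun i _ => memLp_two_of_four (hn.memLp_fst i)).const_mul _
  have hu : MemLp u 2 (P n) :=
    (memLp_finsetSum _ fun i _ => memLp_two_of_four (hn.memLp_snd i)).const_mul _
  -- Markov's inequality in pointwise form: where the squared norm or the remainder is large, the
  -- trivial bound 2M is dominated by a multiple of that variable, and elsewhere uniform continuity
  -- applies.
  have hpt : ∀ ω, |φ ((t ω ^ 2 + u ω ^ 2 : ℝ) : EReal) - φ (-2 * ENNReal.log (L n ω))| ≤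
      ε / 4 + 2 * M / C ^ 2 * (t ω ^ 2 + u ω ^ 2) + 2 * M / η ^ 4 * Z ω := by
    intro ω
    have hZ0 : 0 ≤ Z ω := remainder_nonneg _ _ _ _
    have p1 : 0 ≤ 2 * M / C ^ 2 * (t ω ^ 2 + u ω ^ 2) := by positivity
    have p2 : 0 ≤ 2 * M / η ^ 4 * Z ω := by positivity
    have triv : |φ ((t ω ^ 2 + u ω ^ 2 : ℝ) : EReal) - φ (-2 * ENNReal.log (L n ω))| ≤ 2 * M :=
      (abs_sub _ _).trans (by
        have := hφM ((t ω ^ 2 + u ω ^ 2 : ℝ) : EReal)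
        have := hφM (-2 * ENNReal.log (L n ω))
        linarith)
    rcases lt_or_ge (C ^ 2) (t ω ^ 2 + u ω ^ 2) with h1 | h1
    · have : 2 * M ≤ 2 * M / C ^ 2 * (t ω ^ 2 + u ω ^ 2) := by
        rw [div_mul_eq_mul_div, le_div_iff₀ (by positivity)]
        gcongr
      linarith
    rcases lt_or_ge (η ^ 4) (Z ω) with h2 | h2
    · have : 2 * M ≤ 2 * M / η ^ 4 * Z ω := by
        rw [div_mul_eq_mul_div, le_div_iff₀ (by positivity)]
        gcongr
      linarith
    obtain ⟨r, hr, hrb⟩ := exists_neg_two_mul_log_elRatio_add hNn hC1 hη hη1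
      (abs_le_of_sq_le_sq (by linarith [sq_nonneg (u ω)]) (by positivity) : |t ω| ≤ C)
      (abs_le_of_sq_le_sq (by linarith [sq_nonneg (t ω)]) (by positivity) : |u ω| ≤ C) h2
    rw [hLn ω, hr]
    have hrb' : |r - (t ω ^ 2 + u ω ^ 2)| ≤ 1300 * (C + 1) ^ 3 * η := hrb
    have hr1 := abs_le.1 (hrb'.trans hη2)
    have hT0 : 0 ≤ t ω ^ 2 + u ω ^ 2 := by positivity
    have := hδg (t ω ^ 2 + u ω ^ 2) ⟨by linarith, by linarith [sq_nonneg C]⟩ r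
      ⟨by linarith, by linarith [sq_nonneg C]⟩
      (by rw [dist_comm]; exact hrb'.trans hη3)
    rw [Real.dist_eq] at this
    linarith
  have hi1 : Integrable (fun ω => φ ((t ω ^ 2 + u ω ^ 2 : ℝ) : EReal)) (P n) := by
    refine Integrable.of_bound (C := M) ?_ (Eventually.of_forall fun ω => hφM _)
    exact hg.comp_aestronglyMeasurable
      ((ht.aestronglyMeasurable.pow 2).add (hu.aestronglyMeasurable.pow 2))
  have hi2 : Integrable (fun ω => φ (-2 * ENNReal.log (L n ω))) (P n) := by
    refine Integrable.of_bound (C := M) ?_ (Eventually.of_forall fun ω => hφM _)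
    exact (φ.continuous.measurable.comp_aemeasurable (hm n)).aestronglyMeasurable
  have i1 : Integrable (fun ω => ε / 4 + 2 * M / C ^ 2 * (t ω ^ 2 + u ω ^ 2)) (P n) :=
    (integrable_const _).add ((ht.integrable_sq.add hu.integrable_sq).const_mul _)
  have i2 : Integrable (fun ω => 2 * M / η ^ 4 * Z ω) (P n) := hRn.1.const_mul _
  calc dist (∫ ω, φ ((t ω ^ 2 + u ω ^ 2 : ℝ) : EReal) ∂(P n))
        (∫ ω, φ (-2 * ENNReal.log (L n ω)) ∂(P n))
      = |∫ ω, (φ ((t ω ^ 2 + u ω ^ 2 : ℝ) : EReal) - φ (-2 * ENNReal.log (L n ω))) ∂(P n)| := by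
        rw [integral_sub hi1 hi2, Real.dist_eq]
    _ ≤ ∫ ω, |φ ((t ω ^ 2 + u ω ^ 2 : ℝ) : EReal) - φ (-2 * ENNReal.log (L n ω))| ∂(P n) :=
        abs_integral_le_integral_abs
    _ ≤ ∫ ω, (ε / 4 + 2 * M / C ^ 2 * (t ω ^ 2 + u ω ^ 2) + 2 * M / η ^ 4 * Z ω) ∂(P n) :=
        integral_mono (hi1.sub hi2).abs (i1.add i2) hpt
    _ = ε / 4 + 2 * M / C ^ 2 * (∫ ω, t ω ^ 2 ∂(P n) + ∫ ω, u ω ^ 2 ∂(P n)) +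
          2 * M / η ^ 4 * ∫ ω, Z ω ∂(P n) := by
        rw [integral_add i1 i2, integral_add (integrable_const _)
          ((integrable_fun_add ht.integrable_sq hu.integrable_sq).const_mul _), integral_const_mul,
          integral_const_mul, integral_add ht.integrable_sq hu.integrable_sq]
        simp
    _ ≤ ε / 4 + 2 * M / C ^ 2 * (1 + 1) + 2 * M / η ^ 4 * (c * (N n : ℝ)⁻¹) := by
        have := hn.integral_sq_sum_le.1
        have := hn.integral_sq_sum_le.2
        have := hRn.2
        gcongr
    _ < ε := by
        have : 2 * M / C ^ 2 * (1 + 1) = 2 * M * (2 / C ^ 2) := by ring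
        linarith

namespace IsGaussianSamplePair

variable {Ω : Type*} [MeasurableSpace Ω] {P : Measure Ω} {N : ℕ} {ι : Type*} [Fintype ι]
  [DecidableEq ι] {G : Submodule ℝ (Ω → ℝ)} {S : Matrix ι ι ℝ} {X Y : Ω → Fin N → ι → ℝ}
  {A B : Matrix ι ι ℝ}

/-- The remainder terms for the statistics of the observations centred at the sample means. -/
theorem integral_remainder_le (h : IsGaussianSamplePair G S X Y P) (hAh : A.IsHermitian)
    (hA : ∀ j k, A j k * S j k = 0) (hBh : B.IsHermitian) (hB : ∀ j k, B j k * S j k = 0)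
    (hA0 : 0 < crossVar S A) (hB0 : 0 < quadVar S B) :
    let e := fun α ω => crossForm A (rowComb α (X ω)) (rowComb α (Y ω)) / √(crossVar S A)
    let v := fun α ω => (quadForm B (rowComb α (X ω)) + quadForm B (rowComb α (Y ω))) /
      √(2 * quadVar S B)
    let R := fun ω => remainder (fun i => e (Pi.single i 1) ω) (fun i => v (Pi.single i 1) ω)
      (fun i => e (centringCoeff i) ω - e (Pi.single i 1) ω)
      (fun i => v (centringCoeff i) ω - v (Pi.single i 1) ω)
    Integrable R P ∧ ∫ ω, R ω ∂P ≤ (12 + 5 * chaosConst ^ 2) * (N : ℝ)⁻¹ := by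
  intro e v R
  have hP := h.isProbabilityMeasure
  have hs := h.isStandardSample hAh hA hBh hB hA0 hB0
  have hs' : IsStandardSample (fun i => e (Pi.single i 1)) (fun i => v (Pi.single i 1))
      (chaosConst ^ 2) P := by
    simpa only [e, v, rowComb_single] using hs
  have he : ∀ α, HasMoments (e α) P := fun α => (h.hasMoments_crossForm A α).div_const _
  have hv : ∀ α, HasMoments (v α) P := fun α => (h.hasMoments_quadForm_add B α).div_const _
  exact BandTest.integral_remainder_le hs' (fun i => he _) (fun i => hv _)
    (fun i => (he _).sub (he _)) (fun i => (hv _).sub (hv _))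
    (integral_centring_mul (h.hasMoments_crossForm A) (by norm_num) hA0
      (h.integral_crossForm_mul hA))
    (integral_centring_mul (h.hasMoments_quadForm_add B) (by norm_num) (by positivity)
      (h.integral_quadForm_add_mul hB))

end IsGaussianSamplePair

end BandTest

/-! ### The statistics of the band test as forms in a Gaussian sample. -/

namespace BandTest

section Matrices

variable {p : ℕ} (τ : ℕ)

/-- The matrix of the indicators `I(|i - j| ≥ τ)`. -/
def offBandIndicator (p τ : ℕ) : Matrix (Fin p) (Fin p) ℝ := offBand τ (Matrix.of fun _ _ => 1)

/-- The matrix of the indicators of the corner blocks. -/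
noncomputable def cornerIndicator (p τ : ℕ) : Matrix (Fin p) (Fin p) ℝ := corner τ (Matrix.of fun _ _ => 1)

lemma offBand_apply (M : Matrix (Fin p) (Fin p) ℝ) (j k : Fin p) :
    offBand τ M j k = offBandIndicator p τ j k * M j k := by
  simp [offBand, offBandIndicator]

lemma corner_apply (M : Matrix (Fin p) (Fin p) ℝ) (j k : Fin p) :
    corner τ M j k = cornerIndicator p τ j k * M j k := by
  simp only [corner, cornerIndicator, Matrix.of_apply, ite_mul, one_mul, zero_mul]

lemma offBandIndicator_comm (j k : Fin p) :
    offBandIndicator p τ j k = offBandIndicator p τ k j := by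
  simp only [offBandIndicator, offBand, Matrix.of_apply, abs_sub_comm (j : ℤ)]

lemma cornerIndicator_comm (j k : Fin p) :
    cornerIndicator p τ j k = cornerIndicator p τ k j := by
  simp only [cornerIndicator, corner, Matrix.of_apply, or_comm]

lemma isHermitian_offBandIndicator : (offBandIndicator p τ).IsHermitian := by
  ext j k
  simp [offBandIndicator_comm τ k j]

lemma isHermitian_cornerIndicator : (cornerIndicator p τ).IsHermitian := by
  ext j k
  simp [cornerIndicator_comm τ k j]

lemma offBandIndicator_mul_self (j k : Fin p) :
    offBandIndicator p τ j k * offBandIndicator p τ j k = offBandIndicator p τ j k := by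
  simp only [offBandIndicator, offBand, Matrix.of_apply]
  split_ifs <;> simp

lemma offBandIndicator_nonneg (j k : Fin p) : 0 ≤ offBandIndicator p τ j k := by
  simp only [offBandIndicator, offBand, Matrix.of_apply]
  split_ifs <;> simp

/-- The corner blocks lie off the band. -/
lemma cornerIndicator_mul_offBandIndicator (j k : Fin p) :
    cornerIndicator p τ j k * offBandIndicator p τ j k = cornerIndicator p τ j k := by
  have key : ∀ a b : Fin p, ((a : ℕ) : ℝ) + 1 ≤ ((p : ℝ) - τ) / 2 →
      ((p : ℝ) + τ) / 2 < ((b : ℕ) : ℝ) + 1 → (τ : ℤ) ≤ (b : ℤ) - (a : ℤ) := by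
    intro a b h1 h2
    have : ((τ : ℤ) : ℝ) < (((b : ℤ) - (a : ℤ) : ℤ) : ℝ) := by push_cast; linarith
    exact_mod_cast this.le
  simp only [cornerIndicator, corner, offBandIndicator, offBand, Matrix.of_apply]
  split_ifs with h1 h2
  · simp
  · refine absurd ?_ h2
    rcases h1 with h | h
    · exact (key _ _ h.1 h.2).trans (by rw [abs_sub_comm]; exact le_abs_self _)
    · exact (key _ _ h.1 h.2).trans (le_abs_self _)
  · simp
  · simp

lemma corner_eq_zero_of_offBand {M : Matrix (Fin p) (Fin p) ℝ} (h : offBand τ M = 0) :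
    corner τ M = 0 := by
  ext j k
  rw [corner_apply, ← cornerIndicator_mul_offBandIndicator, mul_assoc, ← offBand_apply, h]
  simp

end Matrices

section Statistics

variable {n N p : ℕ} {τ : ℕ}

/-- The deviations of the observations from `m`. -/
def deviations (m : EuclideanSpace ℝ (Fin p)) (x : Fin N → EuclideanSpace ℝ (Fin p)) :
    Fin N → Fin p → ℝ :=
  fun i j => x i j - m j

/-- The centring coefficients sum to zero, so the unknown mean m cancels; this lets the deviations
from the true mean represent the statistic. -/
lemma rowComb_centringCoeff_deviations (m : EuclideanSpace ℝ (Fin p))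
    (x : Fin N → EuclideanSpace ℝ (Fin p)) (i : Fin N) (j : Fin p) :
    rowComb (centringCoeff i) (deviations m x) j = x i j - sampleMean x j := by
  have : (N : ℝ) ≠ 0 := by exact_mod_cast i.pos.ne'
  rw [rowComb_centringCoeff]
  simp only [deviations, Finset.sum_sub_distrib, Finset.sum_const, Finset.card_univ,
    Fintype.card_fin, nsmul_eq_mul, sampleMean, PiLp.smul_apply, WithLp.ofLp_sum, Finset.sum_apply,
    smul_eq_mul]
  field_simp
  ring

lemma centeredOuter_apply (m : EuclideanSpace ℝ (Fin p))
    (x : Fin N → EuclideanSpace ℝ (Fin p)) (i : Fin N) (j k : Fin p) :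
    centeredOuter x i j k = rowComb (centringCoeff i) (deviations m x) j *
      rowComb (centringCoeff i) (deviations m x) k := by
  simp [centeredOuter, outer, rowComb_centringCoeff_deviations]

variable {S : Matrix (Fin p) (Fin p) ℝ}

/-- The trace pairs entry (j, k) of one matrix with (k, j) of the other; the indicator is symmetric
and idempotent, so its two copies merge into one. -/
lemma eStar_eq_crossForm (hS : offBand τ S = 0) (m : EuclideanSpace ℝ (Fin p))
    (x : Fin n → EuclideanSpace ℝ (Fin p)) (i : Fin (n / 2)) :
    eStar τ S x i = crossForm (offBandIndicator p τ)
      (rowComb (centringCoeff i) (deviations m (firstHalf x)))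
      (rowComb (centringCoeff i) (deviations m (secondHalf x))) := by
  simp only [eStar, hS, smul_zero, sub_zero, Matrix.trace, Matrix.diag_apply, Matrix.mul_apply,
    crossForm, offBand_apply, centeredOuter_apply m]
  refine Finset.sum_congr rfl fun j _ => Finset.sum_congr rfl fun k _ => ?_
  rw [offBandIndicator_comm τ k j]
  linear_combination (rowComb (centringCoeff i) (deviations m (firstHalf x)) j *
    rowComb (centringCoeff i) (deviations m (firstHalf x)) k *
    (rowComb (centringCoeff i) (deviations m (secondHalf x)) j *
      rowComb (centringCoeff i) (deviations m (secondHalf x)) k)) *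
    offBandIndicator_mul_self τ j k

lemma vStar_eq_quadForm_add (hS : corner τ S = 0) (m : EuclideanSpace ℝ (Fin p))
    (x : Fin n → EuclideanSpace ℝ (Fin p)) (i : Fin (n / 2)) :
    vStar τ S x i =
      quadForm (cornerIndicator p τ) (rowComb (centringCoeff i) (deviations m (firstHalf x))) +
      quadForm (cornerIndicator p τ) (rowComb (centringCoeff i) (deviations m (secondHalf x))) := by
  simp only [vStar, oneFormOne, hS, smul_zero, sub_zero, Matrix.add_apply, corner_apply,
    centeredOuter_apply m, quadForm, Finset.sum_add_distrib]

lemma vKnown_eq_quadForm_add (hS : corner τ S = 0) (m : EuclideanSpace ℝ (Fin p))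
    (x : Fin n → EuclideanSpace ℝ (Fin p)) (i : Fin (n / 2)) :
    vKnown τ m S x i = quadForm (cornerIndicator p τ) (deviations m (firstHalf x) i) +
      quadForm (cornerIndicator p τ) (deviations m (secondHalf x) i) := by
  simp only [vKnown, oneFormOne, hS, smul_zero, sub_zero, Matrix.add_apply, corner_apply,
    outer, Matrix.of_apply, deviations, quadForm, Finset.sum_add_distrib]

end Statistics

lemma hasLaw_sub_multivariateGaussian {Ω ι : Type*} [MeasurableSpace Ω] {P : Measure Ω}
    [Fintype ι] [DecidableEq ι] {m : EuclideanSpace ℝ ι} {S : Matrix ι ι ℝ}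
    {X : Ω → EuclideanSpace ℝ ι} (hX : HasLaw X (multivariateGaussian m S) P) :
    HasLaw (fun ω => X ω - m) (multivariateGaussian 0 S) P := by
  refine HasLaw.comp (Y := fun x => x - m) ⟨by fun_prop, ?_⟩ hX
  rw [multivariateGaussian, multivariateGaussian, Measure.map_map (by fun_prop) (by fun_prop)]
  congr 1
  ext x
  simp

section Sample

variable {Ω : Type*} [MeasurableSpace Ω] {P : Measure Ω} {n p : ℕ}
  {m : EuclideanSpace ℝ (Fin p)} {S : Matrix (Fin p) (Fin p) ℝ}
  {X : Fin n → Ω → EuclideanSpace ℝ (Fin p)}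

lemma integral_deviations_mul (hS : S.PosSemidef)
    (hlaw : ∀ i, HasLaw (X i) (multivariateGaussian m S) P) (hindep : iIndepFun X P)
    (i i' : Fin n) (j k : Fin p) :
    ∫ ω, (X i ω j - m j) * (X i' ω k - m k) ∂P = if i = i' then S j k else 0 := by
  have hl := fun i => hasLaw_sub_multivariateGaussian (hlaw i)
  split_ifs with h
  · subst h
    rw [← integral_mul_multivariateGaussian hS j k]
    exact (hl i).integral_comp (f := fun x => x j * x k)
      (Continuous.aestronglyMeasurable (by fun_prop))
  · have h0 : ∫ ω, (X i ω j - m j) ∂P = 0 := by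
      exact ((hl i).integral_comp (f := fun x => x j)
        (Continuous.aestronglyMeasurable (by fun_prop))).trans
        (integral_eval_multivariateGaussian 0 hS j)
    rw [(hindep.indepFun h).integral_fun_comp_mul_comp (f := fun x => x j - m j)
      (g := fun x => x k - m k) (hlaw i).aemeasurable (hlaw i').aemeasurable
      (Continuous.aestronglyMeasurable (by fun_prop))
      (Continuous.aestronglyMeasurable (by fun_prop)), h0, zero_mul]

/-- The two halves of a normal sample. -/
theorem isGaussianSamplePair (hS : S.PosSemidef)
    (hlaw : ∀ i, HasLaw (X i) (multivariateGaussian m S) P) (hindep : iIndepFun X P) :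
    IsGaussianSamplePair
      (Submodule.span ℝ (Set.range fun (q : Fin n × Fin p) ω => X q.1 ω q.2 - m q.2)) S
      (fun ω => deviations m (firstHalf fun i => X i ω))
      (fun ω => deviations m (secondHalf fun i => X i ω)) P := by
  have hl := fun i => hasLaw_sub_multivariateGaussian (hlaw i)
  have hmem : ∀ (i : Fin n) (j : Fin p), (fun ω => X i ω j - m j) ∈
      Submodule.span ℝ (Set.range fun (q : Fin n × Fin p) ω => X q.1 ω q.2 - m q.2) := fun i j =>
    Submodule.subset_span ⟨(i, j), rfl⟩
  have hc := integral_deviations_mul hS hlaw hindep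
  refine ⟨IsCenteredGaussianSpace.span ?_ fun q => ?_, hS, fun i j => hmem _ _, fun i j => hmem _ _,
    fun i i' j k => (hc _ _ _ _).trans ?_, fun i i' j k => (hc _ _ _ _).trans ?_,
    fun i i' j k => (hc _ _ _ _).trans ?_, fun i => hl _, fun i => hl _⟩
  -- Independence of the Gaussian observations makes the whole sample jointly Gaussian.
  · have h1 : HasGaussianLaw (fun ω i => X i ω - m) P :=
      iIndepFun.hasGaussianLaw (fun i => (hl i).hasGaussianLaw)
        (hindep.comp (g := fun _ x => x - m) fun _ => by fun_prop)
    let L : (Fin n → EuclideanSpace ℝ (Fin p)) →L[ℝ] (Fin n × Fin p → ℝ) :=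
      ContinuousLinearMap.pi fun q => (EuclideanSpace.proj q.2).comp (ContinuousLinearMap.proj q.1)
    exact h1.map L
  · exact ((hl q.1).integral_comp (f := fun x => x q.2)
      (Continuous.aestronglyMeasurable (by fun_prop))).trans
      (integral_eval_multivariateGaussian 0 hS q.2)
  · simp [Fin.ext_iff]
  · simp [Fin.ext_iff]
  -- The halves are disjoint: an index of the first is below N, one of the second is at least N.
  · rw [if_neg]
    intro h
    have := congrArg Fin.val h
    simp only at this
    omega

/-- The statistic is measurable in the sample. -/
lemma aemeasurable_L5 (hS : S.PosSemidef)
    (hlaw : ∀ i, HasLaw (X i) (multivariateGaussian m S) P) (hindep : iIndepFun X P) {τ : ℕ}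
    {S₀ : Matrix (Fin p) (Fin p) ℝ} (hS₀ : offBand τ S₀ = 0) :
    AEMeasurable (fun ω => L5 τ S₀ fun i => X i ω) P := by
  have h := isGaussianSamplePair hS hlaw hindep
  simp only [L5, eStar_eq_crossForm hS₀ m, vStar_eq_quadForm_add (corner_eq_zero_of_offBand τ hS₀) m]
  exact measurable_elRatio.comp_aemeasurable (aemeasurable_pi_lambda _ fun i =>
    (h.hasMoments_crossForm _ _).aemeasurable.prodMk (h.hasMoments_quadForm_add _ _).aemeasurable)

end Sample

/-- Positivity of the variance of `∑ A_{jk} x_j x_k y_j y_k`. -/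
lemma crossVar_pos {ι : Type*} [Fintype ι] {S A : Matrix ι ι ℝ} (hS : S.PosSemidef)
    (hd : ∀ i, 0 < S i i) (hA : ∀ j k, 0 ≤ A j k) {a b : ι} (hab : 0 < A a b) :
    0 < crossVar S A := by
  -- As A is nonnegative and the covariance enters squared, no cancellation can occur and the single
  -- diagonal term at (a, b) suffices.
  have h0 : ∀ q r : ι × ι, 0 ≤ A q.1 q.2 * A r.1 r.2 * wick S q r ^ 2 := fun q r =>
    mul_nonneg (mul_nonneg (hA _ _) (hA _ _)) (sq_nonneg _)
  have hw : 0 < wick S (a, b) (a, b) := by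
    have hS' : S b a = S a b := by simpa using hS.1.apply a b
    have hw' : wick S (a, b) (a, b) = S a a * S b b + S a b * S b a := rfl
    rw [hw', hS']
    exact add_pos_of_pos_of_nonneg (mul_pos (hd a) (hd b)) (mul_self_nonneg _)
  have h1 : 0 < A (a, b).1 (a, b).2 * A (a, b).1 (a, b).2 * wick S (a, b) (a, b) ^ 2 :=
    mul_pos (mul_pos hab hab) (pow_pos hw 2)
  refine h1.trans_le ((Finset.single_le_sum (fun r _ => h0 (a, b) r)
    (Finset.mem_univ (a, b))).trans ?_)
  exact Finset.single_le_sum (f := fun q : ι × ι => ∑ r : ι × ι,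
    A q.1 q.2 * A r.1 r.2 * wick S q r ^ 2)
    (fun q _ => Finset.sum_nonneg fun r _ => h0 q r) (Finset.mem_univ (a, b))

/-- Since τ < p, the entry in position (0, τ) exists and lies off the band. -/
lemma crossVar_offBandIndicator_pos {p τ : ℕ} (hτ : τ < p) {S : Matrix (Fin p) (Fin p) ℝ}
    (hS : S.PosSemidef) (hd : ∀ i, 0 < S i i) : 0 < crossVar S (offBandIndicator p τ) := by
  refine crossVar_pos hS hd (offBandIndicator_nonneg τ) (a := ⟨0, by omega⟩) (b := ⟨τ, hτ⟩) ?_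
  simp [offBandIndicator, offBand]

end BandTest

/-! ### Assembly of the theorem. -/

theorem mainTheorem5
    {Ω : ℕ → Type*} [∀ n, MeasurableSpace (Ω n)]
    (P : ∀ n, Measure (Ω n)) [∀ n, IsProbabilityMeasure (P n)]
    (p τ : ℕ → ℕ) (hτp : ∀ n, τ n < p n)
    -- the mean vectors and the covariance matrices
    (μ : ∀ n, EuclideanSpace ℝ (Fin (p n)))
    (S : ∀ n, Matrix (Fin (p n)) (Fin (p n)) ℝ) (hS : ∀ n, (S n).PosSemidef)
    -- for each `n`, a sample of `n` i.i.d. `N(μ, Σ)` random vectors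
    (X : ∀ n, Fin n → Ω n → EuclideanSpace ℝ (Fin (p n)))
    (hlaw : ∀ n i, HasLaw (X n i) (multivariateGaussian (μ n) (S n)) (P n))
    (hindep : ∀ n, iIndepFun (X n) (P n))
    (C₁ C₂ : ℝ) (hC₁ : 0 < C₁) (hC₁₂ : C₁ ≤ C₂)
    (hmin : (C₁ : EReal) ≤ liminf (fun n => ⨅ i, ((S n i i : ℝ) : EReal)) atTop)
    (hmax : limsup (fun n => ⨆ i, ((S n i i : ℝ) : EReal)) atTop ≤ (C₂ : EReal))
    (hτ : (fun n => (τ n : ℝ)) =o[atTop] fun n => Real.sqrt (∑ i, ∑ j, S n i j ^ 2))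
    -- the second estimating function is not degenerate
    (hv : ∀ᶠ n in atTop, ∀ i,
      0 < ∫ ω, BandTest.vKnown (τ n) (μ n) (S n) (fun k => X n k ω) i ^ 2 ∂P n)
    -- the null hypothesis
    (hH0 : ∀ n (i j : Fin (p n)), (τ n : ℤ) ≤ |(i : ℤ) - (j : ℤ)| → S n i j = 0)
    (S₀ : ∀ n, Matrix (Fin (p n)) (Fin (p n)) ℝ)
    (hS₀ : ∀ n, BandTest.offBand (τ n) (S₀ n) = 0) :
    TendstoInDistribution
      (fun n ω => -2 * ENNReal.log (BandTest.L5 (τ n) (S₀ n) fun k => X n k ω))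
      atTop (fun z : ℝ => (z : EReal)) P (BandTest.chiSquared 2) 
 := by
  have hN : Tendsto (fun n : ℕ => n / 2) atTop atTop :=
    Nat.tendsto_div_const_atTop (by norm_num)
  have hG := fun n => BandTest.isGaussianSamplePair (hS n) (hlaw n) (hindep n)
  have hA : ∀ n j k, BandTest.offBandIndicator (p n) (τ n) j k * S n j k = 0 := by
    intro n j k
    rw [← BandTest.offBand_apply]
    simp only [BandTest.offBand, Matrix.of_apply]
    split_ifs with h
    · exact hH0 n j k h
    · rfl
  have hS' : ∀ n, BandTest.corner (τ n) (S n) = 0 := fun n =>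
    BandTest.corner_eq_zero_of_offBand _ <| by
      ext j k
      rw [BandTest.offBand_apply, hA, Matrix.zero_apply]
  have hB : ∀ n j k, BandTest.cornerIndicator (p n) (τ n) j k * S n j k = 0 := fun n j k => by
    rw [← BandTest.corner_apply, hS', Matrix.zero_apply]
  have hdiag : ∀ᶠ n in atTop, ∀ i, 0 < S n i i := by
    have h0 : ((0 : ℝ) : EReal) < liminf (fun n => ⨅ i, ((S n i i : ℝ) : EReal)) atTop :=
      lt_of_lt_of_le (by exact_mod_cast hC₁) hmin
    filter_upwards [eventually_lt_of_lt_liminf h0] with n hn i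
    exact_mod_cast hn.trans_le (iInf_le _ i)
  have hA0 : ∀ᶠ n in atTop, 0 < BandTest.crossVar (S n) (BandTest.offBandIndicator (p n) (τ n)) :=
    hdiag.mono fun n hn => BandTest.crossVar_offBandIndicator_pos (hτp n) (hS n) hn
  -- The terms of `quadVar` need not be nonnegative, unlike those of `crossVar`. Positivity comes
  -- from nondegeneracy: twice `quadVar` is the second moment of the statistic with known mean.
  have hB0 : ∀ᶠ n in atTop, 0 < BandTest.quadVar (S n) (BandTest.cornerIndicator (p n) (τ n)) := by
    filter_upwards [hv, hN.eventually_gt_atTop 0] with n hn hNn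
    have h1 := hn ⟨0, hNn⟩
    have h2 := (hG n).integral_quadForm_add_mul (hB n) (Pi.single ⟨0, hNn⟩ 1)
      (Pi.single ⟨0, hNn⟩ 1)
    simp only [BandTest.vKnown_eq_quadForm_add (hS' n)] at h1
    simp only [BandTest.rowComb_single, ← sq, single_one_dotProduct, Pi.single_eq_same, one_pow,
      one_mul] at h2
    rw [h2] at h1
    linarith
  refine BandTest.tendstoInDistribution_elRatio hN (K := BandTest.chaosConst ^ 2)
    (c := 12 + 5 * BandTest.chaosConst ^ 2)
    (fun n i => (((hG n).hasMoments_crossForm (BandTest.offBandIndicator (p n) (τ n))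
      (Pi.single i 1)).div_const _).aemeasurable)
    (fun n i => (((hG n).hasMoments_quadForm_add (BandTest.cornerIndicator (p n) (τ n))
      (Pi.single i 1)).div_const _).aemeasurable) ?_
    ((hA0.and hB0).mono fun n hn => (hG n).integral_remainder_le
      (BandTest.isHermitian_offBandIndicator _) (hA n) (BandTest.isHermitian_cornerIndicator _)
      (hB n) hn.1 hn.2)
    (fun n => BandTest.aemeasurable_L5 (hS n) (hlaw n) (hindep n) (hS₀ n)) ?_
  · filter_upwards [hA0, hB0] with n hAn hBn
    simpa only [BandTest.rowComb_single] using (hG n).isStandardSample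
      (BandTest.isHermitian_offBandIndicator _) (hA n) (BandTest.isHermitian_cornerIndicator _)
      (hB n) hAn hBn
  · filter_upwards [hA0, hB0] with n hAn hBn ω
    have hs : √(BandTest.crossVar (S n) (BandTest.offBandIndicator (p n) (τ n))) ≠ 0 := by
      positivity
    have ht : √(2 * BandTest.quadVar (S n) (BandTest.cornerIndicator (p n) (τ n))) ≠ 0 := by
      positivity
    -- The uncentred statistic plus its centring error is the centred statistic, and the remaining
    -- normalization is removed by scale invariance.
    simp only [add_sub_cancel, BandTest.L5, BandTest.eStar_eq_crossForm (hS₀ n) (μ n),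
      BandTest.vStar_eq_quadForm_add (BandTest.corner_eq_zero_of_offBand _ (hS₀ n)) (μ n)]
    exact (BandTest.elRatio_div _ _ hs ht).symm
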